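/- Let $N\ge 2$ be an integer, let $\mu$ be the uniform probability measure on the unit sphere $\mathbb S^{N-1}\subset\mathbb R^N$, and let $\beta>N$. For $n\ge 1$ let $P_{n,\beta}$ be the Gibbs measure of the mean-field classical $N$-vector ($O(N)$) model on $(\mathbb S^{N-1})^n$, that is, the probability measure with density $$\frac{1}{Z_{n,\beta}}\exp\Big(\frac{\beta}{2n}\sum_{i=1}^n\sum_{j=1}^n\langle\sigma_i,\sigma_j\rangle\Big),\qquad \sigma=(\sigma_1,\dots,\sigma_n),$$ with respect to $\mu^{\otimes n}$, where $Z_{n,\beta}$ is the normalizing constant. Let $S_n=\sum_{i=1}^n\sigma_i$ with $\sigma\sim P_{n,\beta}$, let $I_\nu$ denote the modified Bessel function of the first kind, and put $$f(x)=\frac{I_{N/2}(x)}{I_{N/2-1}(x)},\qquad x>0.$$ Then the equation $x-\beta f(x)=0$ has a unique strictly positive solution $b$, the function $f$ is differentiable at $b$, and $$B^2:=\frac{4\beta^2}{(1-\beta f'(b))\,b^2}\Big[1-\frac{(N-1)f(b)}{b}-f(b)^2\Big]>0 .$$ Let $B=\sqrt{B^2}>0$ and $$W_n=\sqrt n\Big(\frac{\beta^2}{n^2b^2}|S_n|^2-1\Big).$$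 Then there is a constant $C>0$ depending only on $\beta$ such that for all $n\ge1$ $$\sup_{h}\big|\mathbb E\,h(W_n/B)-\mathbb E\,h(Z)\big|\le C n^{-1/2} \qquad\text{and}\qquad \sup_{z\in\mathbb R}\big|\mathbb P(W_n/B\le z)-\Phi(z)\big|\le C n^{-1/2},$$ where $Z$ is a standard normal random variable with distribution function $\Phi$, and the first supremum (the Wasserstein distance) is over all $h:\mathbb R\to\mathbb R$ with $\|h'\|\le 1$, i.e. over all $1$-Lipschitz functions $h$. -/

import Mathlib

open MeasureTheory ProbabilityTheory
open scoped ENNReal Nat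

noncomputable section

namespace ONModel

/-- The modified Bessel function of the first kind `I_ν(x)` for real order `ν` and `x > 0`:
`I_ν(x) = ∑_{m ≥ 0} (x/2)^(2m+ν) / (m! Γ(m+ν+1))`. -/
def besselI (ν x : ℝ) : ℝ :=
  ∑' m : ℕ, (x / 2) ^ (2 * (m : ℝ) + ν) / ((m ! : ℝ) * Real.Gamma ((m : ℝ) + ν + 1))

/-- `f(x) = I_{N/2}(x) / I_{N/2-1}(x)`, used only for `x > 0`. -/
def besselRatio (N : ℕ) (x : ℝ) : ℝ :=
  besselI ((N : ℝ) / 2) x / besselI ((N : ℝ) / 2 - 1) x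

/-- The unit sphere of `ℝ^N` with its Euclidean norm. -/
abbrev Sphere (N : ℕ) : Type := Metric.sphere (0 : EuclideanSpace ℝ (Fin N)) 1

/-- The uniform probability measure on the unit sphere: normalized surface measure. -/
def sphereUniform (N : ℕ) : Measure (Sphere N) :=
  ((volume : Measure (EuclideanSpace ℝ (Fin N))).toSphere Set.univ)⁻¹ •
    (volume : Measure (EuclideanSpace ℝ (Fin N))).toSphere

/-- Spin configurations on `n` sites. -/
abbrev Config (N n : ℕ) : Type := Fin n → Sphere N

/-- The product `P_n` of `n` copies of the uniform measure. -/
def productMeasure (N n : ℕ) : Measure (Config N n) :=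
  Measure.pi fun _ : Fin n => sphereUniform N

/-- The mean-field Hamiltonian `H_n(σ) = -(1/(2n)) ∑_{i,j} ⟨σ_i, σ_j⟩`. -/
def hamiltonian {N n : ℕ} (σ : Config N n) : ℝ :=
  -(1 / (2 * (n : ℝ))) * ∑ i : Fin n, ∑ j : Fin n,
    inner ℝ (σ i : EuclideanSpace ℝ (Fin N)) (σ j : EuclideanSpace ℝ (Fin N))

/-- The partition function `Z_{n,β} = ∫ exp(-β H_n) dP_n`. -/
def partitionFunction (N n : ℕ) (β : ℝ) : ℝ :=
  ∫ σ : Config N n, Real.exp (-β * hamiltonian σ) ∂(productMeasure N n)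

/-- The Gibbs measure `dP_{n,β} = Z_{n,β}⁻¹ exp(-β H_n) dP_n`. -/
def gibbs (N n : ℕ) (β : ℝ) : Measure (Config N n) :=
  (productMeasure N n).withDensity fun σ =>
    ENNReal.ofReal (Real.exp (-β * hamiltonian σ) / partitionFunction N n β)

/-- The total spin `S_n = ∑_i σ_i`. -/
def totalSpin {N n : ℕ} (σ : Config N n) : EuclideanSpace ℝ (Fin N) :=
  ∑ i : Fin n, (σ i : EuclideanSpace ℝ (Fin N))

/-- `W_n = √n (β² |S_n|² / (n² b²) - 1)`. -/
def rescaledSpin {N n : ℕ} (β b : ℝ) (σ : Config N n) : ℝ :=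
  Real.sqrt n * (β ^ 2 / ((n : ℝ) ^ 2 * b ^ 2) * ‖totalSpin σ‖ ^ 2 - 1)

/-- `B² = 4β² / ((1 - β f'(b)) b²) · [1 - (N-1) f(b)/b - f(b)²]`. -/
def varianceConst (N : ℕ) (β b : ℝ) : ℝ :=
  4 * β ^ 2 / ((1 - β * deriv (besselRatio N) b) * b ^ 2) *
    (1 - ((N : ℝ) - 1) * besselRatio N b / b - besselRatio N b ^ 2)

/-- The Wasserstein distance `sup |E h(X) - E h(Y)|` between laws on `ℝ` with finite first moment.
The condition `‖h'‖ ≤ 1` on the test functions is `1`-Lipschitz continuity, so that in particular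
every differentiable `h` with `|h'| ≤ 1` is a test function. The supremum is taken in `[0, ∞]`. -/
def wassersteinDist (μ ν : Measure ℝ) : ℝ≥0∞ :=
  ⨆ (h : ℝ → ℝ) (_ : LipschitzWith 1 h), ENNReal.ofReal |∫ x, h x ∂μ - ∫ x, h x ∂ν|

/-- The Kolmogorov distance `sup_z |P(X ≤ z) - P(Y ≤ z)|` between laws on `ℝ`. -/
def kolmogorovDist (μ ν : Measure ℝ) : ℝ≥0∞ :=
  ⨆ z : ℝ, ENNReal.ofReal |μ.real (Set.Iic z) - ν.real (Set.Iic z)|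

end ONModel

end

/-! The proof completes the square (Hubbard–Stratonovich). Attach to the spins a field `y` in ℝ^N
with joint weight exp(⟨y, S_n⟩ - n|y|²/(2β)) against Lebesgue measure times the product measure.
Integrating `y` out returns the Gibbs measure. Given the spins, `y` is Gaussian with mean β S_n/n
and variance of order 1/n. Given `y`, the spins are independent, each with the uniform law tilted by
exp⟨y, ·⟩. With M(x) = ∫ exp(x t) over the first coordinate t, the field has weight M(|y|)^n
exp(-n|y|²/(2β)), and f = M'/M is the Bessel ratio (`besselRatio_eq`).

Integration by parts on the sphere gives the modified Bessel equation for M. Hence f' = 1 - (N-1)f/x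
- f² (`tiltVar_riccati`), so the bracket in B² is v = f'(b), a variance and therefore positive. The
same equation yields x f' < f (`mul_tiltVar_lt`): f(x)/x strictly decreases. This single fact gives
uniqueness of b, the bound βv < 1, and the concentration of |y| at b with mean square error O(1/n)
(`exists_field_concentration`).

Fix a field y = x e with |e| = 1, and put c = 2β/b, κ = βv/b². Up to quadratic errors, W_n is c√n⟨e,
S_n/n - f(x)e⟩ + κ√n(x² - b²) (`rescaledSpin_linearization`). Resampling one spin produces
exchangeable pairs, and Stein's method (`stein_exchange`) shows that the first term, multiplied by
g(W_n), has expectation close to c²v E g'(W_n). So E[W g(W)] is κ√n(x² - b²) E g(W) + c²v E g'(W),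
with error O(1/√n + √n(x - b)²) (`fixed_field_estimate`).

Now average over the field. The conditional mean of |y|² given the spins is β²|S_n/n|² + O(1/n), and
b²W_n = √n(β²|S_n/n|² - b²), so the field term turns into βv E[W g(W)]. Thus (1 - βv) E[W g(W)] =
c²v E g'(W) + O(1/√n) under the Gibbs measure (`gibbs_stein`), which is Stein's identity for the
normal law of variance B² = c²v/(1 - βv).

For half-line indicators the Stein solution has a derivative with a jump. The jump is carried along
as an explicit nonnegative term in `SteinPair`, and exchangeability bounds its total contribution by
a sum with cancellation (`integral_jump_le`). Both distances therefore follow from the same estimate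
at the same rate. -/

noncomputable section

namespace ONModel

/-! ### Stein's equation for the standard normal law -/

/-- The Gaussian weight `exp(-x²/2)`. -/
def gweight (x : ℝ) : ℝ := Real.exp (-x ^ 2 / 2)

lemma gweight_pos (x : ℝ) : 0 < gweight x := Real.exp_pos _

lemma continuous_gweight : Continuous gweight := by unfold gweight; fun_prop

lemma gweight_neg (x : ℝ) : gweight (-x) = gweight x := by simp [gweight]

lemma hasDerivAt_gweight (x : ℝ) : HasDerivAt gweight (-x * gweight x) x := by
  have h : HasDerivAt (fun x : ℝ => -x ^ 2 / 2) (-x) x := by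
    exact (((hasDerivAt_id' x).fun_pow 2).fun_neg.div_const 2).congr_deriv (by norm_num; ring)
  exact h.exp.congr_deriv (by unfold gweight; ring)

lemma gweight_eq (x : ℝ) : gweight x = Real.exp (-(1 / 2 : ℝ) * x ^ 2) := by
  unfold gweight; congr 1; ring

lemma integrable_gweight : Integrable gweight := by
  have := integrable_exp_neg_mul_sq (b := 1 / 2) (by norm_num)
  exact this.congr (.of_forall fun x => (gweight_eq x).symm)

lemma integrable_id_mul_gweight : Integrable fun x => x * gweight x := by
  have := integrable_mul_exp_neg_mul_sq (b := 1 / 2) (by norm_num)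
  exact this.congr (.of_forall fun x => by simp only [gweight_eq])

lemma integrable_sq_mul_gweight : Integrable fun x => x ^ 2 * gweight x := by
  have := integrable_rpow_mul_exp_neg_mul_sq (b := 1 / 2) (by norm_num) (s := 2) (by norm_num)
  refine this.congr (.of_forall fun x => ?_)
  simp only [gweight_eq]
  norm_cast

lemma integral_gweight : ∫ x, gweight x = √(2 * Real.pi) := by
  simp_rw [gweight_eq, integral_gaussian]
  congr 1; ring

lemma tendsto_gweight : Filter.Tendsto gweight Filter.atTop (nhds 0) := by
  unfold gweight
  refine Real.tendsto_exp_atBot.comp ?_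
  have : Filter.Tendsto (fun x : ℝ => x ^ 2 / 2) Filter.atTop Filter.atTop :=
    (Filter.tendsto_pow_atTop (by norm_num)).atTop_div_const (by norm_num)
  refine (Filter.tendsto_neg_atTop_atBot.comp this).congr fun x => ?_
  simp; ring

lemma tendsto_id_mul_gweight : Filter.Tendsto (fun x => x * gweight x) Filter.atTop (nhds 0) := by
  have h := Real.tendsto_pow_mul_exp_neg_atTop_nhds_zero 1
  refine tendsto_of_tendsto_of_tendsto_of_le_of_le' tendsto_const_nhds h ?_ ?_
  · filter_upwards [Filter.eventually_ge_atTop 0] with x hx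
    exact mul_nonneg hx (gweight_pos x).le
  · filter_upwards [Filter.eventually_ge_atTop 2] with x hx
    rw [pow_one]
    refine mul_le_mul_of_nonneg_left ?_ (by linarith)
    exact Real.exp_le_exp.2 (by nlinarith)

/-- The Gaussian tail `∫_w^∞ exp(-x²/2) dx`. -/
def gtail (w : ℝ) : ℝ := ∫ x in Set.Ioi w, gweight x

lemma integral_Ioi_id_mul_gweight (w : ℝ) : ∫ x in Set.Ioi w, x * gweight x = gweight w := by
  have := integral_Ioi_of_hasDerivAt_of_tendsto (f := fun x => -gweight x)
    (f' := fun x => x * gweight x) (a := w) (m := 0)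
    continuous_gweight.neg.continuousWithinAt
    (fun x _ => (hasDerivAt_gweight x).fun_neg.congr_deriv (by ring))
    integrable_id_mul_gweight.integrableOn (by simpa using tendsto_gweight.neg)
  rw [this]; ring

lemma integral_Ioi_sq_mul_gweight (w : ℝ) :
    ∫ x in Set.Ioi w, x ^ 2 * gweight x = w * gweight w + gtail w := by
  have hint : IntegrableOn (fun x => x ^ 2 * gweight x - gweight x) (Set.Ioi w) :=
    (integrable_sq_mul_gweight.sub integrable_gweight).integrableOn
  have := integral_Ioi_of_hasDerivAt_of_tendsto (f := fun x => -(x * gweight x))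
    (f' := fun x => x ^ 2 * gweight x - gweight x) (a := w) (m := 0)
    (continuous_id.mul continuous_gweight).neg.continuousWithinAt
    (fun x _ => 
      ((hasDerivAt_id' x).fun_mul (hasDerivAt_gweight x)).fun_neg.congr_deriv (by ring))
    hint (by simpa using tendsto_id_mul_gweight.neg)
  rw [integral_sub integrable_sq_mul_gweight.integrableOn integrable_gweight.integrableOn] at this
  unfold gtail
  linarith

lemma gtail_pos (w : ℝ) : 0 < gtail w := by
  refine (setIntegral_pos_iff_support_of_nonneg_ae (.of_forall fun x => (gweight_pos x).le)
    integrable_gweight.integrableOn).2 ?_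
  have : Function.support gweight = Set.univ := by
    ext x; simp [(gweight_pos x).ne']
  simp [this]

lemma gtail_anti {w z : ℝ} (h : w ≤ z) : gtail z ≤ gtail w :=
  setIntegral_mono_set integrable_gweight.integrableOn (.of_forall fun x => (gweight_pos x).le)
    (Set.Ioi_subset_Ioi h).eventuallyLE

lemma gtail_add_gtail_neg (w : ℝ) : gtail w + gtail (-w) = √(2 * Real.pi) := by
  rw [← integral_gweight, ← intervalIntegral.integral_Iic_add_Ioi (b := w)
    integrable_gweight.integrableOn integrable_gweight.integrableOn]
  unfold gtail
  rw [← integral_comp_neg_Iic]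
  simp_rw [gweight_neg]
  ring

lemma gtail_le_total (w : ℝ) : gtail w ≤ √(2 * Real.pi) := by
  linarith [gtail_add_gtail_neg w, gtail_pos (-w)]

/-- Replace the constant w by the larger integration variable under the tail integral. -/
lemma mul_gtail_le (w : ℝ) : w * gtail w ≤ gweight w := by
  rw [← integral_Ioi_id_mul_gweight, gtail, ← integral_const_mul]
  refine setIntegral_mono_on (integrable_gweight.const_mul w).integrableOn
    integrable_id_mul_gweight.integrableOn measurableSet_Ioi fun x hx => ?_
  exact mul_le_mul_of_nonneg_right (le_of_lt hx) (gweight_pos x).le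

/-- Expand the nonnegative integral of (x - w)² against the Gaussian weight over the tail. This
lower bound on Mills' ratio controls the derivative of the Stein solution for Lipschitz functions.
-/
lemma le_one_add_sq_mul_gtail (w : ℝ) : w * gweight w ≤ (1 + w ^ 2) * gtail w := by
  have h : 0 ≤ ∫ x in Set.Ioi w, (x - w) ^ 2 * gweight x :=
    integral_nonneg fun x => mul_nonneg (sq_nonneg _) (gweight_pos x).le
  have e : (fun x => (x - w) ^ 2 * gweight x) =
      fun x => x ^ 2 * gweight x - 2 * w * (x * gweight x) + w ^ 2 * gweight x := by
    ext x; ring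
  have hi : IntegrableOn (fun x => x ^ 2 * gweight x - 2 * w * (x * gweight x)) (Set.Ioi w) :=
    (integrable_sq_mul_gweight.sub (integrable_id_mul_gweight.const_mul _)).integrableOn
  rw [e, integral_add hi (integrable_gweight.const_mul _).integrableOn,
    integral_sub integrable_sq_mul_gweight.integrableOn
      (integrable_id_mul_gweight.const_mul _).integrableOn, integral_const_mul, integral_const_mul,
    integral_Ioi_sq_mul_gweight, integral_Ioi_id_mul_gweight, ← gtail] at h
  nlinarith

/-- Translate the tail to the origin: for x, w ≥ 0 the weight at x + w is at most the product of the
weights at x and w. The tail at 0 is √(2π)/2 ≤ 2. -/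
lemma gtail_le {w : ℝ} (hw : 0 ≤ w) : gtail w ≤ 2 * gweight w := by
  have h1 : gtail 0 ≤ 2 := by
    have h0 := gtail_add_gtail_neg 0
    have h2 : √(2 * Real.pi) ≤ 4 := by
      rw [Real.sqrt_le_left (by norm_num)]; linarith [Real.pi_le_four]
    rw [neg_zero] at h0
    linarith
  have hs : gtail w = ∫ x in Set.Ioi (0 : ℝ), gweight (x + w) := by
    have := (measurePreserving_add_right volume w).setIntegral_preimage_emb
      (measurableEmbedding_addRight w) gweight (Set.Ioi w)
    simpa [gtail] using this.symm
  have h3 : gtail w ≤ ∫ x in Set.Ioi (0 : ℝ), gweight w * gweight x := by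
    rw [hs]
    refine setIntegral_mono_on (integrable_gweight.comp_add_right w).integrableOn
      (integrable_gweight.const_mul _).integrableOn measurableSet_Ioi fun x hx => ?_
    unfold gweight
    rw [← Real.exp_add]
    refine Real.exp_le_exp.2 ?_
    nlinarith [mul_nonneg (le_of_lt (Set.mem_Ioi.1 hx)) hw]
  rw [integral_const_mul, ← gtail] at h3
  nlinarith [gweight_pos w]

lemma hasDerivAt_integral_Ioi {F : ℝ → ℝ} (hF : Continuous F) (hi : Integrable F) (w : ℝ) :
    HasDerivAt (fun w => ∫ x in Set.Ioi w, F x) (-F w) w := by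
  have h : (fun w => ∫ x in Set.Ioi w, F x) =
      fun w => (∫ x in Set.Ioi (0:ℝ), F x) - ∫ x in (0:ℝ)..w, F x := by
    ext w
    have h1 := intervalIntegral.integral_Iic_add_Ioi (b := w) hi.integrableOn hi.integrableOn
    have h2 := intervalIntegral.integral_Iic_add_Ioi (b := 0) hi.integrableOn hi.integrableOn
    have h3 := intervalIntegral.integral_Iic_sub_Iic (a := 0) (b := w)
      hi.integrableOn hi.integrableOn
    linarith
  rw [h]
  have := (hF.integral_hasStrictDerivAt 0 w).hasDerivAt.const_sub (∫ x in Set.Ioi (0:ℝ), F x)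
  exact this

lemma hasDerivAt_gtail (w : ℝ) : HasDerivAt gtail (-gweight w) w :=
  hasDerivAt_integral_Ioi continuous_gweight integrable_gweight w

lemma hasDerivAt_inv_gweight (x : ℝ) :
    HasDerivAt (fun x => (gweight x)⁻¹) (x * (gweight x)⁻¹) x := by
  have := (gweight_pos x).ne'
  exact ((hasDerivAt_gweight x).fun_inv this).congr_deriv (by field_simp)

/-- Mills' ratio of the standard normal law. -/
def mills (w : ℝ) : ℝ := (gweight w)⁻¹ * gtail w

lemma mills_pos (w : ℝ) : 0 < mills w := mul_pos (inv_pos.2 (gweight_pos w)) (gtail_pos w)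

/-- Up to the inhomogeneity -1 this is the homogeneous Stein equation, which is why both branches of
`kolmSol` are multiples of Mills' ratio. -/
lemma hasDerivAt_mills (w : ℝ) : HasDerivAt mills (w * mills w - 1) w := by
  have := (gweight_pos w).ne'
  exact ((hasDerivAt_inv_gweight w).fun_mul (hasDerivAt_gtail w)).congr_deriv
    (by unfold mills; field_simp; ring)

lemma mills_le {w : ℝ} (hw : 0 ≤ w) : mills w ≤ 2 := by
  unfold mills
  rw [inv_mul_le_iff₀ (gweight_pos w)]
  linarith [gtail_le hw]

lemma mul_mills_le (w : ℝ) : w * mills w ≤ 1 := by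
  unfold mills
  rw [mul_left_comm, inv_mul_le_iff₀ (gweight_pos w)]
  linarith [mul_gtail_le w]

/-- A bounded function `g` with bounded derivative `g'` whose second-order Taylor remainder is
quadratic, up to a jump of `g'` at `z`. -/
structure SteinPair (K z : ℝ) (g g' : ℝ → ℝ) : Prop where
  meas : Measurable g
  meas_deriv : Measurable g'
  bound : ∀ w, |g w| ≤ K
  bound_deriv : ∀ w, |g' w| ≤ K
  taylor : ∀ w v, |g v - g w - g' w * (v - w)| ≤ K * (1 + |w|) * (v - w) ^ 2 +
    K * ((v - w) * (Set.indicator (Set.Iic z) 1 w - Set.indicator (Set.Iic z) 1 v))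

/-- The product vanishes unless z separates w and v, and then equals |v - w|. Written with
indicators rather than absolute values, it splits into two terms that exchangeability can compare.
-/
lemma jump_nonneg (z w v : ℝ) : 0 ≤ (v - w) *
    (Set.indicator (Set.Iic z) (1 : ℝ → ℝ) w - Set.indicator (Set.Iic z) 1 v) := by
  by_cases h1 : w ≤ z <;> by_cases h2 : v ≤ z <;> simp [Set.indicator, h1, h2] <;> linarith

lemma SteinPair.nonneg {K z : ℝ} {g g' : ℝ → ℝ} (h : SteinPair K z g g') : 0 ≤ K :=
  (abs_nonneg _).trans (h.bound 0)

/-- Rescaling of Stein pairs. -/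
lemma SteinPair.comp_div {K z : ℝ} {g g' : ℝ → ℝ} (h : SteinPair K z g g') {B : ℝ} (hB : 0 < B) :
    SteinPair (K * (1 + 1 / B) ^ 3) (z * B) (fun w => g (w / B)) (fun w => g' (w / B) / B) := by
  have hK := h.nonneg
  set c := 1 / B with hc
  have hc0 : 0 < c := by positivity
  have hdiv : ∀ w, w / B = w * c := fun w => by rw [hc]; ring
  -- With c = 1/B, rescaling multiplies the bounds by 1, c, c², c²|w|c and c; the cube (1 + c)³
  -- dominates all of these factors at once.
  have h1 : 1 ≤ (1 + c) ^ 3 := one_le_pow₀ (by linarith)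
  have h2 : c ≤ (1 + c) ^ 3 := by nlinarith [pow_pos hc0 3, pow_pos hc0 2]
  refine ⟨h.meas.comp (by fun_prop), (h.meas_deriv.comp (by fun_prop)).div_const _,
    fun w => (h.bound _).trans (le_mul_of_one_le_right hK h1), fun w => ?_, fun w v => ?_⟩
  · rw [hdiv (g' _), abs_mul, abs_of_pos hc0]
    exact mul_le_mul (h.bound_deriv _) h2 hc0.le hK
  · have key := h.taylor (w / B) (v / B)
    have hi : ∀ w, Set.indicator (Set.Iic z) (1 : ℝ → ℝ) (w / B) =
        Set.indicator (Set.Iic (z * B)) 1 w := by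
      intro w
      by_cases hw : w ≤ z * B
      · rw [Set.indicator_of_mem (Set.mem_Iic.2 hw),
          Set.indicator_of_mem (Set.mem_Iic.2 ((div_le_iff₀ hB).2 hw))]
        rfl
      · rw [Set.indicator_of_notMem (fun h => hw (Set.mem_Iic.1 h)),
          Set.indicator_of_notMem (fun h => hw ((div_le_iff₀ hB).1 (Set.mem_Iic.1 h)))]
    rw [hi, hi] at key
    have hj := jump_nonneg (z * B) w v
    set J := Set.indicator (Set.Iic (z * B)) (1 : ℝ → ℝ) w - Set.indicator (Set.Iic (z * B)) 1 v
    simp only [hdiv] at key ⊢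
    rw [abs_mul, abs_of_pos hc0] at key
    calc _ = |g (v * c) - g (w * c) - g' (w * c) * (v * c - w * c)| := by congr 1; ring
      _ ≤ _ := key
      _ ≤ K * (1 + c) ^ 3 * (1 + |w|) * (v - w) ^ 2 + K * (1 + c) ^ 3 * ((v - w) * J) := by
        refine add_le_add ?_ ?_
        · have : (1 + |w| * c) * c ^ 2 ≤ (1 + c) ^ 3 * (1 + |w|) := by
            have := abs_nonneg w
            have e : (1 + c) ^ 3 * (1 + |w|) - (1 + |w| * c) * c ^ 2
              = 1 + 3 * c + 2 * c ^ 2 + c ^ 3 + |w| * (1 + 3 * c + 3 * c ^ 2) := by ring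
            have : 0 ≤ 1 + 3 * c + 2 * c ^ 2 + c ^ 3 + |w| * (1 + 3 * c + 3 * c ^ 2) := by
              positivity
            linarith
          calc _ = (K * (v - w) ^ 2) * ((1 + |w| * c) * c ^ 2) := by ring
            _ ≤ (K * (v - w) ^ 2) * ((1 + c) ^ 3 * (1 + |w|)) := by gcongr
            _ = _ := by ring
        · calc _ = K * ((v - w) * J) * c := by ring
            _ ≤ K * ((v - w) * J) * (1 + c) ^ 3 := by gcongr
            _ = _ := by ring

/-! #### Indicator test functions -/

/-- The solution of Stein's equation for the indicator of `(-∞, z]`. -/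
def kolmSol (z w : ℝ) : ℝ :=
  (√(2 * Real.pi))⁻¹ * if w ≤ z then gtail z * mills (-w) else gtail (-z) * mills w

/-- The derivative of `kolmSol`. -/
def kolmSolDeriv (z w : ℝ) : ℝ :=
  (√(2 * Real.pi))⁻¹ * if w ≤ z then gtail z * (w * mills (-w) + 1)
    else gtail (-z) * (w * mills w - 1)

lemma sqrt_two_pi_pos : 0 < √(2 * Real.pi) := by positivity

lemma gtail_mul_mills_comm (z : ℝ) : gtail z * mills (-z) = gtail (-z) * mills z := by
  unfold mills; rw [gweight_neg]; ring

lemma gtail_div_le_one (w : ℝ) : (√(2 * Real.pi))⁻¹ * gtail w ≤ 1 := by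
  rw [inv_mul_le_iff₀ sqrt_two_pi_pos, mul_one]; exact gtail_le_total w

/-- For w ≥ 0, lower the tail point from z to w and exchange the signs by `gtail_mul_mills_comm`;
for w ≤ 0, bound the normalized tail by 1. A bound by Mills' ratio at |w| yields boundedness of both
g and w g. -/
lemma gtail_mul_mills_le {z w : ℝ} (h : w ≤ z) :
    (√(2 * Real.pi))⁻¹ * (gtail z * mills (-w)) ≤ mills |w| := by
  have hp := sqrt_two_pi_pos
  rcases le_total 0 w with hw | hw
  · rw [abs_of_nonneg hw, inv_mul_le_iff₀ hp]
    calc gtail z * mills (-w) ≤ gtail w * mills (-w) :=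
          mul_le_mul_of_nonneg_right (gtail_anti h) (mills_pos _).le
      _ = gtail (-w) * mills w := gtail_mul_mills_comm w
      _ ≤ √(2 * Real.pi) * mills w :=
          mul_le_mul_of_nonneg_right (gtail_le_total _) (mills_pos _).le
  · rw [abs_of_nonpos hw, ← mul_assoc]
    exact mul_le_of_le_one_left (mills_pos _).le (gtail_div_le_one z)

lemma kolmSol_nonneg (z w : ℝ) : 0 ≤ kolmSol z w := by
  unfold kolmSol
  have := sqrt_two_pi_pos
  have h1 := gtail_pos z
  have h2 := gtail_pos (-z)
  have h3 := mills_pos w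
  have h4 := mills_pos (-w)
  split_ifs <;> positivity

lemma kolmSol_le (z w : ℝ) : kolmSol z w ≤ mills |w| := by
  unfold kolmSol
  split_ifs with h
  · exact gtail_mul_mills_le h
  · have := gtail_mul_mills_le (z := -z) (w := -w) (by linarith)
    rwa [neg_neg, abs_neg] at this

lemma abs_kolmSol_le (z w : ℝ) : |kolmSol z w| ≤ 2 := by
  rw [abs_of_nonneg (kolmSol_nonneg z w)]
  exact (kolmSol_le z w).trans (mills_le (abs_nonneg _))

lemma abs_mul_kolmSol_le (z w : ℝ) : |w * kolmSol z w| ≤ 1 := by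
  rw [abs_mul, abs_of_nonneg (kolmSol_nonneg z w)]
  exact (mul_le_mul_of_nonneg_left (kolmSol_le z w) (abs_nonneg _)).trans (mul_mills_le _)

/-- This is Stein's equation. The derivative at z is taken from the left, so that the equation holds
at every point, including z. -/
lemma kolmSolDeriv_eq (z w : ℝ) : kolmSolDeriv z w = w * kolmSol z w +
    (Set.indicator (Set.Iic z) 1 w - (√(2 * Real.pi))⁻¹ * gtail (-z)) := by
  have h := gtail_add_gtail_neg z
  have hp := sqrt_two_pi_pos.ne'
  unfold kolmSolDeriv kolmSol
  split_ifs with hw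
  · rw [Set.indicator_of_mem (Set.mem_Iic.2 hw)]
    have : (1 : ℝ) = (√(2 * Real.pi))⁻¹ * (gtail z + gtail (-z)) := by
      rw [h, inv_mul_cancel₀ hp]
    simp only [Pi.one_apply]
    nth_rewrite 2 [this]
    ring
  · rw [Set.indicator_of_notMem (fun h => hw (Set.mem_Iic.1 h))]
    ring

lemma abs_kolmSolDeriv_le (z w : ℝ) : |kolmSolDeriv z w| ≤ 2 := by
  rw [kolmSolDeriv_eq]
  have h1 := abs_mul_kolmSol_le z w
  have h2 := gtail_div_le_one (-z)
  have h3 : 0 ≤ (√(2 * Real.pi))⁻¹ * gtail (-z) :=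
    mul_nonneg (inv_nonneg.2 sqrt_two_pi_pos.le) (gtail_pos _).le
  rw [abs_le] at h1 ⊢
  by_cases hw : w ≤ z
  · rw [Set.indicator_of_mem (Set.mem_Iic.2 hw)]
    simp only [Pi.one_apply]
    constructor <;> linarith [h1.1, h1.2]
  · rw [Set.indicator_of_notMem (fun h => hw (Set.mem_Iic.1 h))]
    constructor <;> linarith [h1.1, h1.2]

lemma hasDerivAt_mills_neg (w : ℝ) :
    HasDerivAt (fun w => mills (-w)) (w * mills (-w) + 1) w :=
  ((hasDerivAt_mills (-w)).comp w (hasDerivAt_neg w)).congr_deriv (by ring)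

lemma continuous_mills : Continuous mills :=
  continuous_iff_continuousAt.2 fun w => (hasDerivAt_mills w).continuousAt

lemma measurable_kolmSol (z : ℝ) : Measurable (kolmSol z) := by
  unfold kolmSol
  have := continuous_mills.measurable
  exact (Measurable.ite measurableSet_Iic (by fun_prop) (by fun_prop)).const_mul _

lemma measurable_kolmSolDeriv (z : ℝ) : Measurable (kolmSolDeriv z) := by
  unfold kolmSolDeriv
  have := continuous_mills.measurable
  exact (Measurable.ite measurableSet_Iic (by fun_prop) (by fun_prop)).const_mul _

lemma kolmSol_of_le {z w : ℝ} (h : w ≤ z) :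
    kolmSol z w = (√(2 * Real.pi))⁻¹ * (gtail z * mills (-w)) := by
  simp [kolmSol, h]

lemma kolmSol_of_ge {z w : ℝ} (h : z ≤ w) :
    kolmSol z w = (√(2 * Real.pi))⁻¹ * (gtail (-z) * mills w) := by
  rcases h.eq_or_lt with rfl | h
  · rw [kolmSol_of_le le_rfl, gtail_mul_mills_comm]
  · simp [kolmSol, not_le.2 h]

lemma hasDerivWithinAt_kolmSol_left {z w : ℝ} (h : w ≤ z) :
    HasDerivWithinAt (kolmSol z) (kolmSolDeriv z w) (Set.Iic z) w := by
  have h1 := (((hasDerivAt_mills_neg w).const_mul (gtail z)).const_mul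
    (√(2 * Real.pi))⁻¹).hasDerivWithinAt (s := Set.Iic z)
  refine (h1.congr (fun x hx => kolmSol_of_le hx) (kolmSol_of_le h)).congr_deriv ?_
  simp [kolmSolDeriv, h]

lemma hasDerivWithinAt_kolmSol_right {z w : ℝ} (h : z ≤ w) :
    HasDerivWithinAt (kolmSol z) ((√(2 * Real.pi))⁻¹ * (gtail (-z) * (w * mills w - 1)))
      (Set.Ici z) w := by
  have h1 := (((hasDerivAt_mills w).const_mul (gtail (-z))).const_mul
    (√(2 * Real.pi))⁻¹).hasDerivWithinAt (s := Set.Ici z)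
  exact h1.congr (fun x hx => kolmSol_of_ge hx) (kolmSol_of_ge h)

lemma lipschitz_left_kolmSol {z w v : ℝ} (hw : w ≤ z) (hv : v ≤ z) :
    |kolmSol z v - kolmSol z w| ≤ 2 * |v - w| := by
  have := (convex_Iic z).norm_image_sub_le_of_norm_hasDerivWithin_le (f := kolmSol z)
    (f' := kolmSolDeriv z) (C := 2) (x := w) (y := v)
    (fun x hx => hasDerivWithinAt_kolmSol_left hx) (fun x _ => abs_kolmSolDeriv_le z x) hw hv
  simpa using this

lemma lipschitz_right_kolmSol {z w v : ℝ} (hw : z ≤ w) (hv : z ≤ v) :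
    |kolmSol z v - kolmSol z w| ≤ 2 * |v - w| := by
  have := (convex_Ici z).norm_image_sub_le_of_norm_hasDerivWithin_le (f := kolmSol z)
    (f' := fun w => (√(2 * Real.pi))⁻¹ * (gtail (-z) * (w * mills w - 1)))
    (C := 2) (x := w) (y := v)
    (fun x hx => hasDerivWithinAt_kolmSol_right hx) (fun x hx => ?_) hw hv
  · simpa using this
  · have e : (√(2 * Real.pi))⁻¹ * (gtail (-z) * (x * mills x - 1)) =
        x * kolmSol z x - (√(2 * Real.pi))⁻¹ * gtail (-z) := by
      rw [kolmSol_of_ge hx]; ring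
    rw [e]
    have h1 := abs_mul_kolmSol_le z x
    have h2 := gtail_div_le_one (-z)
    have h3 : 0 ≤ (√(2 * Real.pi))⁻¹ * gtail (-z) :=
      mul_nonneg (inv_nonneg.2 sqrt_two_pi_pos.le) (gtail_pos _).le
    rw [abs_le] at h1
    rw [Real.norm_eq_abs, abs_le]
    constructor <;> linarith [h1.1, h1.2]

lemma lipschitz_kolmSol (z w v : ℝ) : |kolmSol z v - kolmSol z w| ≤ 2 * |v - w| := by
  wlog h : w ≤ v generalizing w v
  · rw [abs_sub_comm, abs_sub_comm v w]; exact this v w (le_of_not_ge h)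
  rcases le_total v z with hv | hv
  · exact lipschitz_left_kolmSol (h.trans hv) hv
  rcases le_total z w with hw | hw
  · exact lipschitz_right_kolmSol hw hv
  have h1 := lipschitz_left_kolmSol hw le_rfl
  have h2 := lipschitz_right_kolmSol le_rfl hv
  rw [abs_of_nonneg (by linarith : 0 ≤ z - w)] at h1
  rw [abs_of_nonneg (by linarith : 0 ≤ v - z)] at h2
  rw [abs_of_nonneg (by linarith : 0 ≤ v - w)]
  calc _ = |(kolmSol z v - kolmSol z z) + (kolmSol z z - kolmSol z w)| := by congr 1; ring
    _ ≤ _ := abs_add_le _ _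
    _ ≤ _ := by linarith

/-- Stein's equation expresses g' through w g(w), so this estimate is the source of the weight 1 +
|w| in `SteinPair.taylor`. -/
lemma abs_id_mul_sub_le {g : ℝ → ℝ} {K : ℝ} (hb : ∀ w, |g w| ≤ K)
    (hl : ∀ w v, |g v - g w| ≤ K * |v - w|) (w v : ℝ) :
    |v * g v - w * g w| ≤ K * (1 + |w|) * |v - w| := by
  calc |v * g v - w * g w| = |w * (g v - g w) + (v - w) * g v| := by congr 1; ring
    _ ≤ |w| * |g v - g w| + |v - w| * |g v| := by
      rw [← abs_mul, ← abs_mul]; exact abs_add_le _ _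
    _ ≤ |w| * (K * |v - w|) + |v - w| * K := by gcongr; exacts [hl w v, hb v]
    _ = _ := by ring

/-- The mean value inequality for the first-order Taylor remainder. -/
lemma abs_taylor_le_of_hasDerivWithinAt {g g' : ℝ → ℝ} {s : Set ℝ} (hs : s.OrdConnected) {w v C : ℝ}
    (hw : w ∈ s) (hv : v ∈ s) (hd : ∀ x ∈ s, HasDerivWithinAt g (g' x) s x)
    (hC : ∀ x ∈ s, |x - w| ≤ |v - w| → |g' x - g' w| ≤ C * |v - w|) :
    |g v - g w - g' w * (v - w)| ≤ C * (v - w) ^ 2 := by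
  have hsub : Set.uIcc w v ⊆ s := hs.uIcc_subset hw hv
  have := (convex_uIcc w v).norm_image_sub_le_of_norm_hasDerivWithin_le
    (f := fun x => g x - g' w * x) (f' := fun x => g' x - g' w) (C := C * |v - w|)
    (x := w) (y := v) (fun x hx => ((hd x (hsub hx)).mono hsub).fun_sub
      (((hasDerivAt_id' x).const_mul (g' w)).congr_deriv (by ring)).hasDerivWithinAt)
    (fun x hx => hC x (hsub hx) (Set.abs_sub_left_of_mem_uIcc hx))
    Set.left_mem_uIcc Set.right_mem_uIcc
  rw [Real.norm_eq_abs, Real.norm_eq_abs] at this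
  calc _ = |g v - g' w * v - (g w - g' w * w)| := by congr 1; ring
    _ ≤ _ := this
    _ = C * (|v - w| * |v - w|) := by ring
    _ = _ := by rw [abs_mul_abs_self]; ring

/-- On one side of z the indicator is constant and g' varies only through w g(w), which gives a
quadratic remainder. If z separates the points, the crude bound 4|v - w| is exactly the jump term.
-/
lemma kolmSol_taylor (z w v : ℝ) :
    |kolmSol z v - kolmSol z w - kolmSolDeriv z w * (v - w)| ≤ 4 * (1 + |w|) * (v - w) ^ 2 +
    4 * ((v - w) * (Set.indicator (Set.Iic z) 1 w - Set.indicator (Set.Iic z) 1 v)) := by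
  have same : ∀ {s : Set ℝ}, s.OrdConnected → w ∈ s → v ∈ s →
      (∀ x ∈ s, HasDerivWithinAt (kolmSol z) (kolmSolDeriv z x) s x) →
      (∀ x ∈ s, Set.indicator (Set.Iic z) (1 : ℝ → ℝ) x = Set.indicator (Set.Iic z) 1 w) →
      |kolmSol z v - kolmSol z w - kolmSolDeriv z w * (v - w)| ≤ 4 * (1 + |w|) * (v - w) ^ 2 +
      4 * ((v - w) * (Set.indicator (Set.Iic z) 1 w - Set.indicator (Set.Iic z) 1 v)) := by
    intro s hs hw hv hd hi
    rw [hi v hv, sub_self, mul_zero, mul_zero, add_zero]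
    refine abs_taylor_le_of_hasDerivWithinAt hs hw hv hd fun x hx hxv => ?_
    rw [kolmSolDeriv_eq, kolmSolDeriv_eq, hi x hx, add_sub_add_right_eq_sub]
    refine (abs_id_mul_sub_le (abs_kolmSol_le z) (lipschitz_kolmSol z) w x).trans ?_
    gcongr
    norm_num
  by_cases hw : w ≤ z <;> by_cases hv : v ≤ z
  · refine same (s := Set.Iic z) Set.ordConnected_Iic hw hv
      (fun x hx => hasDerivWithinAt_kolmSol_left hx) fun x hx => ?_
    rw [Set.indicator_of_mem hx, Set.indicator_of_mem (Set.mem_Iic.2 hw)]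
    rfl
  -- The case of two points beyond z is brought forward; the two cases separated by z are then
  -- handled together.
  rotate_left 2
  · refine same (s := Set.Ioi z) Set.ordConnected_Ioi (not_le.1 hw) (not_le.1 hv)
      (fun x hx => ?_) fun x hx => ?_
    · refine ((hasDerivWithinAt_kolmSol_right (le_of_lt hx)).mono Set.Ioi_subset_Ici_self).congr_deriv
        ?_
      simp [kolmSolDeriv, not_le.2 (Set.mem_Ioi.1 hx)]
    · rw [Set.indicator_of_notMem (fun h => not_le.2 (Set.mem_Ioi.1 hx) (Set.mem_Iic.1 h)),
        Set.indicator_of_notMem (fun h => hw (Set.mem_Iic.1 h))]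
  all_goals
    have h1 : |kolmSol z v - kolmSol z w - kolmSolDeriv z w * (v - w)| ≤ 4 * |v - w| := by
      refine (abs_sub _ _).trans ?_
      rw [abs_mul]
      have := mul_le_mul_of_nonneg_right (abs_kolmSolDeriv_le z w) (abs_nonneg (v - w))
      linarith [lipschitz_kolmSol z w v]
    refine h1.trans ?_
    have : 0 ≤ 4 * (1 + |w|) * (v - w) ^ 2 := by positivity
    simp only [Set.indicator, Set.mem_Iic, hw, hv, if_true, if_false, Pi.one_apply]
  · rw [abs_of_nonneg (by linarith)]; linarith
  · rw [abs_of_nonpos (by linarith)]; linarith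

lemma gaussianReal_real_Iic (z : ℝ) :
    (gaussianReal 0 1).real (Set.Iic z) = (√(2 * Real.pi))⁻¹ * gtail (-z) := by
  rw [← integral_indicator_one measurableSet_Iic,
    integral_gaussianReal_eq_integral_smul one_ne_zero]
  have e : ∀ x, gaussianPDFReal 0 1 x • (Set.Iic z).indicator (1 : ℝ → ℝ) x =
      (Set.Iic z).indicator (fun x => (√(2 * Real.pi))⁻¹ * gweight (-x)) x := by
    intro x
    by_cases hx : x ∈ Set.Iic z
    · simp [hx, gaussianPDFReal, gweight]
    · simp [hx]
  simp_rw [e]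
  rw [integral_indicator measurableSet_Iic, integral_const_mul, gtail, integral_comp_neg_Iic]

/-- Stein's equation for the Kolmogorov distance. -/
theorem exists_steinPair_indicator (z : ℝ) : ∃ g g' : ℝ → ℝ, SteinPair 4 z g g' ∧
    ∀ w, g' w - w * g w = Set.indicator (Set.Iic z) 1 w - (gaussianReal 0 1).real (Set.Iic z) :=
  ⟨kolmSol z, kolmSolDeriv z, ⟨measurable_kolmSol z, measurable_kolmSolDeriv z,
    fun w => (abs_kolmSol_le z w).trans (by norm_num),
    fun w => (abs_kolmSolDeriv_le z w).trans (by norm_num), kolmSol_taylor z⟩,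
    fun w => by rw [kolmSolDeriv_eq, gaussianReal_real_Iic]; ring⟩

/-! #### Lipschitz test functions -/

lemma integrable_mul_gweight {k : ℝ → ℝ} (hk : Continuous k) (hb : ∀ x, |k x| ≤ 1 + |x|) :
    Integrable fun x => k x * gweight x := by
  refine Integrable.mono' (integrable_gweight.add integrable_id_mul_gweight.abs)
    (hk.mul continuous_gweight).aestronglyMeasurable (.of_forall fun x => ?_)
  rw [Real.norm_eq_abs, abs_mul, abs_of_pos (gweight_pos x)]
  simp only [Pi.add_apply, abs_mul, abs_of_pos (gweight_pos x)]
  nlinarith [hb x, gweight_pos x]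

/-- The solution of Stein's equation with right-hand side `k`. -/
def lipSol (k : ℝ → ℝ) (w : ℝ) : ℝ := -((gweight w)⁻¹ * ∫ x in Set.Ioi w, k x * gweight x)

lemma hasDerivAt_lipSol {k : ℝ → ℝ} (hk : Continuous k) (hb : ∀ x, |k x| ≤ 1 + |x|) (w : ℝ) :
    HasDerivAt (lipSol k) (w * lipSol k w + k w) w := by
  have hg := (gweight_pos w).ne'
  exact ((hasDerivAt_inv_gweight w).fun_mul (hasDerivAt_integral_Ioi (hk.mul continuous_gweight)
    (integrable_mul_gweight hk hb) w)).fun_neg.congr_deriv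
      (by simp only [lipSol, Pi.mul_apply]; field_simp; ring)

/-- Since k has Gaussian mean zero, its integrals over the two half-lines at w are opposite.
Reflection thus reduces all bounds to w ≥ 0. -/
lemma lipSol_neg {k : ℝ → ℝ} (hk : Continuous k) (hb : ∀ x, |k x| ≤ 1 + |x|)
    (h0 : ∫ x, k x * gweight x = 0) (w : ℝ) :
    lipSol (fun x => k (-x)) (-w) = -lipSol k w := by
  have hi := integrable_mul_gweight hk hb
  have h1 := intervalIntegral.integral_Iic_add_Ioi (b := w) hi.integrableOn hi.integrableOn
  have h2 : ∫ x in Set.Ioi (-w), k (-x) * gweight x = ∫ x in Set.Iic w, k x * gweight x := by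
    have := integral_comp_neg_Iic w (fun x => k (-x) * gweight x)
    simp only [neg_neg, gweight_neg] at this
    exact this.symm
  unfold lipSol
  rw [h2, gweight_neg]
  have : ∫ x in Set.Iic w, k x * gweight x = -∫ x in Set.Ioi w, k x * gweight x := by linarith
  rw [this]; ring

/-- On the tail |k| ≤ 1 + x, whose integral is `gtail w + gweight w`; division by the weight leaves
at most 2 + 1. -/
lemma abs_lipSol_le_of_nonneg {k : ℝ → ℝ} (hk : Continuous k) (hb : ∀ x, |k x| ≤ 1 + |x|)
    {w : ℝ} (hw : 0 ≤ w) : |lipSol k w| ≤ 3 := by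
  have h1 : |∫ x in Set.Ioi w, k x * gweight x| ≤ gtail w + gweight w := by
    rw [← integral_Ioi_id_mul_gweight, gtail, ← integral_add integrable_gweight.integrableOn
      integrable_id_mul_gweight.integrableOn]
    refine (abs_integral_le_integral_abs).trans (setIntegral_mono_on
      (integrable_mul_gweight hk hb).abs.integrableOn
      (integrable_gweight.add integrable_id_mul_gweight).integrableOn measurableSet_Ioi
      fun x hx => ?_)
    rw [abs_mul, abs_of_pos (gweight_pos x)]
    have := hb x
    rw [abs_of_pos (hw.trans_lt hx)] at this
    nlinarith [gweight_pos x]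
  unfold lipSol
  rw [abs_neg, abs_mul, abs_of_pos (inv_pos.2 (gweight_pos w)), inv_mul_le_iff₀ (gweight_pos w)]
  linarith [gtail_le hw]

/-- Both k(w) and w times the solution grow linearly, so a cancellation is needed. Splitting k(x) =
k(w) + (k(x) - k(w)) makes d = `gweight w - w * gtail w` a factor of the first part and a bound for
the second. The lower Mills bound gives (1 + w²) d ≤ `gweight w`, enough to absorb the linear
growth. -/
lemma abs_lipSol_deriv_le_of_nonneg {k : ℝ → ℝ} (hk : LipschitzWith 1 k)
    (hb : ∀ x, |k x| ≤ 1 + |x|) {w : ℝ} (hw : 0 ≤ w) : |w * lipSol k w + k w| ≤ 3 := by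
  have hi := integrable_mul_gweight hk.continuous hb
  have hR : |∫ x in Set.Ioi w, (k x - k w) * gweight x| ≤ gweight w - w * gtail w := by
    have e : gweight w - w * gtail w = ∫ x in Set.Ioi w, (x * gweight x - w * gweight x) := by
      rw [integral_sub integrable_id_mul_gweight.integrableOn
        (integrable_gweight.const_mul _).integrableOn, integral_Ioi_id_mul_gweight,
        integral_const_mul, gtail]
    rw [e]
    refine (abs_integral_le_integral_abs).trans (setIntegral_mono_on ?_
      (integrable_id_mul_gweight.sub (integrable_gweight.const_mul _)).integrableOn
      measurableSet_Ioi fun x hx => ?_)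
    · have : Integrable fun x => (k x - k w) * gweight x := by
        simp_rw [sub_mul]
        exact hi.sub (integrable_gweight.const_mul (k w))
      exact this.abs.integrableOn
    · have h1 : |k x - k w| ≤ |x - w| := by simpa [Real.dist_eq] using hk.dist_le_mul x w
      rw [abs_of_pos (sub_pos.2 (Set.mem_Ioi.1 hx))] at h1
      rw [abs_mul, abs_of_pos (gweight_pos x), ← sub_mul]
      exact mul_le_mul_of_nonneg_right h1 (gweight_pos x).le
  have hT : ∫ x in Set.Ioi w, k x * gweight x =
      k w * gtail w + ∫ x in Set.Ioi w, (k x - k w) * gweight x := by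
    simp_rw [sub_mul]
    rw [integral_sub hi.integrableOn (integrable_gweight.const_mul _).integrableOn,
      integral_const_mul, gtail]
    ring
  set R := ∫ x in Set.Ioi w, (k x - k w) * gweight x
  have hg := gweight_pos w
  have hbw := hb w
  rw [abs_of_nonneg hw] at hbw
  set d := gweight w - w * gtail w with hd
  have hd0 : 0 ≤ d := by linarith [mul_gtail_le w]
  have hd1 : (1 + w ^ 2) * d ≤ gweight w := by
    have := mul_le_mul_of_nonneg_left (le_one_add_sq_mul_gtail w) hw
    rw [hd]; nlinarith
  have e : w * lipSol k w + k w = (gweight w)⁻¹ * (k w * d - w * R) := by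
    unfold lipSol
    rw [hT, hd]
    field_simp
    ring
  rw [e, abs_mul, abs_of_pos (inv_pos.2 hg), inv_mul_le_iff₀ hg]
  calc |k w * d - w * R| ≤ |k w| * d + w * |R| := by
        refine (abs_sub _ _).trans ?_
        rw [abs_mul, abs_mul, abs_of_nonneg hd0, abs_of_nonneg hw]
    _ ≤ (1 + w) * d + w * d := by gcongr
    _ ≤ gweight w * 3 := by nlinarith [mul_nonneg hd0 (sq_nonneg (w - 1))]

lemma abs_lipSol_le {k : ℝ → ℝ} (hk : Continuous k) (hb : ∀ x, |k x| ≤ 1 + |x|)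
    (h0 : ∫ x, k x * gweight x = 0) (w : ℝ) : |lipSol k w| ≤ 3 := by
  rcases le_total 0 w with hw | hw
  · exact abs_lipSol_le_of_nonneg hk hb hw
  · rw [← abs_neg, ← lipSol_neg hk hb h0]
    exact abs_lipSol_le_of_nonneg (hk.comp continuous_neg) (fun x => by simpa using hb (-x))
      (by linarith)

lemma abs_lipSol_deriv_le {k : ℝ → ℝ} (hk : LipschitzWith 1 k) (hb : ∀ x, |k x| ≤ 1 + |x|)
    (h0 : ∫ x, k x * gweight x = 0) (w : ℝ) : |w * lipSol k w + k w| ≤ 3 := by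
  rcases le_total 0 w with hw | hw
  · exact abs_lipSol_deriv_le_of_nonneg hk hb hw
  · have hk' : LipschitzWith 1 fun x => k (-x) := by
      refine LipschitzWith.of_dist_le_mul fun x y => ?_
      simpa using hk.dist_le_mul (-x) (-y)
    have := abs_lipSol_deriv_le_of_nonneg hk' (fun x => by simpa using hb (-x))
      (w := -w) (by linarith)
    rw [lipSol_neg hk.continuous hb h0] at this
    simpa using this

/-- Centring removes the free additive constant of h, so that the Stein bounds are uniform over all
1-Lipschitz functions. The 1 bounds E|Z|, by |y| ≤ (1 + y²)/2. -/
lemma abs_sub_integral_gaussian_le {h : ℝ → ℝ} (hh : LipschitzWith 1 h) (x : ℝ) :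
    Integrable h (gaussianReal 0 1) ∧ |h x - ∫ y, h y ∂gaussianReal 0 1| ≤ 1 + |x| := by
  have hid : MemLp id 2 (gaussianReal 0 1) := memLp_id_gaussianReal 2
  have hid1 : Integrable id (gaussianReal 0 1) := hid.integrable (by norm_num)
  have hidabs : Integrable (fun y : ℝ => |y|) (gaussianReal 0 1) := hid1.abs
  have hidsq : Integrable (fun y : ℝ => y ^ 2) (gaussianReal 0 1) := hid.integrable_sq
  have hlip : ∀ y, |h x - h y| ≤ |x| + |y| := fun y => by
    have : |h x - h y| ≤ |x - y| := by simpa [Real.dist_eq] using hh.dist_le_mul x y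
    exact this.trans (abs_sub _ _)
  have hi : Integrable h (gaussianReal 0 1) := by
    refine Integrable.mono' ((integrable_const (|h x| + |x|)).add hidabs)
      hh.continuous.aestronglyMeasurable (.of_forall fun y => ?_)
    have := hlip y
    have h2 := abs_sub_abs_le_abs_sub (h y) (h x)
    rw [abs_sub_comm] at h2
    simp only [Real.norm_eq_abs, Pi.add_apply]
    linarith
  refine ⟨hi, ?_⟩
  have hsq : ∫ y, y ^ 2 ∂gaussianReal 0 1 = 1 := by
    have := variance_id_gaussianReal (μ := 0) (v := 1)
    rw [variance_of_integral_eq_zero aemeasurable_id (by simp)] at this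
    simpa using this
  have habs : ∫ y, |y| ∂gaussianReal 0 1 ≤ 1 := by
    calc ∫ y, |y| ∂gaussianReal 0 1 ≤ ∫ y, (1 + y ^ 2) / 2 ∂gaussianReal 0 1 := by
          refine integral_mono hidabs
            (((integrable_const (1 : ℝ)).add hidsq).div_const 2) fun y => ?_
          nlinarith [sq_nonneg (|y| - 1), sq_abs y]
      _ = 1 := by
          rw [integral_div, integral_add (integrable_const _) hidsq]
          simp [hsq]
  have e : h x - ∫ y, h y ∂gaussianReal 0 1 = ∫ y, (h x - h y) ∂gaussianReal 0 1 := by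
    rw [integral_sub (integrable_const _) hi]; simp
  rw [e]
  calc _ ≤ ∫ y, |h x - h y| ∂gaussianReal 0 1 := abs_integral_le_integral_abs
    _ ≤ ∫ y, (|x| + |y|) ∂gaussianReal 0 1 :=
      integral_mono ((integrable_const _).sub hi).abs ((integrable_const _).add hidabs) hlip
    _ = |x| + ∫ y, |y| ∂gaussianReal 0 1 := by
      rw [integral_add (integrable_const _) hidabs]; simp
    _ ≤ _ := by linarith

/-- Stein's equation for the Wasserstein distance. -/
theorem exists_steinPair_lipschitz {h : ℝ → ℝ} (hh : LipschitzWith 1 h) :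
    ∃ g g' : ℝ → ℝ, SteinPair 4 0 g g' ∧
    ∀ w, g' w - w * g w = h w - ∫ y, h y ∂gaussianReal 0 1 := by
  set c := ∫ y, h y ∂gaussianReal 0 1 with hc
  set k : ℝ → ℝ := fun x => h x - c with hkdef
  have hk : LipschitzWith 1 k := by
    refine LipschitzWith.of_dist_le_mul fun x y => ?_
    simpa [k, Real.dist_eq] using hh.dist_le_mul x y
  have hb : ∀ x, |k x| ≤ 1 + |x| := fun x => (abs_sub_integral_gaussian_le hh x).2
  have hi := (abs_sub_integral_gaussian_le hh 0).1
  have h0 : ∫ x, k x * gweight x = 0 := by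
    have h1 : ∫ y, k y ∂gaussianReal 0 1 = 0 := by
      simp only [k]
      rw [integral_sub hi (integrable_const _), ← hc]; simp
    rw [integral_gaussianReal_eq_integral_smul one_ne_zero] at h1
    have e : ∀ x, gaussianPDFReal 0 1 x • k x = (√(2 * Real.pi))⁻¹ * (k x * gweight x) := by
      intro x
      simp [gaussianPDFReal, gweight]; ring
    simp_rw [e, integral_const_mul] at h1
    exact (mul_eq_zero.1 h1).resolve_left (inv_ne_zero sqrt_two_pi_pos.ne')
  have hd := hasDerivAt_lipSol hk.continuous hb
  have hcont : Continuous (lipSol k) := continuous_iff_continuousAt.2 fun w => (hd w).continuousAt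
  have hB := abs_lipSol_le hk.continuous hb h0
  have hB' := abs_lipSol_deriv_le hk hb h0
  have hL : ∀ w v, |lipSol k v - lipSol k w| ≤ 3 * |v - w| := fun w v => by
    have := convex_univ.norm_image_sub_le_of_norm_hasDerivWithin_le (f := lipSol k)
      (C := 3) (x := w) (y := v) (fun x _ => (hd x).hasDerivWithinAt) (fun x _ => hB' x)
      (Set.mem_univ _) (Set.mem_univ _)
    simpa using this
  refine ⟨lipSol k, fun w => w * lipSol k w + k w, ⟨hcont.measurable, ?_,
    fun w => (hB w).trans (by norm_num), fun w => (hB' w).trans (by norm_num), fun w v => ?_⟩,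
    fun w => by ring⟩
  · exact ((continuous_id.mul hcont).add hk.continuous).measurable
  · have h1 : |lipSol k v - lipSol k w - (w * lipSol k w + k w) * (v - w)| ≤
        4 * (1 + |w|) * (v - w) ^ 2 := by
      refine abs_taylor_le_of_hasDerivWithinAt (s := Set.univ) (g' := fun w => w * lipSol k w + k w)
        Set.ordConnected_univ (Set.mem_univ _) (Set.mem_univ _)
        (fun x _ => (hd x).hasDerivWithinAt) fun x _ hx => ?_
      have h2 := abs_id_mul_sub_le hB hL w x
      have h3 : |k x - k w| ≤ |x - w| := by simpa [Real.dist_eq] using hk.dist_le_mul x w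
      have h4 : 0 ≤ |w| * |x - w| := by positivity
      calc _ = |(x * lipSol k x - w * lipSol k w) + (k x - k w)| := by congr 1; ring
        _ ≤ 3 * (1 + |w|) * |x - w| + |x - w| := (abs_add_le _ _).trans (by gcongr)
        _ ≤ 4 * (1 + |w|) * |x - w| := by nlinarith
        _ ≤ _ := by gcongr
    -- The derivative has no jump here; the jump term at 0 is nonnegative and is added only to fit
    -- the common structure.
    have := jump_nonneg 0 w v
    linarith

/-! ### The uniform measure on the sphere -/

/-- The action of a linear isometry on the unit sphere. -/
def sphereMap {N : ℕ} (e : EuclideanSpace ℝ (Fin N) ≃ₗᵢ[ℝ] EuclideanSpace ℝ (Fin N))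
    (σ : Sphere N) : Sphere N :=
  ⟨e σ, by simp⟩

@[simp]
lemma coe_sphereMap {N : ℕ} (e : EuclideanSpace ℝ (Fin N) ≃ₗᵢ[ℝ] EuclideanSpace ℝ (Fin N))
    (σ : Sphere N) : (sphereMap e σ : EuclideanSpace ℝ (Fin N)) = e σ := rfl

lemma measurable_sphereMap {N : ℕ}
    (e : EuclideanSpace ℝ (Fin N) ≃ₗᵢ[ℝ] EuclideanSpace ℝ (Fin N)) : Measurable (sphereMap e) :=
  (Continuous.subtype_mk (e.continuous.comp continuous_subtype_val) _).measurable

-- The surface measure of a set is defined through the volume of the cone over it, and a linear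
-- isometry maps cones to cones and preserves volume.
open scoped Pointwise in
lemma map_toSphere_sphereMap {N : ℕ}
    (e : EuclideanSpace ℝ (Fin N) ≃ₗᵢ[ℝ] EuclideanSpace ℝ (Fin N)) :
    Measure.map (sphereMap e) (volume : Measure (EuclideanSpace ℝ (Fin N))).toSphere =
      (volume : Measure (EuclideanSpace ℝ (Fin N))).toSphere := by
  ext s hs
  rw [Measure.map_apply (measurable_sphereMap e) hs,
    Measure.toSphere_apply' _ (measurable_sphereMap e hs), Measure.toSphere_apply' _ hs]
  congr 1
  have : Set.Ioo (0 : ℝ) 1 • (Subtype.val '' (sphereMap e ⁻¹' s)) =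
      e ⁻¹' (Set.Ioo (0 : ℝ) 1 • (Subtype.val '' s)) := by
    ext x
    simp only [Set.mem_smul, Set.mem_image, Set.mem_preimage]
    constructor
    · rintro ⟨r, hr, _, ⟨σ, hσ, rfl⟩, rfl⟩
      exact ⟨r, hr, e σ, ⟨sphereMap e σ, hσ, rfl⟩, by simp⟩
    · rintro ⟨r, hr, _, ⟨σ, hσ, rfl⟩, h⟩
      refine ⟨r, hr, e.symm σ, ⟨sphereMap e.symm σ, ?_, rfl⟩, ?_⟩
      · have : sphereMap e (sphereMap e.symm σ) = σ := Subtype.ext (by simp)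
        rwa [this]
      · apply e.injective
        rw [map_smul, e.apply_symm_apply, h]
  rw [this]
  exact e.measurePreserving.measure_preimage_equiv (f := e.toMeasurableEquiv) _

lemma measurePreserving_sphereMap {N : ℕ}
    (e : EuclideanSpace ℝ (Fin N) ≃ₗᵢ[ℝ] EuclideanSpace ℝ (Fin N)) :
    MeasurePreserving (sphereMap e) (sphereUniform N) (sphereUniform N) := by
  refine ⟨measurable_sphereMap e, ?_⟩
  unfold sphereUniform
  rw [Measure.map_smul, map_toSphere_sphereMap]

lemma sphereMap_injective {N : ℕ}
    (e : EuclideanSpace ℝ (Fin N) ≃ₗᵢ[ℝ] EuclideanSpace ℝ (Fin N)) :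
    Function.Injective (sphereMap e) := fun _ _ h =>
  Subtype.ext (e.injective (congrArg Subtype.val h))

lemma integral_sphereMap {N : ℕ} {F : Type*} [NormedAddCommGroup F] [NormedSpace ℝ F]
    (e : EuclideanSpace ℝ (Fin N) ≃ₗᵢ[ℝ] EuclideanSpace ℝ (Fin N))
    (G : EuclideanSpace ℝ (Fin N) → F) :
    ∫ σ : Sphere N, G (e σ) ∂sphereUniform N = ∫ σ : Sphere N, G σ ∂sphereUniform N :=
  (measurePreserving_sphereMap e).integral_comp
    ((Continuous.subtype_mk (e.continuous.comp continuous_subtype_val) _).measurableEmbedding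
      (sphereMap_injective e)) (fun σ : Sphere N => G σ)

section
variable {N : ℕ} [Fact (2 ≤ N)]

instance : NeZero N := ⟨by have := Fact.out (p := 2 ≤ N); omega⟩

instance : IsProbabilityMeasure (sphereUniform N) := by
  refine ⟨?_⟩
  unfold sphereUniform
  rw [Measure.smul_apply, smul_eq_mul]
  refine ENNReal.inv_mul_cancel ?_ (measure_ne_top _ _)
  rw [Measure.measure_univ_ne_zero]
  exact Measure.toSphere_ne_zero _

lemma norm_coe_sphere {N : ℕ} (σ : Sphere N) : ‖(σ : EuclideanSpace ℝ (Fin N))‖ = 1 := by simp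

/-- A bounded continuous function is integrable for any finite measure on the sphere. -/
lemma integrable_of_continuous_sphere {N : ℕ} {F : Type*} [NormedAddCommGroup F] [NormedSpace ℝ F]
    [SecondCountableTopology F]
    {G : Sphere N → F} (hG : Continuous G) (ν : Measure (Sphere N)) [IsFiniteMeasure ν] :
    Integrable G ν := by
  obtain ⟨C, hC⟩ := isCompact_univ.exists_bound_of_continuousOn hG.continuousOn
  exact Integrable.of_bound hG.aestronglyMeasurable C (.of_forall fun σ => hC σ (Set.mem_univ _))

/-- The isometry is the reflection in the hyperplane orthogonal to cos t u + sin t v. Turning the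
mirror by t turns images in the plane of u and v by 2t, so these reflections serve as a
one-parameter family in place of rotations. -/
lemma exists_isometry_angle {N : ℕ} {u v : EuclideanSpace ℝ (Fin N)} (hu : ‖u‖ = 1) (hv : ‖v‖ = 1)
    (huv : inner ℝ u v = 0) (t : ℝ) :
    ∃ e : EuclideanSpace ℝ (Fin N) ≃ₗᵢ[ℝ] EuclideanSpace ℝ (Fin N), ∀ x,
      inner ℝ u (e x) = -(inner ℝ u x * Real.cos (2 * t) + inner ℝ v x * Real.sin (2 * t)) ∧
      inner ℝ v (e x) = inner ℝ v x * Real.cos (2 * t) - inner ℝ u x * Real.sin (2 * t) := by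
  set w := Real.cos t • u + Real.sin t • v with hw
  have huu : inner ℝ u u = 1 := by rw [real_inner_self_eq_norm_sq, hu]; norm_num
  have hvv : inner ℝ v v = 1 := by rw [real_inner_self_eq_norm_sq, hv]; norm_num
  have hvu : inner ℝ v u = 0 := by rw [real_inner_comm]; exact huv
  have hcs := Real.sin_sq_add_cos_sq t
  have hw1 : ‖w‖ ^ 2 = 1 := by
    rw [← real_inner_self_eq_norm_sq, hw]
    simp only [inner_add_left, inner_add_right, inner_smul_left, inner_smul_right, huu, hvv, huv,
      hvu]
    simp; nlinarith
  refine ⟨(ℝ ∙ w)ᗮ.reflection, fun x => ?_⟩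
  rw [Submodule.reflection_orthogonal_apply, Submodule.reflection_singleton_apply]
  simp only [RCLike.ofReal_real_eq_id, id, hw1, div_one]
  have hwx : inner ℝ w x = Real.cos t * inner ℝ u x + Real.sin t * inner ℝ v x := by
    rw [hw]; simp [inner_add_left, inner_smul_left]
  have huw : inner ℝ u w = Real.cos t := by
    rw [hw]; simp [inner_add_right, inner_smul_right, huv, hu]
  have hvw : inner ℝ v w = Real.sin t := by
    rw [hw]; simp [inner_add_right, inner_smul_right, hvu, hv]
  rw [Real.cos_two_mul, Real.sin_two_mul]
  have e1 : ∀ y : EuclideanSpace ℝ (Fin N), inner ℝ y (-(2 • inner ℝ w x • w - x)) =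
      inner ℝ y x - 2 * (inner ℝ w x * inner ℝ y w) := by
    intro y
    rw [← Nat.cast_smul_eq_nsmul ℝ]
    simp only [inner_neg_right, inner_sub_right, inner_smul_right]
    push_cast; ring
  rw [e1, e1, hwx, huw, hvw]
  constructor
  · ring
  · linear_combination (-2 * inner ℝ v x) * hcs

/-- Integration by parts on the sphere, along rotations of the plane spanned by `u` and `v`. -/
lemma integral_inner_mul_eq {u v : EuclideanSpace ℝ (Fin N)} (hu : ‖u‖ = 1) (hv : ‖v‖ = 1)
    (huv : inner ℝ u v = 0) {g g' : ℝ → ℝ} (hg : ∀ x, HasDerivAt g (g' x) x)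
    (hg' : Continuous g') :
    ∫ σ : Sphere N, inner ℝ u (σ : EuclideanSpace ℝ (Fin N)) * g (inner ℝ u σ.1)
      ∂sphereUniform N =
    ∫ σ : Sphere N, (inner ℝ v (σ : EuclideanSpace ℝ (Fin N))) ^ 2 * g' (inner ℝ u σ.1)
      ∂sphereUniform N := by
  have hgc : Continuous g := continuous_iff_continuousAt.2 fun x => (hg x).continuousAt
  set P : ℝ → Sphere N → ℝ := fun t σ =>
    -(inner ℝ u σ.1 * Real.cos (2 * t) + inner ℝ v σ.1 * Real.sin (2 * t)) with hP
  set Q : ℝ → Sphere N → ℝ := fun t σ =>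
    inner ℝ v σ.1 * Real.cos (2 * t) - inner ℝ u σ.1 * Real.sin (2 * t) with hQ
  have hcont : ∀ t, Continuous (P t) ∧ Continuous (Q t) := fun t => by
    constructor <;> simp only [hP, hQ] <;> fun_prop
  have hle : ∀ (w : EuclideanSpace ℝ (Fin N)), ‖w‖ = 1 → ∀ σ : Sphere N,
      |inner ℝ w σ.1| ≤ 1 := fun w hw σ => by
    have := abs_real_inner_le_norm w σ.1
    rwa [hw, norm_coe_sphere, mul_one] at this
  have hcomb : ∀ a b t : ℝ, |a| ≤ 1 → |b| ≤ 1 → |a * Real.cos t| + |b * Real.sin t| ≤ 2 := by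
    intro a b t ha hb
    rw [abs_mul, abs_mul]
    have h1 := mul_le_one₀ ha (abs_nonneg _) (Real.abs_cos_le_one t)
    have h2 := mul_le_one₀ hb (abs_nonneg _) (Real.abs_sin_le_one t)
    linarith
  have hPb : ∀ t σ, |P t σ| ≤ 2 := fun t σ => by
    simp only [hP, abs_neg]
    exact (abs_add_le _ _).trans (hcomb _ _ _ (hle u hu σ) (hle v hv σ))
  have hQb : ∀ t σ, |Q t σ| ≤ 2 := fun t σ =>
    (abs_sub _ _).trans (hcomb _ _ _ (hle v hv σ) (hle u hu σ))
  have hPd : ∀ t σ, HasDerivAt (fun t => P t σ) (-2 * Q t σ) t := fun t σ => by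
    have h2 : HasDerivAt (fun t : ℝ => 2 * t) 2 t := by simpa using (hasDerivAt_id t).const_mul 2
    exact ((h2.cos.const_mul (inner ℝ u σ.1)).fun_add
      (h2.sin.const_mul (inner ℝ v σ.1))).fun_neg.congr_deriv (by simp only [hQ]; ring)
  have hQd : ∀ t σ, HasDerivAt (fun t => Q t σ) (2 * P t σ) t := fun t σ => by
    have h2 : HasDerivAt (fun t : ℝ => 2 * t) 2 t := by simpa using (hasDerivAt_id t).const_mul 2
    exact ((h2.cos.const_mul (inner ℝ v σ.1)).fun_sub
      (h2.sin.const_mul (inner ℝ u σ.1))).congr_deriv (by simp only [hP]; ring)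
  obtain ⟨C, hC⟩ := (isCompact_Icc (a := (-2 : ℝ)) (b := 2)).exists_bound_of_continuousOn
    hgc.continuousOn
  obtain ⟨C', hC'⟩ := (isCompact_Icc (a := (-2 : ℝ)) (b := 2)).exists_bound_of_continuousOn
    hg'.continuousOn
  have hC0 : 0 ≤ C := (norm_nonneg _).trans (hC 0 (by constructor <;> norm_num))
  have hC0' : 0 ≤ C' := (norm_nonneg _).trans (hC' 0 (by constructor <;> norm_num))
  -- By invariance of the measure this integral does not depend on t. Since P' = -2Q and Q' = 2P,
  -- its vanishing derivative at 0 is the asserted identity, with `P 0` and `Q 0` in place of the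
  -- two coordinates.
  have hconst : ∀ t, ∫ σ, Q t σ * g (P t σ) ∂sphereUniform N =
      ∫ σ : Sphere N, inner ℝ v σ.1 * g (inner ℝ u σ.1) ∂sphereUniform N := by
    intro t
    obtain ⟨e, he⟩ := exists_isometry_angle hu hv huv t
    rw [← integral_sphereMap e fun x => inner ℝ v x * g (inner ℝ u x)]
    simp_rw [fun x => (he x).1, fun x => (he x).2]
    rfl
  have hderiv := hasDerivAt_integral_of_dominated_loc_of_deriv_le (μ := sphereUniform N)
    (F := fun t σ => Q t σ * g (P t σ))
    (F' := fun t σ => 2 * P t σ * g (P t σ) + Q t σ * (g' (P t σ) * (-2 * Q t σ)))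
    (x₀ := 0) (s := Set.univ) (bound := fun _ => 2 * 2 * C + 2 * (C' * (2 * 2))) Filter.univ_mem
    (.of_forall fun t => ((hcont t).2.mul (hgc.comp (hcont t).1)).aestronglyMeasurable)
    (integrable_of_continuous_sphere ((hcont 0).2.mul (hgc.comp (hcont 0).1)) _)
    (by
      have h1 := (hcont 0).1
      have h2 := (hcont 0).2
      exact (Continuous.add ((continuous_const.mul h1).mul (hgc.comp h1))
        (h2.mul ((hg'.comp h1).mul (continuous_const.mul h2)))).aestronglyMeasurable)
    (.of_forall fun σ t _ => by
      have hp := hPb t σ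
      have hq := hQb t σ
      have h1 := hC (P t σ) (abs_le.1 hp)
      have h2 := hC' (P t σ) (abs_le.1 hp)
      rw [Real.norm_eq_abs] at *
      refine (abs_add_le _ _).trans ?_
      simp only [abs_mul, abs_neg, abs_two]
      gcongr)
    (integrable_const _)
    (.of_forall fun σ t _ => ((hQd t σ).fun_mul ((hg (P t σ)).comp t (hPd t σ))))
  have hz := hderiv.2
  simp_rw [hconst] at hz
  have hzero := hz.unique (hasDerivAt_const _ _)
  -- At t = 0 the reflection carries the two coordinates to `P 0` and `Q 0`, which brings both sides
  -- of the goal to the form just obtained.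
  obtain ⟨e, he⟩ := exists_isometry_angle hu hv huv 0
  rw [← integral_sphereMap e fun x => inner ℝ u x * g (inner ℝ u x),
    ← integral_sphereMap e fun x => inner ℝ v x ^ 2 * g' (inner ℝ u x)]
  simp_rw [fun x => (he x).1, fun x => (he x).2]
  have i1 : Integrable (fun σ => P 0 σ * g (P 0 σ)) (sphereUniform N) :=
    integrable_of_continuous_sphere ((hcont 0).1.mul (hgc.comp (hcont 0).1)) _
  have i2 : Integrable (fun σ => Q 0 σ ^ 2 * g' (P 0 σ)) (sphereUniform N) :=
    integrable_of_continuous_sphere (((hcont 0).2.pow 2).mul (hg'.comp (hcont 0).1)) _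
  have e3 : ∀ σ, 2 * P 0 σ * g (P 0 σ) + Q 0 σ * (g' (P 0 σ) * (-2 * Q 0 σ)) =
      2 * (P 0 σ * g (P 0 σ)) - 2 * (Q 0 σ ^ 2 * g' (P 0 σ)) := fun σ => by ring
  simp_rw [e3] at hzero
  rw [integral_sub (i1.const_mul 2) (i2.const_mul 2), integral_const_mul,
    integral_const_mul] at hzero
  change ∫ σ, P 0 σ * g (P 0 σ) ∂sphereUniform N = ∫ σ, Q 0 σ ^ 2 * g' (P 0 σ) ∂sphereUniform N
  linarith

/-- The first coordinate of a point of the sphere. -/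
def height (σ : Sphere N) : ℝ := (σ : EuclideanSpace ℝ (Fin N)) 0

lemma continuous_height : Continuous (height (N := N)) := by unfold height; fun_prop

lemma abs_height_le (σ : Sphere N) : |height σ| ≤ 1 := by
  have := PiLp.norm_apply_le σ.1 0
  rwa [norm_coe_sphere] at this

lemma height_eq_inner (σ : Sphere N) :
    height σ = inner ℝ (EuclideanSpace.single (0 : Fin N) (1 : ℝ)) σ.1 := by
  simp [height, EuclideanSpace.inner_single_left]

/-- The law of `⟨e, σ⟩` does not depend on the unit vector `e`. -/
lemma integral_comp_inner {F : Type*} [NormedAddCommGroup F] [NormedSpace ℝ F]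
    {e : EuclideanSpace ℝ (Fin N)} (he : ‖e‖ = 1) (G : ℝ → F) :
    ∫ σ : Sphere N, G (inner ℝ e σ.1) ∂sphereUniform N =
      ∫ σ, G (height σ) ∂sphereUniform N := by
  have h := Submodule.reflection_sub (v := e) (w := EuclideanSpace.single (0 : Fin N) (1 : ℝ))
    (by rw [he]; simp)
  set R := (ℝ ∙ (e - EuclideanSpace.single (0 : Fin N) (1 : ℝ)))ᗮ.reflection
  simp_rw [height_eq_inner]
  rw [← integral_sphereMap R fun x => G (inner ℝ (EuclideanSpace.single (0 : Fin N) (1 : ℝ)) x)]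
  simp_rw [← h, R.inner_map_map]

/-- Integration by parts for the law of a coordinate. -/
lemma integral_height_mul {g g' : ℝ → ℝ} (hg : ∀ x, HasDerivAt g (g' x) x) (hg' : Continuous g') :
    ((N : ℝ) - 1) * ∫ σ : Sphere N, height σ * g (height σ) ∂sphereUniform N =
      ∫ σ : Sphere N, (1 - height σ ^ 2) * g' (height σ) ∂sphereUniform N := by
  have hgc : Continuous g := continuous_iff_continuousAt.2 fun x => (hg x).continuousAt
  -- Each of the N - 1 other coordinates gives the same identity. Summing them uses that their
  -- squares add up to 1 minus the squared height.
  have key : ∀ j ∈ Finset.univ.erase (0 : Fin N),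
      ∫ σ : Sphere N, height σ * g (height σ) ∂sphereUniform N =
      ∫ σ : Sphere N, (σ.1 j) ^ 2 * g' (height σ) ∂sphereUniform N := by
    intro j hj
    have := integral_inner_mul_eq (N := N) (u := EuclideanSpace.single 0 1)
      (v := EuclideanSpace.single j 1) (by simp) (by simp)
      (by simp [EuclideanSpace.inner_single_left, (Finset.ne_of_mem_erase hj).symm]) hg hg'
    simp_rw [← height_eq_inner] at this
    simpa [EuclideanSpace.inner_single_left] using this
  have hsum := Finset.sum_congr rfl key
  rw [Finset.sum_const, Finset.card_erase_of_mem (Finset.mem_univ _), Finset.card_univ,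
    Fintype.card_fin, nsmul_eq_mul, Nat.cast_sub (by have := Fact.out (p := 2 ≤ N); omega),
    Nat.cast_one] at hsum
  rw [hsum, ← integral_finsetSum]
  · refine integral_congr_ae (.of_forall fun σ => ?_)
    simp only
    rw [← Finset.sum_mul]
    congr 1
    have h1 : ∑ j, (σ.1 j) ^ 2 = 1 := by
      rw [← EuclideanSpace.real_norm_sq_eq, norm_coe_sphere]; norm_num
    rw [← Finset.add_sum_erase _ _ (Finset.mem_univ (0 : Fin N))] at h1
    unfold height
    linarith
  · intro j _
    refine integrable_of_continuous_sphere ?_ _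
    have := continuous_height (N := N)
    exact Continuous.mul (by fun_prop) (hg'.comp this)

end

section
variable {N : ℕ} [Fact (2 ≤ N)]

/-! ### Exponential moments of a coordinate and Bessel functions -/

variable (N) in
/-- The exponential moments `∫ t^j exp(x t)` of the first coordinate `t` on the sphere. -/
def expMoment (j : ℕ) (x : ℝ) : ℝ :=
  ∫ σ : Sphere N, height σ ^ j * Real.exp (x * height σ) ∂sphereUniform N

lemma integrable_comp_height {G : ℝ → ℝ} (hG : Continuous G) :
    Integrable (fun σ : Sphere N => G (height σ)) (sphereUniform N) :=
  integrable_of_continuous_sphere (hG.comp continuous_height) _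

lemma hasDerivAt_expMoment (j : ℕ) (x : ℝ) :
    HasDerivAt (expMoment N j) (expMoment N (j + 1) x) x := by
  have : integrableExpSet (height (N := N)) (sphereUniform N) = Set.univ := by
    ext t
    simp only [Set.mem_univ, iff_true]
    exact integrable_comp_height (G := fun s => Real.exp (t * s)) (by fun_prop)
  exact hasDerivAt_integral_pow_mul_exp_real (by rw [this, interior_univ]; trivial) j

lemma expMoment_zero_pos (x : ℝ) : 0 < expMoment N 0 x := by
  unfold expMoment
  simp only [pow_zero, one_mul]
  exact integral_exp_pos (integrable_comp_height (G := fun s => Real.exp (x * s)) (by fun_prop))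

lemma abs_expMoment_le (j : ℕ) (x : ℝ) : |expMoment N j x| ≤ expMoment N 0 x := by
  unfold expMoment
  refine abs_integral_le_integral_abs.trans (integral_mono
    (integrable_comp_height (G := fun s => |s ^ j * Real.exp (x * s)|) (by fun_prop))
    (integrable_comp_height (G := fun s => s ^ 0 * Real.exp (x * s)) (by fun_prop)) fun σ => ?_)
  simp only [abs_mul, abs_pow, Real.abs_exp, pow_zero, one_mul]
  exact mul_le_of_le_one_left (Real.exp_pos _).le (pow_le_one₀ (abs_nonneg _) (abs_height_le σ))

lemma expMoment_zero_zero : expMoment N 0 0 = 1 := by simp [expMoment]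

/-- The modified Bessel equation for the exponential moments. -/
lemma bessel_ode (x : ℝ) :
    ((N : ℝ) - 1) * expMoment N 1 x = x * (expMoment N 0 x - expMoment N 2 x) := by
  have h := integral_height_mul (N := N) (g := fun s => Real.exp (x * s))
    (g' := fun s => x * Real.exp (x * s))
    (fun s => by
      have : HasDerivAt (fun s : ℝ => x * s) x s := by simpa using (hasDerivAt_id s).const_mul x
      exact this.exp.congr_deriv (by ring)) (by fun_prop)
  have e : (fun σ : Sphere N => (1 - height σ ^ 2) * (x * Real.exp (x * height σ))) =
      fun σ => x * (height σ ^ 0 * Real.exp (x * height σ)) -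
        x * (height σ ^ 2 * Real.exp (x * height σ)) := by
    ext σ; ring
  rw [e, integral_sub
    (integrable_comp_height (G := fun s => x * (s ^ 0 * Real.exp (x * s))) (by fun_prop))
    (integrable_comp_height (G := fun s => x * (s ^ 2 * Real.exp (x * s))) (by fun_prop)),
    integral_const_mul, integral_const_mul] at h
  unfold expMoment
  simp only [pow_one]
  linarith

lemma integral_height_odd {G : ℝ → ℝ} (hG : ∀ s, G (-s) = -G s) :
    ∫ σ : Sphere N, G (height σ) ∂sphereUniform N = 0 := by
  have := integral_sphereMap (LinearIsometryEquiv.neg ℝ (E := EuclideanSpace ℝ (Fin N)))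
    fun x => G (x 0)
  simp only [LinearIsometryEquiv.coe_neg, PiLp.neg_apply, hG, integral_neg] at this
  unfold height
  linarith

variable (N) in
/-- The even moments of the first coordinate on the sphere. -/
def evenMoment (m : ℕ) : ℝ := ∫ σ : Sphere N, height σ ^ (2 * m) ∂sphereUniform N

/-- Integration by parts with g(s) = s^(2m+1). -/
lemma evenMoment_succ (m : ℕ) :
    (2 * (m : ℝ) + N) * evenMoment N (m + 1) = (2 * m + 1) * evenMoment N m := by
  have h := integral_height_mul (N := N) (g := fun s => s ^ (2 * m + 1))
    (g' := fun s => (2 * m + 1 : ℝ) * s ^ (2 * m))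
    (fun s => by simpa using hasDerivAt_pow (2 * m + 1) s) (by fun_prop)
  have e : (fun σ : Sphere N => (1 - height σ ^ 2) * ((2 * m + 1 : ℝ) * height σ ^ (2 * m))) =
      fun σ => (2 * m + 1 : ℝ) * height σ ^ (2 * m) -
        (2 * m + 1 : ℝ) * height σ ^ (2 * (m + 1)) := by
    ext σ; ring
  have e2 : (fun σ : Sphere N => height σ * height σ ^ (2 * m + 1)) =
      fun σ => height σ ^ (2 * (m + 1)) := by
    ext σ; ring
  rw [e, e2, integral_sub
    (integrable_comp_height (G := fun s => (2 * m + 1 : ℝ) * s ^ (2 * m)) (by fun_prop))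
    (integrable_comp_height (G := fun s => (2 * m + 1 : ℝ) * s ^ (2 * (m + 1))) (by fun_prop)),
    integral_const_mul, integral_const_mul] at h
  unfold evenMoment
  linarith

/-- The moment recursion is the ratio of consecutive coefficients of the Bessel series, so induction
identifies the two. -/
lemma evenMoment_div_factorial (m : ℕ) :
    evenMoment N m / (2 * m)! =
      Real.Gamma ((N : ℝ) / 2) / (4 ^ m * m ! * Real.Gamma (m + N / 2)) := by
  have hN : (0 : ℝ) < N := by have := Fact.out (p := 2 ≤ N); positivity
  induction m with
  | zero =>
    have : Real.Gamma ((N : ℝ) / 2) ≠ 0 := (Real.Gamma_pos_of_pos (by positivity)).ne'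
    simp [evenMoment, this]
  | succ m ih =>
    have h := evenMoment_succ (N := N) m
    have hG := Real.Gamma_add_one (s := (m : ℝ) + N / 2) (by positivity)
    have hG0 : Real.Gamma ((m : ℝ) + N / 2) ≠ 0 := (Real.Gamma_pos_of_pos (by positivity)).ne'
    have e1 : ((m + 1 : ℕ) : ℝ) + (N : ℝ) / 2 = (m : ℝ) + N / 2 + 1 := by push_cast; ring
    rw [e1, hG]
    have e2 : ((2 * (m + 1))! : ℝ) = (2 * m + 2) * ((2 * m + 1) * (2 * m)!) := by
      rw [show 2 * (m + 1) = 2 * m + 1 + 1 by ring, Nat.factorial_succ, Nat.factorial_succ]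
      push_cast; ring
    have e3 : ((m + 1)! : ℝ) = (m + 1) * m ! := by rw [Nat.factorial_succ]; push_cast; ring
    rw [e2, e3]
    have hf : ((2 * m)! : ℝ) ≠ 0 := by positivity
    have hf' : ((m)! : ℝ) ≠ 0 := by positivity
    have h1 : (2 * (m : ℝ) + N) ≠ 0 := by positivity
    have h2 : (2 * (m : ℝ) + 1) ≠ 0 := by positivity
    have h3 : ((m : ℝ) + 1) ≠ 0 := by positivity
    have h4 : ((m : ℝ) + N / 2) ≠ 0 := by positivity
    have h5 : (2 * (m : ℝ) + 2) ≠ 0 := by positivity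
    have hm : evenMoment N (m + 1) = (2 * m + 1) * evenMoment N m / (2 * m + N) := by
      field_simp; linarith
    have : evenMoment N (m + 1) / ((2 * m + 2) * ((2 * m + 1) * (2 * m)!)) =
        evenMoment N m / (2 * m)! / ((2 * m + N) * (2 * m + 2)) := by
      rw [hm]; field_simp
    rw [this, ih]
    rw [div_div]
    congr 1
    ring

/-- Antipodal symmetry removes the sinh part of the exponential. The cosh series may be integrated
termwise, dominated by its value at |x| because heights are at most 1. -/
lemma hasSum_expMoment_zero (x : ℝ) :
    HasSum (fun m : ℕ => x ^ (2 * m) * (evenMoment N m / (2 * m)!)) (expMoment N 0 x) := by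
  have h1 : expMoment N 0 x = ∫ σ : Sphere N, Real.cosh (x * height σ) ∂sphereUniform N := by
    have hs : ∫ σ : Sphere N, Real.sinh (x * height σ) ∂sphereUniform N = 0 :=
      integral_height_odd (G := fun s => Real.sinh (x * s)) (fun s => by simp)
    have : ∀ σ : Sphere N, height σ ^ 0 * Real.exp (x * height σ) =
        Real.cosh (x * height σ) + Real.sinh (x * height σ) := fun σ => by
      rw [Real.cosh_add_sinh]; simp
    unfold expMoment
    simp_rw [this]
    rw [integral_add (integrable_comp_height (G := fun s => Real.cosh (x * s)) (by fun_prop))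
      (integrable_comp_height (G := fun s => Real.sinh (x * s)) (by fun_prop)), hs, add_zero]
  rw [h1]
  have h2 := hasSum_integral_of_dominated_convergence (μ := sphereUniform N)
    (F := fun (m : ℕ) (σ : Sphere N) => (x * height σ) ^ (2 * m) / (2 * m)!)
    (f := fun σ => Real.cosh (x * height σ))
    (fun m _ => |x| ^ (2 * m) / (2 * m)!)
    (fun m => (integrable_comp_height (G := fun s => (x * s) ^ (2 * m) / (2 * m)!)
      (by fun_prop)).aestronglyMeasurable)
    (fun m => .of_forall fun σ => by
      rw [norm_div, norm_pow, Real.norm_eq_abs, abs_mul, Real.norm_natCast]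
      gcongr
      exact mul_le_of_le_one_right (abs_nonneg _) (abs_height_le σ))
    (.of_forall fun _ => (Real.hasSum_cosh |x|).summable) (integrable_const _)
    (.of_forall fun σ => Real.hasSum_cosh _)
  convert! h2 using 2 with m
  simp_rw [mul_pow, mul_div_right_comm _ _ (((2 * m)! : ℕ) : ℝ)]
  rw [integral_const_mul]
  unfold evenMoment
  ring

lemma hasSum_expMoment_one (x : ℝ) :
    HasSum (fun m : ℕ => x ^ (2 * m + 1) * (evenMoment N (m + 1) / (2 * m + 1)!))
      (expMoment N 1 x) := by
  have h1 : expMoment N 1 x =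
      ∫ σ : Sphere N, height σ * Real.sinh (x * height σ) ∂sphereUniform N := by
    have hs : ∫ σ : Sphere N, height σ * Real.cosh (x * height σ) ∂sphereUniform N = 0 :=
      integral_height_odd (G := fun s => s * Real.cosh (x * s)) (fun s => by simp)
    have : ∀ σ : Sphere N, height σ ^ 1 * Real.exp (x * height σ) =
        height σ * Real.cosh (x * height σ) + height σ * Real.sinh (x * height σ) := fun σ => by
      rw [← mul_add, Real.cosh_add_sinh]; simp
    unfold expMoment
    simp_rw [this]
    rw [integral_add (integrable_comp_height (G := fun s => s * Real.cosh (x * s)) (by fun_prop))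
      (integrable_comp_height (G := fun s => s * Real.sinh (x * s)) (by fun_prop)), hs, zero_add]
  rw [h1]
  have h2 := hasSum_integral_of_dominated_convergence (μ := sphereUniform N)
    (F := fun (m : ℕ) (σ : Sphere N) => height σ * ((x * height σ) ^ (2 * m + 1) / (2 * m + 1)!))
    (f := fun σ => height σ * Real.sinh (x * height σ))
    (fun m _ => |x| ^ (2 * m + 1) / (2 * m + 1)!)
    (fun m => (integrable_comp_height (G := fun s => s * ((x * s) ^ (2 * m + 1) / (2 * m + 1)!))
      (by fun_prop)).aestronglyMeasurable)
    (fun m => .of_forall fun σ => by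
      rw [norm_mul, norm_div, norm_pow, Real.norm_eq_abs, Real.norm_eq_abs, abs_mul,
        Real.norm_natCast]
      refine (mul_le_of_le_one_left (by positivity) (abs_height_le σ)).trans ?_
      gcongr
      exact mul_le_of_le_one_right (abs_nonneg _) (abs_height_le σ))
    (.of_forall fun _ => (Real.hasSum_sinh |x|).summable) (integrable_const _)
    (.of_forall fun σ => (Real.hasSum_sinh _).mul_left _)
  convert! h2 using 2 with m
  have : ∀ σ : Sphere N, height σ * ((x * height σ) ^ (2 * m + 1) / (2 * m + 1)!) =
      x ^ (2 * m + 1) / (2 * m + 1)! * height σ ^ (2 * (m + 1)) := fun σ => by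
    rw [mul_pow]; ring
  simp_rw [this]
  rw [integral_const_mul]
  unfold evenMoment
  ring

lemma besselI_term (x : ℝ) (hx : 0 < x) (m : ℕ) (ν : ℝ) :
    (x / 2) ^ (2 * (m : ℝ) + ν) = (x / 2) ^ ν * (x ^ (2 * m) / 4 ^ m) := by
  rw [Real.rpow_add (by positivity), mul_comm]
  congr 1
  rw [show 2 * (m : ℝ) = ((2 * m : ℕ) : ℝ) by push_cast; ring, Real.rpow_natCast, div_pow,
    pow_mul 2]
  norm_num

/-- The prefactor is the same as in `besselI_half_eq`, so it cancels in the Bessel ratio. -/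
lemma besselI_sub_one_eq {x : ℝ} (hx : 0 < x) :
    besselI ((N : ℝ) / 2 - 1) x =
      (x / 2) ^ ((N : ℝ) / 2 - 1) / Real.Gamma ((N : ℝ) / 2) * expMoment N 0 x := by
  have hN : (0 : ℝ) < N := by have := Fact.out (p := 2 ≤ N); positivity
  have hG : Real.Gamma ((N : ℝ) / 2) ≠ 0 := (Real.Gamma_pos_of_pos (by positivity)).ne'
  refine HasSum.tsum_eq ?_
  convert! (hasSum_expMoment_zero (N := N) x).mul_left
    ((x / 2) ^ ((N : ℝ) / 2 - 1) / Real.Gamma ((N : ℝ) / 2)) using 2 with m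
  have hG' : Real.Gamma ((m : ℝ) + N / 2) ≠ 0 := (Real.Gamma_pos_of_pos (by positivity)).ne'
  rw [evenMoment_div_factorial, besselI_term x hx,
    show (m : ℝ) + ((N : ℝ) / 2 - 1) + 1 = m + N / 2 by ring]
  field_simp

lemma besselI_half_eq {x : ℝ} (hx : 0 < x) :
    besselI ((N : ℝ) / 2) x =
      (x / 2) ^ ((N : ℝ) / 2 - 1) / Real.Gamma ((N : ℝ) / 2) * expMoment N 1 x := by
  have hN : (0 : ℝ) < N := by have := Fact.out (p := 2 ≤ N); positivity
  have hG : Real.Gamma ((N : ℝ) / 2) ≠ 0 := (Real.Gamma_pos_of_pos (by positivity)).ne'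
  refine HasSum.tsum_eq ?_
  convert! (hasSum_expMoment_one (N := N) x).mul_left
    ((x / 2) ^ ((N : ℝ) / 2 - 1) / Real.Gamma ((N : ℝ) / 2)) using 2 with m
  have hG' : Real.Gamma ((m : ℝ) + 1 + N / 2) ≠ 0 := (Real.Gamma_pos_of_pos (by positivity)).ne'
  have h1 : evenMoment N (m + 1) / (2 * m + 1)! = (2 * m + 2) * (evenMoment N (m + 1) /
      (2 * (m + 1))!) := by
    rw [show 2 * (m + 1) = 2 * m + 1 + 1 by ring, Nat.factorial_succ (2 * m + 1)]
    push_cast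
    field_simp
    ring
  have e3 : ((m + 1)! : ℝ) = (m + 1) * m ! := by rw [Nat.factorial_succ]; push_cast; ring
  have e4 : (x / 2) ^ ((N : ℝ) / 2) = (x / 2) ^ ((N : ℝ) / 2 - 1) * (x / 2) := by
    rw [← Real.rpow_add_one (by positivity)]; congr 1; ring
  rw [h1, evenMoment_div_factorial, besselI_term x hx, e3, e4,
    show (m : ℝ) + (N : ℝ) / 2 + 1 = m + 1 + N / 2 by ring]
  have hm : ((m ! : ℕ) : ℝ) ≠ 0 := by positivity
  have hm1 : ((m : ℝ) + 1) ≠ 0 := by positivity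
  push_cast
  field_simp
  ring

lemma besselRatio_eq {x : ℝ} (hx : 0 < x) :
    besselRatio N x = expMoment N 1 x / expMoment N 0 x := by
  have hN : (0 : ℝ) < N := by have := Fact.out (p := 2 ≤ N); positivity
  have hG : 0 < Real.Gamma ((N : ℝ) / 2) := Real.Gamma_pos_of_pos (by positivity)
  unfold besselRatio
  rw [besselI_half_eq hx, besselI_sub_one_eq hx, mul_div_mul_left]
  have : 0 < (x / 2) ^ ((N : ℝ) / 2 - 1) := Real.rpow_pos_of_pos (by positivity) _
  positivity

end

section
variable {N : ℕ} [Fact (2 ≤ N)]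

/-! ### The mean and the variance of a coordinate under an exponential tilt -/

variable (N) in
/-- The mean of the first coordinate under the tilt by `exp(x t)`. -/
def tiltMean (x : ℝ) : ℝ := expMoment N 1 x / expMoment N 0 x

variable (N) in
/-- The variance of the first coordinate under the tilt by `exp(x t)`. -/
def tiltVar (x : ℝ) : ℝ := expMoment N 2 x / expMoment N 0 x - tiltMean N x ^ 2

lemma abs_expMoment_div_le (j : ℕ) (x : ℝ) : |expMoment N j x / expMoment N 0 x| ≤ 1 := by
  have h0 := expMoment_zero_pos (N := N) x
  rw [abs_div, abs_of_pos h0, div_le_one h0]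
  exact abs_expMoment_le j x

lemma hasDerivAt_expMoment_div (j : ℕ) (x : ℝ) :
    HasDerivAt (fun x => expMoment N j x / expMoment N 0 x)
      (expMoment N (j + 1) x / expMoment N 0 x -
        expMoment N j x / expMoment N 0 x * tiltMean N x) x := by
  have h0 := (expMoment_zero_pos (N := N) x).ne'
  refine ((hasDerivAt_expMoment j x).fun_div (hasDerivAt_expMoment 0 x) h0).congr_deriv ?_
  unfold tiltMean
  field_simp

lemma hasDerivAt_tiltMean (x : ℝ) : HasDerivAt (tiltMean N) (tiltVar N x) x :=
  (hasDerivAt_expMoment_div 1 x).congr_deriv (by unfold tiltVar tiltMean; ring)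

lemma continuous_tiltMean : Continuous (tiltMean N) :=
  continuous_iff_continuousAt.2 fun x => (hasDerivAt_tiltMean x).continuousAt

lemma abs_tiltMean_le (x : ℝ) : |tiltMean N x| ≤ 1 := abs_expMoment_div_le 1 x

lemma tiltVar_le (x : ℝ) : tiltVar N x ≤ 1 := by
  have := (abs_le.1 (abs_expMoment_div_le (N := N) 2 x)).2
  unfold tiltVar
  nlinarith [sq_nonneg (tiltMean N x)]

lemma expMoment_one_zero : expMoment N 1 0 = 0 := by
  unfold expMoment
  simp only [zero_mul, Real.exp_zero, mul_one]
  exact integral_height_odd (G := fun s => s ^ 1) (fun s => by simp)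

lemma tiltMean_zero : tiltMean N 0 = 0 := by simp [tiltMean, expMoment_one_zero]

lemma expMoment_two_zero : expMoment N 2 0 = 1 / N := by
  have hN : (N : ℝ) ≠ 0 := by have := Fact.out (p := 2 ≤ N); positivity
  have h := evenMoment_succ (N := N) 0
  have h0 : evenMoment N 0 = 1 := by simp [evenMoment]
  have h1 : expMoment N 2 0 = evenMoment N 1 := by simp [expMoment, evenMoment]
  rw [h1]
  rw [h0] at h
  field_simp
  push_cast at h
  linarith

/-- The tilt density is at least exp(-|x|) before normalization. Hence the centred second moment is
at least exp(-|x|) times the untilted second moment about the same point c, which is 1/N + c². -/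
lemma tiltVar_pos (x : ℝ) : 0 < tiltVar N x := by
  have hN : (0 : ℝ) < N := by have := Fact.out (p := 2 ≤ N); positivity
  have h0 := expMoment_zero_pos (N := N) x
  set c := tiltMean N x with hc
  have expand : ∀ y, ∫ σ : Sphere N, (height σ - c) ^ 2 * Real.exp (y * height σ)
      ∂sphereUniform N = expMoment N 2 y - 2 * c * expMoment N 1 y + c ^ 2 * expMoment N 0 y := by
    intro y
    unfold expMoment
    rw [← integral_const_mul, ← integral_const_mul, ← integral_sub, ← integral_add]
    · congr 1; ext σ; ring
    · exact integrable_comp_height (G := fun s => s ^ 2 * Real.exp (y * s) -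
        2 * c * (s ^ 1 * Real.exp (y * s))) (by fun_prop)
    · exact integrable_comp_height (G := fun s => c ^ 2 * (s ^ 0 * Real.exp (y * s))) (by fun_prop)
    · exact integrable_comp_height (G := fun s => s ^ 2 * Real.exp (y * s)) (by fun_prop)
    · exact integrable_comp_height (G := fun s => 2 * c * (s ^ 1 * Real.exp (y * s)))
        (by fun_prop)
  have h1 := expand x
  have h2 := expand 0
  rw [expMoment_two_zero, expMoment_one_zero, expMoment_zero_zero] at h2
  have hle : Real.exp (-|x|) * ∫ σ : Sphere N, (height σ - c) ^ 2 * Real.exp (0 * height σ)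
      ∂sphereUniform N ≤
      ∫ σ : Sphere N, (height σ - c) ^ 2 * Real.exp (x * height σ) ∂sphereUniform N := by
    rw [← integral_const_mul]
    refine integral_mono (integrable_comp_height
      (G := fun s => Real.exp (-|x|) * ((s - c) ^ 2 * Real.exp (0 * s))) (by fun_prop))
      (integrable_comp_height (G := fun s => (s - c) ^ 2 * Real.exp (x * s)) (by fun_prop))
      fun σ => ?_
    simp only [zero_mul, Real.exp_zero, mul_one]
    rw [mul_comm]
    refine mul_le_mul_of_nonneg_left (Real.exp_le_exp.2 ?_) (sq_nonneg _)
    have h3 := neg_abs_le (x * height σ)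
    rw [abs_mul] at h3
    have := mul_le_of_le_one_right (abs_nonneg x) (abs_height_le σ)
    linarith
  rw [h1, h2] at hle
  have hpos : 0 < Real.exp (-|x|) * (1 / (N : ℝ) - 2 * c * 0 + c ^ 2 * 1) := by
    rw [mul_zero, sub_zero]; positivity
  have key : expMoment N 2 x - 2 * c * expMoment N 1 x + c ^ 2 * expMoment N 0 x =
      expMoment N 0 x * tiltVar N x := by
    have : expMoment N 1 x = c * expMoment N 0 x := by
      rw [hc]; unfold tiltMean; field_simp
    unfold tiltVar
    rw [← hc, this]
    field_simp
    ring
  rw [key] at hle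
  exact pos_of_mul_pos_right (hpos.trans_le hle) h0.le

lemma abs_tiltVar_le (x : ℝ) : |tiltVar N x| ≤ 1 := by
  rw [abs_of_pos (tiltVar_pos x)]; exact tiltVar_le x

/-- The derivative is the third cumulant. Normalized moments are at most 1 in absolute value, so its
terms contribute 1 + 1 + 2 = 4. -/
lemma exists_hasDerivAt_tiltVar (x : ℝ) : ∃ d, HasDerivAt (tiltVar N) d x ∧ |d| ≤ 4 := by
  refine ⟨_, (hasDerivAt_expMoment_div 2 x).fun_sub ((hasDerivAt_tiltMean x).fun_pow 2), ?_⟩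
  have h1 := abs_expMoment_div_le (N := N) 2 x
  have h2 := abs_expMoment_div_le (N := N) 3 x
  have h3 := abs_tiltMean_le (N := N) x
  have h4 := abs_tiltVar_le (N := N) x
  have h5 : |expMoment N 2 x / expMoment N 0 x * tiltMean N x| ≤ 1 := by
    rw [abs_mul]; exact mul_le_one₀ h1 (abs_nonneg _) h3
  have h6 : |tiltMean N x * tiltVar N x| ≤ 1 := by
    rw [abs_mul]; exact mul_le_one₀ h3 (abs_nonneg _) h4
  rw [abs_le] at *
  norm_num
  constructor <;> nlinarith

lemma continuous_tiltVar : Continuous (tiltVar N) :=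
  continuous_iff_continuousAt.2 fun x => (exists_hasDerivAt_tiltVar x).choose_spec.1.continuousAt

lemma abs_tiltVar_sub_le (x y : ℝ) : |tiltVar N y - tiltVar N x| ≤ 4 * |y - x| := by
  choose d hd hd' using exists_hasDerivAt_tiltVar (N := N)
  simpa using convex_univ.norm_image_sub_le_of_norm_hasDerivWithin_le (f := tiltVar N)
    (C := 4) (x := x) (y := y) (fun x _ => (hd x).hasDerivWithinAt) (fun x _ => hd' x)
    (Set.mem_univ _) (Set.mem_univ _)

lemma abs_tiltMean_sub_le (x y : ℝ) : |tiltMean N y - tiltMean N x| ≤ |y - x| := by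
  simpa using convex_univ.norm_image_sub_le_of_norm_hasDerivWithin_le (f := tiltMean N)
    (C := 1) (x := x) (y := y) (fun x _ => (hasDerivAt_tiltMean x).hasDerivWithinAt)
    (fun x _ => abs_tiltVar_le x) (Set.mem_univ _) (Set.mem_univ _)

lemma abs_tiltMean_taylor_le (b x : ℝ) :
    |tiltMean N x - tiltMean N b - tiltVar N b * (x - b)| ≤ 4 * (x - b) ^ 2 := by
  refine abs_taylor_le_of_hasDerivWithinAt (s := Set.univ) Set.ordConnected_univ (Set.mem_univ _)
    (Set.mem_univ _) (fun x _ => (hasDerivAt_tiltMean x).hasDerivWithinAt) fun y _ hy => ?_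
  exact (abs_tiltVar_sub_le b y).trans (by gcongr)

/-- This is the Bessel equation divided by `expMoment N 0 x`. It identifies the bracket in the
definition of B² with the variance f'(b). -/
lemma tiltVar_riccati {x : ℝ} (hx : x ≠ 0) :
    tiltVar N x = 1 - ((N : ℝ) - 1) * tiltMean N x / x - tiltMean N x ^ 2 := by
  have h := bessel_ode (N := N) x
  have h0 := (expMoment_zero_pos (N := N) x).ne'
  have h2 : expMoment N 2 x = expMoment N 0 x - ((N : ℝ) - 1) * expMoment N 1 x / x := by
    rw [h]; field_simp; ring
  have h3 : expMoment N 2 x / expMoment N 0 x = 1 - ((N : ℝ) - 1) * tiltMean N x / x := by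
    rw [h2]; unfold tiltMean; field_simp
  unfold tiltVar
  rw [h3]

lemma expMoment_two_pos (x : ℝ) : 0 < expMoment N 2 x := by
  have h0 := expMoment_zero_pos (N := N) x
  have h1 := tiltVar_pos (N := N) x
  unfold tiltVar at h1
  have : 0 < expMoment N 2 x / expMoment N 0 x := by nlinarith [sq_nonneg (tiltMean N x)]
  exact (div_pos_iff_of_pos_right h0).1 this

lemma expMoment_one_pos {x : ℝ} (hx : 0 < x) : 0 < expMoment N 1 x := by
  have h := strictMono_of_hasDerivAt_pos (fun x => hasDerivAt_expMoment (N := N) 1 x)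
    (fun x => expMoment_two_pos x) hx
  rwa [expMoment_one_zero] at h

lemma tiltMean_pos {x : ℝ} (hx : 0 < x) : 0 < tiltMean N x :=
  div_pos (expMoment_one_pos hx) (expMoment_zero_pos x)

/-- `f(x)/x` has negative derivative. -/
lemma mul_tiltVar_lt {x : ℝ} (hx : 0 < x) : x * tiltVar N x < tiltMean N x := by
  obtain ⟨k, hk⟩ : ∃ k, N = k + 2 := ⟨N - 2, by have := Fact.out (p := 2 ≤ N); omega⟩
  have hkN : (N : ℝ) = k + 2 := by rw [hk]; push_cast; ring
  -- By the Riccati identity G is x^(N-1) M² (x f' - f), with M the zeroth moment. The Bessel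
  -- equation collapses its derivative to -2 x^(N-1) (M')², so G is negative after its zero at the
  -- origin.
  set G : ℝ → ℝ := fun x => x ^ (k + 2) * (expMoment N 0 x ^ 2 - expMoment N 1 x ^ 2) -
    N * (x ^ (k + 1) * (expMoment N 0 x * expMoment N 1 x)) with hG
  have hd : ∀ x, HasDerivAt G (-2 * x ^ (k + 1) * expMoment N 1 x ^ 2) x := by
    intro x
    have d0 := hasDerivAt_expMoment (N := N) 0 x
    have d1 := hasDerivAt_expMoment (N := N) 1 x
    refine (((hasDerivAt_pow (k + 2) x).fun_mul ((d0.fun_pow 2).fun_sub (d1.fun_pow 2))).fun_sub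
      (((hasDerivAt_pow (k + 1) x).fun_mul (d0.fun_mul d1)).const_mul (N : ℝ))).congr_deriv ?_
    have ode := bessel_ode (N := N) x
    simp only [Nat.add_sub_cancel, zero_add, show k + 2 - 1 = k + 1 by omega,
      Nat.reduceAdd, Nat.reduceSub]
    rw [hkN] at ode ⊢
    push_cast
    linear_combination (-(k + 2 : ℝ) * x ^ k * expMoment N 0 x -
      2 * x ^ (k + 1) * expMoment N 1 x) * ode
  have hanti : StrictAntiOn G (Set.Ici 0) := by
    refine strictAntiOn_of_deriv_neg (convex_Ici 0)
      (fun x _ => (hd x).continuousAt.continuousWithinAt) fun x hx => ?_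
    rw [interior_Ici] at hx
    rw [(hd x).deriv]
    have h1 := expMoment_one_pos (N := N) hx
    have h2 : 0 < x := hx
    have : 0 < x ^ (k + 1) * expMoment N 1 x ^ 2 := by positivity
    linarith
  have hlt := hanti (Set.mem_Ici.2 le_rfl) (Set.mem_Ici.2 hx.le) hx
  have hG0 : G 0 = 0 := by simp [hG]
  rw [hG0] at hlt
  have h0 := expMoment_zero_pos (N := N) x
  have hGx : G x = x ^ (k + 1) * expMoment N 0 x ^ 2 * (x * tiltVar N x - tiltMean N x) := by
    rw [tiltVar_riccati hx.ne']
    simp only [hG, tiltMean]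
    field_simp
    ring
  rw [hGx] at hlt
  have hp : 0 < x ^ (k + 1) * expMoment N 0 x ^ 2 := by positivity
  have := neg_of_mul_neg_right hlt hp.le
  linarith

lemma hasDerivAt_tiltMean_div {x : ℝ} (hx : 0 < x) :
    HasDerivAt (fun x => tiltMean N x / x) ((x * tiltVar N x - tiltMean N x) / x ^ 2) x :=
  ((hasDerivAt_tiltMean x).fun_div (hasDerivAt_id' x) hx.ne').congr_deriv (by ring)

lemma strictAntiOn_tiltMean_div : StrictAntiOn (fun x => tiltMean N x / x) (Set.Ioi 0) := by
  refine strictAntiOn_of_deriv_neg (convex_Ioi 0)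
    (fun x hx => (hasDerivAt_tiltMean_div hx).continuousAt.continuousWithinAt) fun x hx => ?_
  rw [interior_Ioi] at hx
  rw [(hasDerivAt_tiltMean_div hx).deriv]
  exact div_neg_of_neg_of_pos (sub_neg.2 (mul_tiltVar_lt hx)) (pow_pos hx 2)

/-- Existence of a positive solution of the mean-field equation. -/
lemma exists_meanField {β : ℝ} (hβ : (N : ℝ) < β) : ∃ b, 0 < b ∧ b = β * tiltMean N b := by
  have hN : (0 : ℝ) < N := by have := Fact.out (p := 2 ≤ N); positivity
  have hβ0 : 0 < β := hN.trans hβ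
  have hd := hasDerivAt_tiltMean (N := N) 0
  have hv : tiltVar N 0 = 1 / N := by
    simp [tiltVar, tiltMean_zero, expMoment_zero_zero, expMoment_two_zero]
  rw [hv] at hd
  have hlt : 1 / β < 1 / (N : ℝ) := one_div_lt_one_div_of_lt hN hβ
  -- The slope of f at 0 is 1/N > 1/β, so x < β f(x) for small positive x. At 2β the opposite
  -- inequality follows from f ≤ 1, and a zero lies in between.
  have hs := hd.tendsto_slope_zero_right.eventually (lt_mem_nhds hlt)
  have hpos : ∃ x, 0 < x ∧ x < 2 * β ∧ x < β * tiltMean N x := by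
    have hsmall : ∀ᶠ x : ℝ in nhdsWithin 0 (Set.Ioi 0), x < 2 * β :=
      nhdsWithin_le_nhds (Iio_mem_nhds (by positivity))
    obtain ⟨x, ⟨hx, hx2⟩, hx0⟩ := ((hs.and hsmall).and self_mem_nhdsWithin).exists
    have hx0 : 0 < x := hx0
    refine ⟨x, hx0, hx2, ?_⟩
    simp only [zero_add, tiltMean_zero, sub_zero, smul_eq_mul] at hx
    rw [one_div, inv_mul_eq_div, lt_div_iff₀ hx0, inv_mul_lt_iff₀ hβ0] at hx
    exact hx
  obtain ⟨x, hx0, hx2, hx⟩ := hpos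
  have hc : ContinuousOn (fun x => β * tiltMean N x - x) (Set.Icc x (2 * β)) :=
    ((continuous_tiltMean.const_mul β).sub continuous_id).continuousOn
  have hend : β * tiltMean N (2 * β) - 2 * β ≤ 0 := by
    have := (abs_le.1 (abs_tiltMean_le (N := N) (2 * β))).2
    nlinarith
  obtain ⟨b, hb, hb0⟩ := intermediate_value_Icc' hx2.le hc ⟨hend, (sub_pos.2 hx).le⟩
  refine ⟨b, hx0.trans_le hb.1, ?_⟩
  simp only at hb0
  linarith

/-- Positive solutions are the points where f(x)/x equals 1/β, and this quotient is injective
because it strictly decreases. -/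
lemma meanField_unique {β x y : ℝ} (hx : 0 < x) (hy : 0 < y) (h1 : x = β * tiltMean N x)
    (h2 : y = β * tiltMean N y) : x = y := by
  refine (strictAntiOn_tiltMean_div (N := N)).injOn hx hy ?_
  have hβ : β ≠ 0 := by rintro rfl; linarith
  change tiltMean N x / x = tiltMean N y / y
  rw [div_eq_div_iff hx.ne' hy.ne']
  rw [mul_comm] at h1 h2
  have e1 : tiltMean N x = x / β := by field_simp; exact h1.symm
  have e2 : tiltMean N y = y / β := by field_simp; exact h2.symm
  rw [e1, e2]; ring

/-- The inequality x f' < f is evaluated at b, where β f(b) = b. It makes the denominator 1 - β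
f'(b) positive. -/
lemma mul_tiltVar_lt_one {β b : ℝ} (hb : 0 < b) (hβ : 0 < β) (h : b = β * tiltMean N b) :
    β * tiltVar N b < 1 := by
  have h1 := mul_tiltVar_lt (N := N) hb
  have h2 : b * (β * tiltVar N b) < b * 1 := by nlinarith
  exact lt_of_mul_lt_mul_left h2 hb.le

/-- Quadratic growth of the rate function away from zero. -/
lemma exists_drift_bound {β b : ℝ} (hb : 0 < b) (hβ : 0 < β) (h : b = β * tiltMean N b) :
    ∃ c, 0 < c ∧ ∀ x, b / 4 ≤ x → c * (x - b) ^ 2 ≤ (x / β - tiltMean N x) * (x - b) := by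
  have hbβ : b ≤ β := by
    have := (abs_le.1 (abs_tiltMean_le (N := N) b)).2
    nlinarith
  -- This is the derivative of f(x)/x. By compactness it is at most -c₁ < 0 on [b/4, 2β];
  -- multiplication by x ≥ b/4 produces the constant `b / 4 * c₁`.
  set r' : ℝ → ℝ := fun x => (x * tiltVar N x - tiltMean N x) / x ^ 2 with hr'
  have hc : ContinuousOn r' (Set.Icc (b / 4) (2 * β)) := by
    intro x hx
    have : x ^ 2 ≠ 0 := by have : 0 < x := by linarith [hx.1]
                           positivity
    exact (((continuous_id.mul continuous_tiltVar).sub continuous_tiltMean).continuousAt.div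
      (continuous_pow 2).continuousAt this).continuousWithinAt
  obtain ⟨x₀, hx₀, hmax⟩ := (isCompact_Icc (a := b / 4) (b := 2 * β)).exists_isMaxOn
    ⟨b, by constructor <;> linarith⟩ hc
  have hx₀0 : 0 < x₀ := by linarith [hx₀.1]
  set c₁ := -r' x₀ with hc₁
  have hc₁0 : 0 < c₁ := neg_pos.2
    (div_neg_of_neg_of_pos (sub_neg.2 (mul_tiltVar_lt hx₀0)) (pow_pos hx₀0 2))
  have hanti : AntitoneOn (fun x => tiltMean N x / x + c₁ * x) (Set.Icc (b / 4) (2 * β)) := by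
    have hd : ∀ x ∈ Set.Icc (b / 4) (2 * β),
        HasDerivAt (fun x => tiltMean N x / x + c₁ * x) (r' x + c₁) x := fun x hx =>
      (hasDerivAt_tiltMean_div (by linarith [hx.1])).fun_add
        (((hasDerivAt_id' x).const_mul c₁).congr_deriv (mul_one _))
    refine antitoneOn_of_deriv_nonpos (convex_Icc _ _)
      (fun x hx => (hd x hx).continuousAt.continuousWithinAt)
      (fun x hx => (hd x (interior_subset hx)).differentiableAt.differentiableWithinAt)
      fun x hx => ?_
    rw [(hd x (interior_subset hx)).deriv]
    have := hmax (interior_subset hx)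
    simp only [Set.mem_ofPred_eq] at this
    linarith
  refine ⟨min (1 / (2 * β)) (b / 4 * c₁), by positivity, fun x hx => ?_⟩
  have hx0 : 0 < x := by linarith
  rcases le_total x (2 * β) with hx2 | hx2
  · have hbm : b ∈ Set.Icc (b / 4) (2 * β) := by constructor <;> linarith
    have hrb : tiltMean N b / b = 1 / β := by
      rw [div_eq_div_iff hb.ne' hβ.ne']; linarith
    have key : c₁ * (x - b) ^ 2 ≤ (1 / β - tiltMean N x / x) * (x - b) := by
      rcases le_total x b with hxb | hxb
      · have := hanti ⟨hx, hx2⟩ hbm hxb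
        simp only [hrb] at this
        nlinarith
      · have := hanti hbm ⟨hx, hx2⟩ hxb
        simp only [hrb] at this
        nlinarith
    have e : (x / β - tiltMean N x) * (x - b) =
        x * ((1 / β - tiltMean N x / x) * (x - b)) := by field_simp
    rw [e]
    have hk0 : 0 ≤ c₁ * (x - b) ^ 2 := by positivity
    calc _ ≤ b / 4 * c₁ * (x - b) ^ 2 := by gcongr; exact min_le_right _ _
      _ = b / 4 * (c₁ * (x - b) ^ 2) := by ring
      _ ≤ x * (c₁ * (x - b) ^ 2) := by gcongr
      _ ≤ _ := by gcongr
  · have hf := (abs_le.1 (abs_tiltMean_le (N := N) x)).2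
    -- Beyond 2β the bound f ≤ 1 ≤ x/(2β) alone leaves half of the linear drift.
    have h1 : (x - b) / (2 * β) ≤ x / β - tiltMean N x := by
      have : 1 ≤ x / (2 * β) := (one_le_div (by positivity)).2 hx2
      have e2 : x / β = x / (2 * β) + x / (2 * β) := by field_simp; ring
      have e3 : (x - b) / (2 * β) ≤ x / (2 * β) := by gcongr; linarith
      linarith
    calc _ ≤ 1 / (2 * β) * (x - b) ^ 2 := by gcongr; exact min_le_left _ _
      _ = (x - b) / (2 * β) * (x - b) := by ring
      _ ≤ _ := mul_le_mul_of_nonneg_right h1 (by linarith)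

end

section
variable {N : ℕ} [Fact (2 ≤ N)]

/-! ### Concentration of the auxiliary field -/

variable (N) in
/-- The density of the auxiliary field, as a function of its norm. -/
def fieldWeight (n : ℕ) (β x : ℝ) : ℝ := expMoment N 0 x ^ n * Real.exp (-(n * x ^ 2 / (2 * β)))

lemma fieldWeight_pos (n : ℕ) (β x : ℝ) : 0 < fieldWeight N n β x :=
  mul_pos (pow_pos (expMoment_zero_pos x) n) (Real.exp_pos _)

/-- The logarithmic derivative is -n(x/β - f(x)), so the positive critical points of the field
weight are the solutions of the mean-field equation. -/
lemma hasDerivAt_fieldWeight {n : ℕ} {β : ℝ} (x : ℝ) :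
    HasDerivAt (fieldWeight N n β) (-(n * (x / β - tiltMean N x)) * fieldWeight N n β x) x := by
  have h0 := (expMoment_zero_pos (N := N) x).ne'
  have h1 : HasDerivAt (fun x : ℝ => -(n * x ^ 2 / (2 * β))) (-(n * x / β)) x :=
    ((((hasDerivAt_pow 2 x).const_mul (n : ℝ)).div_const (2 * β)).fun_neg).congr_deriv
      (by
        push_cast
        rw [pow_one, mul_left_comm, mul_div_mul_left _ _ (two_ne_zero (α := ℝ))])
  refine (((hasDerivAt_expMoment (N := N) 0 x).fun_pow n).fun_mul h1.exp).congr_deriv ?_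
  unfold fieldWeight tiltMean
  rcases n with _ | n
  · simp
  · simp only [Nat.add_sub_cancel, zero_add]
    field_simp
    ring

lemma continuous_fieldWeight (n : ℕ) (β : ℝ) : Continuous (fieldWeight N n β) :=
  continuous_iff_continuousAt.2 fun x => (hasDerivAt_fieldWeight x).continuousAt

lemma expMoment_zero_le_exp {x : ℝ} (hx : 0 ≤ x) : expMoment N 0 x ≤ Real.exp x := by
  have : ∫ σ : Sphere N, height σ ^ 0 * Real.exp (x * height σ) ∂sphereUniform N ≤
      ∫ _ : Sphere N, Real.exp x ∂sphereUniform N := by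
    refine integral_mono (integrable_comp_height
      (G := fun s => s ^ 0 * Real.exp (x * s)) (by fun_prop)) (integrable_const _) fun σ => ?_
    simp only [pow_zero, one_mul]
    exact Real.exp_le_exp.2
      (mul_le_of_le_one_right hx ((le_abs_self _).trans (abs_height_le σ)))
  simpa [expMoment] using this

/-- Beyond 2β(n + 2) the quadratic exponent is at least (n + 2)x, while M(x)^n ≤ exp(n x). This
leaves exp(-2x), and one factor exp(-x) absorbs the power. -/
lemma pow_mul_fieldWeight_le {n : ℕ} (hn : 1 ≤ n) {β : ℝ} (hβ : 0 < β) (p : ℕ) {x : ℝ}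
    (hx : 2 * β * (n + 2) ≤ x) : x ^ p * fieldWeight N n β x ≤ p ! * Real.exp (-(1 : ℝ) * x) := by
  have hx0 : 0 ≤ x := le_trans (by positivity) hx
  have hn1 : (1 : ℝ) ≤ n := by exact_mod_cast hn
  have h1 : x ^ p ≤ p ! * Real.exp x := by
    have := Real.pow_div_factorial_le_exp x hx0 p
    rwa [div_le_iff₀' (by positivity)] at this
  have h2 : fieldWeight N n β x ≤ Real.exp (-2 * x) := by
    have h3 : expMoment N 0 x ^ n ≤ Real.exp (n * x) := by
      rw [Real.exp_nat_mul]
      exact pow_le_pow_left₀ (expMoment_zero_pos x).le (expMoment_zero_le_exp hx0) n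
    calc fieldWeight N n β x ≤ Real.exp (n * x) * Real.exp (-(n * x ^ 2 / (2 * β))) := by
          unfold fieldWeight; gcongr
      _ = Real.exp (n * x - n * x ^ 2 / (2 * β)) := by rw [← Real.exp_add]; ring_nf
      _ ≤ _ := by
        refine Real.exp_le_exp.2 ?_
        have h4 : (n + 2) * x ≤ n * x ^ 2 / (2 * β) := by
          rw [le_div_iff₀ (by positivity)]
          have := mul_le_mul_of_nonneg_right hx hx0
          nlinarith
        linarith
  calc x ^ p * fieldWeight N n β x ≤ (p ! * Real.exp x) * Real.exp (-2 * x) :=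
        mul_le_mul h1 h2 (fieldWeight_pos n β x).le (by positivity)
    _ = p ! * Real.exp (-(1 : ℝ) * x) := by rw [mul_assoc, ← Real.exp_add]; ring_nf

lemma integrableOn_pow_mul_fieldWeight {n : ℕ} (hn : 1 ≤ n) {β : ℝ} (hβ : 0 < β) (p : ℕ) :
    IntegrableOn (fun x => x ^ p * fieldWeight N n β x) (Set.Ioi 0) := by
  refine integrable_of_isBigO_exp_neg (b := 1) one_pos
    ((continuous_pow p).mul (continuous_fieldWeight n β)).continuousOn
    (Asymptotics.IsBigO.of_bound (p ! : ℝ) ?_)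
  filter_upwards [Filter.eventually_ge_atTop (2 * β * (n + 2))] with x hx
  have hx0 : 0 ≤ x := le_trans (by positivity) hx
  rw [Real.norm_of_nonneg (mul_nonneg (pow_nonneg hx0 p) (fieldWeight_pos n β x).le),
    Real.norm_of_nonneg (Real.exp_pos _).le]
  exact pow_mul_fieldWeight_le hn hβ p hx

lemma tendsto_pow_mul_fieldWeight {n : ℕ} (hn : 1 ≤ n) {β : ℝ} (hβ : 0 < β) (p : ℕ) :
    Filter.Tendsto (fun x => x ^ p * fieldWeight N n β x) Filter.atTop (nhds 0) := by
  have h : Filter.Tendsto (fun x : ℝ => (p ! : ℝ) * Real.exp (-(1 : ℝ) * x)) Filter.atTop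
      (nhds 0) := by
    have := (Real.tendsto_exp_neg_atTop_nhds_zero).const_mul (p ! : ℝ)
    simpa using this
  refine tendsto_of_tendsto_of_tendsto_of_le_of_le' tendsto_const_nhds h ?_ ?_
  · filter_upwards [Filter.eventually_ge_atTop 0] with x hx
    exact mul_nonneg (pow_nonneg hx p) (fieldWeight_pos n β x).le
  · filter_upwards [Filter.eventually_ge_atTop (2 * β * (n + 2))] with x hx
    exact pow_mul_fieldWeight_le hn hβ p hx

/-- As f(x)/x decreases and equals 1/β at b, the drift x/β - f(x) has the sign of x - b. -/
lemma drift_nonneg {β b x : ℝ} (hb : 0 < b) (hβ : 0 < β) (h : b = β * tiltMean N b)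
    (hx : 0 < x) : 0 ≤ (x / β - tiltMean N x) * (x - b) := by
  have hrb : tiltMean N b / b = 1 / β := by
    rw [div_eq_div_iff hb.ne' hβ.ne']; linarith
  have e : (x / β - tiltMean N x) * (x - b) =
      x * ((1 / β - tiltMean N x / x) * (x - b)) := by field_simp
  rw [e, ← hrb]
  refine mul_nonneg hx.le ?_
  have hanti := (strictAntiOn_tiltMean_div (N := N)).antitoneOn
  rcases le_total x b with hxb | hxb
  · have : tiltMean N b / b ≤ tiltMean N x / x := hanti hx hb hxb
    exact mul_nonneg_of_nonpos_of_nonpos (by linarith) (by linarith)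
  · have : tiltMean N x / x ≤ tiltMean N b / b := hanti hb hx hxb
    exact mul_nonneg (by linarith) (by linarith)

lemma fieldWeight_monotoneOn {n : ℕ} {β b : ℝ} (hb : 0 < b) (hβ : 0 < β)
    (h : b = β * tiltMean N b) : MonotoneOn (fieldWeight N n β) (Set.Icc 0 b) := by
  refine monotoneOn_of_deriv_nonneg (convex_Icc _ _) (continuous_fieldWeight n β).continuousOn
    (fun x _ => (hasDerivAt_fieldWeight x).differentiableAt.differentiableWithinAt) fun x hx => ?_
  rw [interior_Icc] at hx
  rw [(hasDerivAt_fieldWeight x).deriv]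
  have h1 := drift_nonneg hb hβ h hx.1
  have h2 : x / β - tiltMean N x ≤ 0 := nonpos_of_mul_nonneg_left h1 (sub_neg.2 hx.2)
  have h3 : (n : ℝ) * (x / β - tiltMean N x) ≤ 0 :=
    mul_nonpos_of_nonneg_of_nonpos (by positivity) h2
  exact mul_nonneg (by linarith) (fieldWeight_pos n β x).le

/-- Integration by parts for the radial density. -/
lemma integral_drift_mul_le {n : ℕ} (hn : 1 ≤ n) {β b : ℝ} (hb : 0 < b) (hβ : 0 < β) :
    IntegrableOn (fun x => (x / β - tiltMean N x) * (x - b) * (x ^ (N - 1) * fieldWeight N n β x))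
      (Set.Ioi 0) ∧
    n * ∫ x in Set.Ioi (0 : ℝ), (x / β - tiltMean N x) * (x - b) *
      (x ^ (N - 1) * fieldWeight N n β x) ≤
      N * ∫ x in Set.Ioi (0 : ℝ), x ^ (N - 1) * fieldWeight N n β x := by
  obtain ⟨k, hk⟩ : ∃ k, N = k + 2 := ⟨N - 2, by have := Fact.out (p := 2 ≤ N); omega⟩
  have hkN : (N : ℝ) = k + 2 := by rw [hk]; push_cast; ring
  have hN1 : N - 1 = k + 1 := by omega
  rw [hN1, hkN]
  set q := fieldWeight N n β with hq
  have I : ∀ p : ℕ, IntegrableOn (fun x => x ^ p * q x) (Set.Ioi 0) := fun p =>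
    integrableOn_pow_mul_fieldWeight hn hβ p
  have If : ∀ p : ℕ, IntegrableOn (fun x => tiltMean N x * (x ^ p * q x)) (Set.Ioi 0) := fun p =>
    (I p).bdd_mul (c := 1) continuous_tiltMean.aestronglyMeasurable
      (.of_forall fun x => abs_tiltMean_le x)
  have hD : IntegrableOn (fun x => (x / β - tiltMean N x) * (x - b) * (x ^ (k + 1) * q x))
      (Set.Ioi 0) := by
    have := ((((I (k + 3)).const_mul (1 / β)).sub ((I (k + 2)).const_mul (b / β))).sub
      (If (k + 2))).add ((If (k + 1)).const_mul b)
    refine this.congr (.of_forall fun x => ?_)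
    simp only [Pi.add_apply, Pi.sub_apply]
    field_simp
    ring
  refine ⟨hD, ?_⟩
  -- A is the derivative of the polynomial (x - b) x^(N-1) times the weight. Dropping its negative
  -- part, proportional to -b x^(N-2), leaves N x^(N-1) times the weight.
  set A : ℝ → ℝ := fun x => (x ^ (k + 1) + (x - b) * ((k + 1) * x ^ k)) * q x with hA
  have hAi : IntegrableOn A (Set.Ioi 0) := by
    have := ((I (k + 1)).const_mul (k + 2)).sub ((I k).const_mul (b * (k + 1)))
    refine this.congr (.of_forall fun x => ?_)
    simp only [Pi.sub_apply, hA]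
    ring
  have hftc := integral_Ioi_of_hasDerivAt_of_tendsto' (a := 0) (m := 0)
    (f := fun x => (x - b) * x ^ (k + 1) * q x)
    (f' := fun x => A x - n * ((x / β - tiltMean N x) * (x - b) * (x ^ (k + 1) * q x)))
    (fun x _ => ((((hasDerivAt_id' x).sub_const b).fun_mul (hasDerivAt_pow (k + 1) x)).fun_mul
      (hasDerivAt_fieldWeight x)).congr_deriv (by simp only [hA, ← hq]; push_cast; simp; ring))
    (hAi.sub (hD.const_mul _))
    (by
      have := (tendsto_pow_mul_fieldWeight (N := N) hn hβ (k + 2)).sub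
        ((tendsto_pow_mul_fieldWeight (N := N) hn hβ (k + 1)).const_mul b)
      simp only [mul_zero, sub_zero] at this
      refine this.congr fun x => ?_
      rw [← hq]; ring)
  rw [integral_sub hAi (hD.const_mul _), integral_const_mul] at hftc
  have h2 : ∫ x in Set.Ioi (0 : ℝ), A x ≤
      ∫ x in Set.Ioi (0 : ℝ), ((k : ℝ) + 2) * (x ^ (k + 1) * q x) := by
    refine setIntegral_mono_on hAi ((I (k + 1)).const_mul _) measurableSet_Ioi fun x hx => ?_
    have hx : 0 < x := hx
    have h3 : 0 < q x := fieldWeight_pos n β x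
    have h4 : 0 ≤ b * ((k + 1) * x ^ k * q x) := by positivity
    calc A x = ((k : ℝ) + 2) * (x ^ (k + 1) * q x) - b * ((k + 1) * x ^ k * q x) := by
          simp only [hA]; ring
      _ ≤ _ := by linarith
  rw [integral_const_mul] at h2
  simp only [zero_pow (Nat.succ_ne_zero k), mul_zero, zero_mul, sub_zero] at hftc
  linarith

/-- The norm of the auxiliary field concentrates at the scale `n^{-1/2}`. -/
lemma exists_radial_concentration {β b : ℝ} (hb : 0 < b) (hβ : 0 < β)
    (h : b = β * tiltMean N b) : ∃ C, 0 < C ∧ ∀ n : ℕ, 1 ≤ n →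
    ∫ x in Set.Ioi (0 : ℝ), x ^ (N - 1) * ((x - b) ^ 2 * fieldWeight N n β x) ≤
      C / n * ∫ x in Set.Ioi (0 : ℝ), x ^ (N - 1) * fieldWeight N n β x := by
  obtain ⟨c, hc, hdrift⟩ := exists_drift_bound (N := N) hb hβ h
  have hN : (0 : ℝ) < N := by have := Fact.out (p := 2 ≤ N); positivity
  -- The quadratic drift bound fails near 0, where the drift vanishes. The mass there is at most 4
  -- times the mass beyond b/4, whence 5 = 1 + 4.
  refine ⟨5 * (N / c), by positivity, fun n hn => ?_⟩
  have hn0 : (0 : ℝ) < n := by positivity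
  set q := fieldWeight N n β with hq
  have hq0 : ∀ x, 0 < q x := fun x => fieldWeight_pos n β x
  obtain ⟨hD, hle⟩ := integral_drift_mul_le (N := N) hn hb hβ
  rw [← hq] at hD hle
  set Z := ∫ x in Set.Ioi (0 : ℝ), x ^ (N - 1) * q x
  set ψ : ℝ → ℝ := fun x => x ^ (N - 1) * ((x - b) ^ 2 * q x) with hψ
  have hψc : Continuous ψ := by
    have : Continuous q := continuous_fieldWeight n β
    simp only [hψ]; fun_prop
  have hψi : IntegrableOn ψ (Set.Ioi 0) := by
    have I : ∀ p : ℕ, IntegrableOn (fun x => x ^ p * q x) (Set.Ioi 0) := fun p =>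
      integrableOn_pow_mul_fieldWeight hn hβ p
    have := ((I (N - 1 + 2)).sub ((I (N - 1 + 1)).const_mul (2 * b))).add
      ((I (N - 1)).const_mul (b ^ 2))
    refine this.congr (.of_forall fun x => ?_)
    simp only [Pi.add_apply, Pi.sub_apply, hψ]
    ring
  have hsub : Set.Ioi (b / 4) ⊆ Set.Ioi 0 := Set.Ioi_subset_Ioi (by positivity)
  -- the part away from the origin
  have hfar : ∫ x in Set.Ioi (b / 4), ψ x ≤ N / (c * n) * Z := by
    have h1 : ∫ x in Set.Ioi (b / 4), c * ψ x ≤ ∫ x in Set.Ioi (b / 4),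
        (x / β - tiltMean N x) * (x - b) * (x ^ (N - 1) * q x) := by
      refine setIntegral_mono_on ((hψi.mono_set hsub).const_mul c) (hD.mono_set hsub)
        measurableSet_Ioi fun x hx => ?_
      have hx0 : 0 < x := hsub hx
      calc c * ψ x = c * (x - b) ^ 2 * (x ^ (N - 1) * q x) := by simp only [hψ]; ring
        _ ≤ _ := mul_le_mul_of_nonneg_right (hdrift x (le_of_lt hx))
          (mul_nonneg (pow_nonneg hx0.le _) (hq0 x).le)
    have h2 : ∫ x in Set.Ioi (b / 4), (x / β - tiltMean N x) * (x - b) * (x ^ (N - 1) * q x) ≤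
        ∫ x in Set.Ioi (0 : ℝ), (x / β - tiltMean N x) * (x - b) * (x ^ (N - 1) * q x) := by
      refine setIntegral_mono_set hD ?_ hsub.eventuallyLE
      filter_upwards [ae_restrict_mem measurableSet_Ioi] with x hx
      exact mul_nonneg (drift_nonneg hb hβ h hx)
        (mul_nonneg (pow_nonneg (le_of_lt hx) _) (hq0 x).le)
    rw [integral_const_mul] at h1
    rw [div_mul_eq_mul_div, le_div_iff₀ (by positivity)]
    nlinarith
  -- the part near the origin, by translation
  have hnear : ∫ x in Set.Ioc 0 (b / 4), ψ x ≤ 4 * ∫ x in Set.Ioi (b / 4), ψ x := by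
    rw [← intervalIntegral.integral_of_le (by positivity)]
    have h1 : ∫ x in (0 : ℝ)..(b / 4), ψ x ≤ ∫ x in (0 : ℝ)..(b / 4), 4 * ψ (x + b / 4) := by
      refine intervalIntegral.integral_mono_on (by positivity) (hψc.intervalIntegrable _ _)
        ((continuous_const.mul (hψc.comp (continuous_id.add continuous_const))).intervalIntegrable
          _ _) fun x hx => ?_
      have hx0 := hx.1
      have hx1 := hx.2
      have hqm : q x ≤ q (x + b / 4) := fieldWeight_monotoneOn hb hβ h ⟨hx0, by linarith⟩
        ⟨by linarith, by linarith⟩ (by linarith)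
      have hp : x ^ (N - 1) ≤ (x + b / 4) ^ (N - 1) := pow_le_pow_left₀ hx0 (by linarith) _
      -- For 0 ≤ x ≤ b/4 one has |x - b| ≤ b, while the translated point is still at distance at
      -- least b/2 from b.
      have hs : (x - b) ^ 2 ≤ 4 * (x + b / 4 - b) ^ 2 := by nlinarith
      calc ψ x ≤ (x + b / 4) ^ (N - 1) * (4 * (x + b / 4 - b) ^ 2 * q (x + b / 4)) := by
            simp only [hψ]
            have := hq0 x
            gcongr
        _ = _ := by simp only [hψ]; ring
    have h2 : ∫ x in (0 : ℝ)..(b / 4), 4 * ψ (x + b / 4) =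
        4 * ∫ x in Set.Ioc (b / 4) (b / 2), ψ x := by
      rw [intervalIntegral.integral_const_mul, intervalIntegral.integral_comp_add_right ψ,
        intervalIntegral.integral_of_le (by linarith)]
      congr 3; ring_nf
    have h3 : ∫ x in Set.Ioc (b / 4) (b / 2), ψ x ≤ ∫ x in Set.Ioi (b / 4), ψ x := by
      refine setIntegral_mono_set (hψi.mono_set hsub) ?_ Set.Ioc_subset_Ioi_self.eventuallyLE
      filter_upwards [ae_restrict_mem measurableSet_Ioi] with x hx
      have hx0 : 0 < x := hsub hx
      have := hq0 x
      simp only [hψ, Pi.zero_apply]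
      positivity
    linarith
  have hsplit : ∫ x in Set.Ioi (0 : ℝ), ψ x =
      (∫ x in Set.Ioc 0 (b / 4), ψ x) + ∫ x in Set.Ioi (b / 4), ψ x := by
    rw [← setIntegral_union (Set.Ioc_disjoint_Ioi le_rfl) measurableSet_Ioi
      (hψi.mono_set Set.Ioc_subset_Ioi_self) (hψi.mono_set hsub),
      Set.Ioc_union_Ioi_eq_Ioi (by positivity)]
  rw [hsplit]
  calc _ ≤ 5 * ∫ x in Set.Ioi (b / 4), ψ x := by linarith
    _ ≤ 5 * (N / (c * n) * Z) := by gcongr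
    _ = _ := by field_simp

end

/-! ### Exchangeable pairs -/

section
variable {Ω : Type*} [MeasurableSpace Ω]

lemma integrable_of_abs_le {μ : Measure Ω} [IsFiniteMeasure μ] {F : Ω → ℝ} (hF : Measurable F)
    {C : ℝ} (hC : ∀ ω, |F ω| ≤ C) : Integrable F μ :=
  Integrable.of_bound hF.aestronglyMeasurable C (.of_forall hC)

/-- The contribution of the jump of `g'` in Stein's method is controlled by exchangeability. -/
lemma integral_jump_le {P : Measure Ω} [IsProbabilityMeasure P] {n : ℕ}
    {T : Fin n → Ω → Ω} (hT : ∀ k, MeasurePreserving (T k) P P) (hTT : ∀ k ω, T k (T k ω) = ω)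
    {W : Ω → ℝ} (hW : Measurable W) {A : ℝ} (hWA : ∀ ω, |W ω| ≤ A)
    {u : Fin n → Ω → ℝ} (hu : ∀ k, Measurable (u k)) (hu2 : ∀ k ω, |u k ω| ≤ 2)
    (huT : ∀ k ω, u k (T k ω) = -u k ω) (z : ℝ) :
    ∫ ω, ∑ k, |u k ω| * ((W ω - W (T k ω)) * (Set.indicator (Set.Iic z) 1 (W (T k ω)) -
      Set.indicator (Set.Iic z) 1 (W ω))) ∂P ≤
      2 * ∫ ω, |∑ k, |u k ω| * (W ω - W (T k ω))| ∂P := by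
  set I : ℝ → ℝ := Set.indicator (Set.Iic z) 1 with hI
  have hIm : Measurable I := measurable_one.indicator measurableSet_Iic
  have hI1 : ∀ x, |I x| ≤ 1 := fun x => by
    by_cases hx : x ∈ Set.Iic z <;> simp [hI, hx]
  have hTm : ∀ k, Measurable (T k) := fun k => (hT k).measurable
  have hWT : ∀ k, Measurable fun ω => W (T k ω) := fun k => hW.comp (hTm k)
  have hb : ∀ k ω, |(|u k ω| * (W ω - W (T k ω)))| ≤ 2 * (A + A) := fun k ω => by
    rw [abs_mul, abs_abs]
    exact mul_le_mul (hu2 k ω) ((abs_sub _ _).trans (add_le_add (hWA _) (hWA _))) (abs_nonneg _)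
      (by norm_num)
  have hA : 0 ≤ 2 * (A + A) := by
    rcases isEmpty_or_nonempty Ω with h | ⟨⟨ω⟩⟩
    · exact absurd (measure_univ (μ := P))
        (by rw [Set.eq_empty_of_isEmpty (Set.univ : Set Ω)]; simp)
    · linarith [(abs_nonneg _).trans (hWA ω)]
  have hb1 : ∀ (y : ℝ) k ω, |(|u k ω| * (W ω - W (T k ω)) * I y)| ≤ 2 * (A + A) := fun y k ω => by
    rw [abs_mul]
    exact (mul_le_of_le_one_right (abs_nonneg _) (hI1 _)).trans (hb k ω)
  have hm0 : ∀ k, Measurable fun ω => |u k ω| * (W ω - W (T k ω)) := fun k =>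
    (hu k).abs.mul (hW.sub (hWT k))
  have i1 : ∀ k, Integrable (fun ω => |u k ω| * (W ω - W (T k ω)) * I (W ω)) P := fun k =>
    integrable_of_abs_le ((hm0 k).mul (hIm.comp hW)) fun ω => hb1 _ k ω
  have i2 : ∀ k, Integrable (fun ω => |u k ω| * (W ω - W (T k ω)) * I (W (T k ω))) P := fun k =>
    integrable_of_abs_le ((hm0 k).mul (hIm.comp (hWT k))) fun ω => hb1 _ k ω
  -- The transformation `T k` preserves P and |u k|, reverses the increment of W and exchanges the
  -- two indicators. Both halves of the jump thus reduce to the same integral.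
  have hflip : ∀ k, ∫ ω, |u k ω| * (W ω - W (T k ω)) * I (W (T k ω)) ∂P =
      -∫ ω, |u k ω| * (W ω - W (T k ω)) * I (W ω) ∂P := by
    intro k
    have hcomp := (hT k).map_eq
    have h1 : ∫ ω, |u k (T k ω)| * (W (T k ω) - W (T k (T k ω))) * I (W (T k (T k ω))) ∂P =
        ∫ ω, |u k ω| * (W ω - W (T k ω)) * I (W (T k ω)) ∂P := by
      nth_rewrite 2 [← hcomp]
      rw [integral_map (hTm k).aemeasurable]
      exact ((hm0 k).mul (hIm.comp (hWT k))).aestronglyMeasurable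
    rw [← h1, ← integral_neg]
    congr 1; ext ω
    rw [hTT, huT, abs_neg]; ring
  have e : ∀ ω, ∑ k, |u k ω| * ((W ω - W (T k ω)) * (I (W (T k ω)) - I (W ω))) =
      ∑ k, (|u k ω| * (W ω - W (T k ω)) * I (W (T k ω)) -
        |u k ω| * (W ω - W (T k ω)) * I (W ω)) := fun ω =>
    Finset.sum_congr rfl fun k _ => by ring
  simp_rw [e]
  have i3 : ∀ k, Integrable (fun ω => |u k ω| * (W ω - W (T k ω)) * I (W (T k ω)) -
      |u k ω| * (W ω - W (T k ω)) * I (W ω)) P := fun k => (i2 k).sub (i1 k)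
  rw [integral_finsetSum _ fun k _ => i3 k]
  have e2 : ∀ k, ∫ ω, (|u k ω| * (W ω - W (T k ω)) * I (W (T k ω)) -
        |u k ω| * (W ω - W (T k ω)) * I (W ω)) ∂P =
      -2 * ∫ ω, |u k ω| * (W ω - W (T k ω)) * I (W ω) ∂P := fun k => by
    rw [integral_sub (i2 k) (i1 k), hflip]; ring
  simp_rw [e2]
  rw [← Finset.mul_sum, ← integral_finsetSum _ fun k _ => i1 k]
  have hsm : Measurable fun ω => ∑ k, |u k ω| * (W ω - W (T k ω)) :=
    Finset.measurable_fun_sum _ fun k _ => hm0 k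
  have hsi : Integrable (fun ω => |∑ k, |u k ω| * (W ω - W (T k ω))|) P :=
    (integrable_of_abs_le hsm (C := ∑ _ : Fin n, 2 * (A + A)) fun ω =>
      (Finset.abs_sum_le_sum_abs _ _).trans (Finset.sum_le_sum fun k _ => hb k ω)).abs
  -- The indicator of W no longer depends on k, so it factors out of the sum and the cancellation
  -- between the sites survives the absolute value.
  have h3 : |∫ ω, ∑ k, |u k ω| * (W ω - W (T k ω)) * I (W ω) ∂P| ≤
      ∫ ω, |∑ k, |u k ω| * (W ω - W (T k ω))| ∂P := by
    refine abs_integral_le_integral_abs.trans (integral_mono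
      (integrable_finsetSum _ fun k _ => i1 k).abs hsi fun ω => ?_)
    simp only
    rw [← Finset.sum_mul, abs_mul]
    exact mul_le_of_le_one_right (abs_nonneg _) (hI1 _)
  have := neg_le_of_abs_le h3
  linarith

/-- Stein's method for a statistic `W` and a family of exchangeable pairs `(W, W ∘ T k)`. -/
lemma stein_exchange {P : Measure Ω} [IsProbabilityMeasure P] {n : ℕ} (hn : 1 ≤ n)
    {T : Fin n → Ω → Ω} (hT : ∀ k, MeasurePreserving (T k) P P) (hTT : ∀ k ω, T k (T k ω) = ω)
    {W : Ω → ℝ} (hW : Measurable W) {A : ℝ} (hWA : ∀ ω, |W ω| ≤ A)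
    {u : Fin n → Ω → ℝ} (hu : ∀ k, Measurable (u k)) (hu2 : ∀ k ω, |u k ω| ≤ 2)
    (huT : ∀ k ω, u k (T k ω) = -u k ω) {ε : Ω → ℝ} (hε : Integrable ε P) {a c v ε₀ w₀ : ℝ}
    (hc : 0 ≤ c)
    (hΔ : ∀ k ω, |W ω - W (T k ω) - c / √n * u k ω| ≤ ε ω / √n)
    (hΔ' : ∀ k ω, |W ω - W (T k ω)| ≤ a / √n)
    (h1 : ∫ ω, |∑ k, (u k ω ^ 2 - 2 * v)| ∂P ≤ 4 * √n)
    (h2 : ∫ ω, |∑ k, |u k ω| * u k ω| ∂P ≤ 4 * √n)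
    (hε₀ : ∫ ω, ε ω ∂P ≤ ε₀) (hw₀ : ∫ ω, |W ω| ∂P ≤ w₀)
    {K z : ℝ} {g g' : ℝ → ℝ} (hg : SteinPair K z g g') :
    |∫ ω, (c / (2 * √n) * ∑ k, u k ω * (g (W ω) - g (W (T k ω))) - c ^ 2 * v * g' (W ω)) ∂P| ≤
      K * (3 * c * ε₀ + (6 * c ^ 2 + c * a ^ 2 * (1 + w₀)) / √n) := by
  have hK := hg.nonneg
  have hn0 : (0 : ℝ) < n := by exact_mod_cast hn
  set r := √(n : ℝ) with hr
  have hr0 : 0 < r := Real.sqrt_pos.2 hn0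
  have hr2 : r ^ 2 = n := Real.sq_sqrt hn0.le
  have hTm : ∀ k, Measurable (T k) := fun k => (hT k).measurable
  have hWT : ∀ k, Measurable fun ω => W (T k ω) := fun k => hW.comp (hTm k)
  set J : Ω → ℝ := fun ω => ∑ k, |u k ω| * ((W ω - W (T k ω)) *
    (Set.indicator (Set.Iic z) 1 (W (T k ω)) - Set.indicator (Set.Iic z) 1 (W ω))) with hJ
  set U : Ω → ℝ := fun ω => ∑ k, (u k ω ^ 2 - 2 * v) with hU
  have hpt : ∀ ω, |c / (2 * r) * ∑ k, u k ω * (g (W ω) - g (W (T k ω))) - c ^ 2 * v * g' (W ω)| ≤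
      K * c * ε ω + K * c ^ 2 / (2 * n) * |U ω| + K * (c * a ^ 2 / r) * (1 + |W ω|) +
        K * (c / (2 * r)) * J ω := by
    intro ω
    set R : Fin n → ℝ := fun k => g (W ω) - g (W (T k ω)) - g' (W ω) * (W ω - W (T k ω)) with hR
    have hRb : ∀ k, |R k| ≤ K * (1 + |W ω|) * (a / r) ^ 2 + K * ((W ω - W (T k ω)) *
        (Set.indicator (Set.Iic z) 1 (W (T k ω)) - Set.indicator (Set.Iic z) 1 (W ω))) := by
      intro k
      have ht := hg.taylor (W ω) (W (T k ω))
      have e : |R k| = |g (W (T k ω)) - g (W ω) - g' (W ω) * (W (T k ω) - W ω)| := by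
        rw [← abs_neg]; congr 1; simp only [hR]; ring
      rw [e]
      refine ht.trans (add_le_add ?_ (le_of_eq (by ring)))
      refine mul_le_mul_of_nonneg_left ?_ (by positivity)
      rw [← sq_abs, abs_sub_comm]
      exact pow_le_pow_left₀ (abs_nonneg _) (hΔ' k ω) 2
    -- Three errors are separated: fluctuation of u_k² about its mean 2v, nonlinearity of the
    -- increment of W in u_k, and the Taylor remainder of g. The mean part c/√n · 2v, summed over n
    -- sites, is what cancels c²v g'.
    have e1 : c / (2 * r) * ∑ k, u k ω * (g (W ω) - g (W (T k ω))) - c ^ 2 * v * g' (W ω) =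
        c ^ 2 / (2 * n) * g' (W ω) * U ω +
        c / (2 * r) * g' (W ω) * ∑ k, u k ω * (W ω - W (T k ω) - c / r * u k ω) +
        c / (2 * r) * ∑ k, u k ω * R k := by
      have e2 : ∑ k, u k ω * (g (W ω) - g (W (T k ω))) =
          ∑ k, (c / r * g' (W ω) * (u k ω ^ 2 - 2 * v) +
            g' (W ω) * (u k ω * (W ω - W (T k ω) - c / r * u k ω)) + u k ω * R k) +
          n * (c / r * g' (W ω) * (2 * v)) := by
        have e3 : (n : ℝ) * (c / r * g' (W ω) * (2 * v)) =
            ∑ _ : Fin n, c / r * g' (W ω) * (2 * v) := by simp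
        rw [e3, ← Finset.sum_add_distrib]
        refine Finset.sum_congr rfl fun k _ => ?_
        simp only [hR]; ring
      rw [e2, Finset.sum_add_distrib, Finset.sum_add_distrib, ← Finset.mul_sum, ← Finset.mul_sum,
        ← hr2]
      simp only [hU]
      field_simp
      ring
    have b1 : |c ^ 2 / (2 * n) * g' (W ω) * U ω| ≤ K * c ^ 2 / (2 * n) * |U ω| := by
      rw [abs_mul, abs_mul, abs_of_nonneg (by positivity : 0 ≤ c ^ 2 / (2 * (n : ℝ)))]
      calc _ ≤ c ^ 2 / (2 * n) * K * |U ω| := by gcongr; exact hg.bound_deriv _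
        _ = _ := by ring
    have b2 : |c / (2 * r) * g' (W ω) * ∑ k, u k ω * (W ω - W (T k ω) - c / r * u k ω)| ≤
        K * c * ε ω := by
      rw [abs_mul, abs_mul, abs_of_nonneg (by positivity : 0 ≤ c / (2 * r))]
      have : |∑ k, u k ω * (W ω - W (T k ω) - c / r * u k ω)| ≤ n * (2 * (ε ω / r)) := by
        refine (Finset.abs_sum_le_sum_abs _ _).trans ?_
        calc _ ≤ ∑ _ : Fin n, 2 * (ε ω / r) := by
              refine Finset.sum_le_sum fun k _ => ?_
              rw [abs_mul]
              exact mul_le_mul (hu2 k ω) (hΔ k ω) (abs_nonneg _) (by norm_num)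
          _ = _ := by simp
      calc _ ≤ c / (2 * r) * K * (n * (2 * (ε ω / r))) := by gcongr; exact hg.bound_deriv _
        _ = _ := by rw [← hr2]; field_simp
    have b3 : |c / (2 * r) * ∑ k, u k ω * R k| ≤ K * (c * a ^ 2 / r) * (1 + |W ω|) +
        K * (c / (2 * r)) * J ω := by
      rw [abs_mul, abs_of_nonneg (by positivity : 0 ≤ c / (2 * r))]
      have : |∑ k, u k ω * R k| ≤ n * (2 * (K * (1 + |W ω|) * (a / r) ^ 2)) + K * J ω := by
        refine (Finset.abs_sum_le_sum_abs _ _).trans ?_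
        calc _ ≤ ∑ k : Fin n, (2 * (K * (1 + |W ω|) * (a / r) ^ 2) + K * (|u k ω| *
                ((W ω - W (T k ω)) * (Set.indicator (Set.Iic z) 1 (W (T k ω)) -
                  Set.indicator (Set.Iic z) 1 (W ω))))) := by
              refine Finset.sum_le_sum fun k _ => ?_
              rw [abs_mul]
              refine (mul_le_mul_of_nonneg_left (hRb k) (abs_nonneg _)).trans ?_
              rw [mul_add]
              refine add_le_add ?_ (le_of_eq (by ring))
              exact mul_le_mul_of_nonneg_right (hu2 k ω) (by positivity)
          _ = _ := by
              rw [Finset.sum_add_distrib, ← Finset.mul_sum]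
              simp only [hJ, Finset.sum_const, Finset.card_univ, Fintype.card_fin, nsmul_eq_mul,
                Finset.mul_sum]
              ring
      calc _ ≤ c / (2 * r) * (n * (2 * (K * (1 + |W ω|) * (a / r) ^ 2)) + K * J ω) := by gcongr
        _ = _ := by rw [← hr2]; field_simp
    rw [e1]
    refine (abs_add_three _ _ _).trans ?_
    linarith
  have hIm : Measurable (Set.indicator (Set.Iic z) (1 : ℝ → ℝ)) :=
    measurable_one.indicator measurableSet_Iic
  have hI1 : ∀ x, |Set.indicator (Set.Iic z) (1 : ℝ → ℝ) x| ≤ 1 := fun x => by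
    by_cases hx : x ∈ Set.Iic z <;> simp [hx]
  have hWd : ∀ k ω, |W ω - W (T k ω)| ≤ A + A := fun k ω =>
    (abs_sub _ _).trans (add_le_add (hWA _) (hWA _))
  have hWi : Integrable (fun ω => |W ω|) P := (integrable_of_abs_le hW hWA).abs
  have hUi : Integrable (fun ω => |U ω|) P := by
    refine (integrable_of_abs_le (C := ∑ _ : Fin n, (4 + |2 * v|)) ?_ fun ω => ?_).abs
    · exact Finset.measurable_fun_sum _ fun k _ => ((hu k).pow_const 2).sub_const _
    · refine (Finset.abs_sum_le_sum_abs _ _).trans (Finset.sum_le_sum fun k _ => ?_)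
      refine (abs_sub _ _).trans (add_le_add ?_ le_rfl)
      rw [abs_pow]
      nlinarith [hu2 k ω, abs_nonneg (u k ω)]
  have hA0 : ∀ k : Fin n, ∀ ω, 0 ≤ A + A := fun k ω => (abs_nonneg _).trans (hWd k ω)
  have hJi : Integrable J P := by
    refine integrable_finsetSum _ fun k _ => integrable_of_abs_le (C := 2 * ((A + A) * 2)) ?_
      fun ω => ?_
    · exact (hu k).abs.mul ((hW.sub (hWT k)).mul ((hIm.comp (hWT k)).sub (hIm.comp hW)))
    · rw [abs_mul, abs_abs, abs_mul]
      have h3 : |Set.indicator (Set.Iic z) (1 : ℝ → ℝ) (W (T k ω)) -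
          Set.indicator (Set.Iic z) 1 (W ω)| ≤ 2 :=
        (abs_sub _ _).trans (by linarith [hI1 (W (T k ω)), hI1 (W ω)])
      have := hA0 k ω
      exact mul_le_mul (hu2 k ω) (mul_le_mul (hWd k ω) h3 (abs_nonneg _) this)
        (by positivity) (by norm_num)
  have hεn : ∀ ω, 0 ≤ ε ω := fun ω => by
    have := (abs_nonneg _).trans (hΔ ⟨0, hn⟩ ω)
    rwa [le_div_iff₀ hr0, zero_mul] at this
  -- After the increment is replaced by c/√n u_k, the sum of |u_k| u_k has mean absolute value of
  -- order √n by hypothesis, not n; this saves the factor needed for the rate.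
  have hJle : ∫ ω, J ω ∂P ≤ 2 * (4 * c + 2 * r * ε₀) := by
    refine (integral_jump_le hT hTT hW hWA hu hu2 huT z).trans ?_
    refine mul_le_mul_of_nonneg_left ?_ (by norm_num)
    have hVi : Integrable (fun ω => |∑ k, |u k ω| * u k ω|) P := by
      refine (integrable_of_abs_le (C := ∑ _ : Fin n, (4 : ℝ)) ?_ fun ω => ?_).abs
      · exact Finset.measurable_fun_sum _ fun k _ => (hu k).abs.mul (hu k)
      · refine (Finset.abs_sum_le_sum_abs _ _).trans (Finset.sum_le_sum fun k _ => ?_)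
        rw [abs_mul, abs_abs]
        nlinarith [hu2 k ω, abs_nonneg (u k ω)]
    calc _ ≤ ∫ ω, (c / r * |∑ k, |u k ω| * u k ω| + 2 * r * ε ω) ∂P := by
          refine integral_mono_of_nonneg (.of_forall fun ω => abs_nonneg _)
            ((hVi.const_mul _).add (hε.const_mul _)) (.of_forall fun ω => ?_)
          simp only
          have e : ∑ k, |u k ω| * (W ω - W (T k ω)) = c / r * ∑ k, |u k ω| * u k ω +
              ∑ k, |u k ω| * (W ω - W (T k ω) - c / r * u k ω) := by
            rw [Finset.mul_sum, ← Finset.sum_add_distrib]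
            exact Finset.sum_congr rfl fun k _ => by ring
          rw [e]
          refine (abs_add_le _ _).trans (add_le_add ?_ ?_)
          · rw [abs_mul, abs_of_nonneg (by positivity : 0 ≤ c / r)]
          · refine (Finset.abs_sum_le_sum_abs _ _).trans ?_
            calc _ ≤ ∑ _ : Fin n, 2 * (ε ω / r) := by
                  refine Finset.sum_le_sum fun k _ => ?_
                  rw [abs_mul, abs_abs]
                  exact mul_le_mul (hu2 k ω) (hΔ k ω) (abs_nonneg _) (by norm_num)
              _ = n * (2 * (ε ω / r)) := by simp
              _ = 2 * r * ε ω := by rw [← hr2]; field_simp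
      _ = c / r * ∫ ω, |∑ k, |u k ω| * u k ω| ∂P + 2 * r * ∫ ω, ε ω ∂P := by
          rw [integral_add (hVi.const_mul _) (hε.const_mul _), integral_const_mul,
            integral_const_mul]
      _ ≤ c / r * (4 * r) + 2 * r * ε₀ := by gcongr
      _ = _ := by field_simp
  have i1 : Integrable (fun ω => K * c * ε ω + K * c ^ 2 / (2 * n) * |U ω|) P :=
    (hε.const_mul _).add (hUi.const_mul _)
  have i0 : Integrable (fun ω => K * (c * a ^ 2 / r) * (1 + |W ω|)) P :=
    ((integrable_const _).add hWi).const_mul _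
  have i2 : Integrable (fun ω => K * c * ε ω + K * c ^ 2 / (2 * n) * |U ω| +
    K * (c * a ^ 2 / r) * (1 + |W ω|)) P := i1.add i0
  calc _ ≤ ∫ ω, (K * c * ε ω + K * c ^ 2 / (2 * n) * |U ω| + K * (c * a ^ 2 / r) * (1 + |W ω|) +
        K * (c / (2 * r)) * J ω) ∂P :=
        abs_integral_le_integral_abs.trans (integral_mono_of_nonneg
          (.of_forall fun ω => abs_nonneg _) (i2.add (hJi.const_mul _)) (.of_forall hpt))
    _ = K * c * ∫ ω, ε ω ∂P + K * c ^ 2 / (2 * n) * ∫ ω, |U ω| ∂P +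
        K * (c * a ^ 2 / r) * (1 + ∫ ω, |W ω| ∂P) + K * (c / (2 * r)) * ∫ ω, J ω ∂P := by
      rw [integral_add i2 (hJi.const_mul _), integral_add i1 i0,
        integral_add (hε.const_mul _) (hUi.const_mul _), integral_const_mul, integral_const_mul,
        integral_const_mul, integral_const_mul, integral_add (integrable_const _) hWi]
      simp
    _ ≤ K * c * ε₀ + K * c ^ 2 / (2 * n) * (4 * r) + K * (c * a ^ 2 / r) * (1 + w₀) +
        K * (c / (2 * r)) * (2 * (4 * c + 2 * r * ε₀)) := by gcongr
    _ = _ := by rw [← hr2]; field_simp; ring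

end

/-! ### Sums of independent centred variables -/

lemma integral_sq_sum_pi_le {X : Type*} [MeasurableSpace X] (ν : Measure X)
    [IsProbabilityMeasure ν] {n : ℕ} {ψ : X → ℝ} (hψ : Measurable ψ) {C : ℝ}
    (hC : ∀ x, |ψ x| ≤ C) (h0 : ∫ x, ψ x ∂ν = 0) :
    ∫ τ : Fin n → X, (∑ k, ψ (τ k)) ^ 2 ∂Measure.pi (fun _ => ν) = n * ∫ x, ψ x ^ 2 ∂ν := by
  have hmem : ∀ k : Fin n, MemLp (fun τ : Fin n → X => ψ (τ k)) 2 (Measure.pi fun _ => ν) :=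
    fun k => MemLp.of_bound (hψ.comp (measurable_pi_apply k)).aestronglyMeasurable C
      (.of_forall fun τ => hC _)
  have hindep := iIndepFun_pi (μ := fun _ : Fin n => ν) (X := fun _ => ψ)
    fun _ => hψ.aemeasurable
  have hint : ∀ k : Fin n, ∫ τ : Fin n → X, ψ (τ k) ∂Measure.pi (fun _ => ν) = 0 := fun k => by
    rw [integral_comp_eval (μ := fun _ : Fin n => ν) hψ.aestronglyMeasurable, h0]
  have hvar := IndepFun.variance_sum (s := Finset.univ) (fun k _ => hmem k)
    (fun i _ j _ hij => hindep.indepFun hij)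
  have hsum : ∀ τ : Fin n → X, (∑ k, fun τ : Fin n → X => ψ (τ k)) τ = ∑ k, ψ (τ k) :=
    fun τ => Finset.sum_apply _ _ _
  rw [variance_of_integral_eq_zero] at hvar
  · simp_rw [hsum] at hvar
    rw [hvar]
    have : ∀ k : Fin n, Var[fun τ : Fin n → X => ψ (τ k); Measure.pi fun _ => ν] =
        ∫ x, ψ x ^ 2 ∂ν := fun k => by
      rw [variance_of_integral_eq_zero (hmem k).aestronglyMeasurable.aemeasurable (hint k)]
      exact integral_comp_eval (μ := fun _ : Fin n => ν) (f := fun x => ψ x ^ 2)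
        (hψ.pow_const 2).aestronglyMeasurable
    simp [this]
  · rw [funext hsum]
    exact (Finset.measurable_fun_sum _ fun k _ => hψ.comp (measurable_pi_apply k)).aemeasurable
  · simp_rw [hsum]
    rw [integral_finsetSum _ fun k _ => (hmem k).integrable (by norm_num)]
    simp [hint]

/-- Jensen's inequality, in the form that |F| has nonnegative variance. -/
lemma integral_abs_le_sqrt {Ω : Type*} [MeasurableSpace Ω] {P : Measure Ω}
    [IsProbabilityMeasure P] {F : Ω → ℝ} (hF : MemLp F 2 P) {B : ℝ}
    (h : ∫ ω, F ω ^ 2 ∂P ≤ B) : ∫ ω, |F ω| ∂P ≤ √B := by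
  refine Real.le_sqrt_of_sq_le (le_trans ?_ h)
  have h1 := variance_nonneg (fun ω => |F ω|) P
  have hm : MemLp (fun ω => |F ω|) 2 P := hF.abs
  rw [variance_eq_sub hm] at h1
  simp only [Pi.pow_apply, sq_abs] at h1
  linarith

lemma integral_abs_sum_pi_le {X : Type*} [MeasurableSpace X] (ν : Measure X)
    [IsProbabilityMeasure ν] {n : ℕ} {ψ : X → ℝ} (hψ : Measurable ψ) {C : ℝ} (hC0 : 0 ≤ C)
    (hC : ∀ x, |ψ x| ≤ C) (h0 : ∫ x, ψ x ∂ν = 0) :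
    ∫ τ : Fin n → X, |∑ k, ψ (τ k)| ∂Measure.pi (fun _ => ν) ≤ C * √n := by
  have hm : Measurable fun τ : Fin n → X => ∑ k, ψ (τ k) :=
    Finset.measurable_fun_sum _ fun k _ => hψ.comp (measurable_pi_apply k)
  refine (integral_abs_le_sqrt (F := fun τ : Fin n → X => ∑ k, ψ (τ k)) (B := n * C ^ 2)
    ?_ ?_).trans ?_
  · refine MemLp.of_bound hm.aestronglyMeasurable (∑ _ : Fin n, C) (.of_forall fun τ => ?_)
    exact (norm_sum_le _ _).trans (Finset.sum_le_sum fun k _ => hC _)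
  · rw [integral_sq_sum_pi_le ν hψ hC h0]
    refine mul_le_mul_of_nonneg_left ?_ (Nat.cast_nonneg n)
    calc ∫ x, ψ x ^ 2 ∂ν ≤ ∫ _, C ^ 2 ∂ν := by
          refine integral_mono_of_nonneg (.of_forall fun x => sq_nonneg _) (integrable_const _)
            (.of_forall fun x => ?_)
          simp only
          rw [← sq_abs]
          exact pow_le_pow_left₀ (abs_nonneg _) (hC x) 2
      _ = C ^ 2 := by simp
  · rw [Real.sqrt_mul (Nat.cast_nonneg n), Real.sqrt_sq hC0, mul_comm]

section
variable {N : ℕ} [Fact (2 ≤ N)]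

/-! ### The tilted law of one spin -/

/-- The law of one spin in the external field `y`. -/
def tiltedSphere (y : EuclideanSpace ℝ (Fin N)) : Measure (Sphere N) :=
  (sphereUniform N).tilted fun σ => inner ℝ y σ.1

instance (y : EuclideanSpace ℝ (Fin N)) : IsProbabilityMeasure (tiltedSphere y) :=
  isProbabilityMeasure_tilted (integrable_of_continuous_sphere (by fun_prop) _)

lemma integral_exp_inner {e : EuclideanSpace ℝ (Fin N)} (he : ‖e‖ = 1) (x : ℝ) :
    ∫ σ : Sphere N, Real.exp (inner ℝ (x • e) σ.1) ∂sphereUniform N = expMoment N 0 x := by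
  have := integral_comp_inner he fun s => Real.exp (x * s)
  simp only [inner_smul_left, RCLike.conj_to_real, this, expMoment, pow_zero, one_mul]

lemma integral_tiltedSphere_inner {e : EuclideanSpace ℝ (Fin N)} (he : ‖e‖ = 1) (x : ℝ) (j : ℕ) :
    ∫ σ : Sphere N, inner ℝ e σ.1 ^ j ∂tiltedSphere (x • e) =
      expMoment N j x / expMoment N 0 x := by
  unfold tiltedSphere
  rw [integral_tilted, integral_exp_inner he]
  have := integral_comp_inner he fun s => Real.exp (x * s) / expMoment N 0 x * s ^ j
  simp only [inner_smul_left, RCLike.conj_to_real, smul_eq_mul, this]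
  unfold expMoment
  rw [← integral_div]
  congr 1; ext σ; ring

/-- The reflection that reverses w fixes e, hence preserves the tilted law, and changes the sign of
the integrand. -/
lemma integral_tiltedSphere_orthogonal {N : ℕ} {e w : EuclideanSpace ℝ (Fin N)}
    (hw : inner ℝ w e = 0) (x : ℝ) :
    ∫ σ : Sphere N, inner ℝ w σ.1 ∂tiltedSphere (x • e) = 0 := by
  unfold tiltedSphere
  rw [integral_tilted]
  simp only [div_eq_inv_mul, mul_smul, integral_smul]
  have hR1 := Submodule.reflection_orthogonalComplement_singleton_eq_neg (𝕜 := ℝ) w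
  have hR2 : (ℝ ∙ w)ᗮ.reflection e = e :=
    Submodule.reflection_mem_subspace_eq_self
      ((Submodule.mem_orthogonal_singleton_iff_inner_right).2 hw)
  set R := (ℝ ∙ w)ᗮ.reflection
  have h1 := integral_sphereMap R fun y => Real.exp (inner ℝ (x • e) y) • inner ℝ w y
  have h2 : ∀ y, inner ℝ (x • e) (R y) = inner ℝ (x • e) y := fun y => by
    nth_rewrite 1 [← hR2]
    rw [← map_smul, R.inner_map_map]
  have h3 : ∀ y, inner ℝ w (R y) = -inner ℝ w y := fun y => by
    have : w = -R w := by rw [hR1, neg_neg]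
    nth_rewrite 1 [this]
    rw [inner_neg_left, R.inner_map_map]
  simp only [h2, h3, smul_neg, integral_neg] at h1
  have : ∫ σ : Sphere N, Real.exp (inner ℝ (x • e) σ.1) • inner ℝ w σ.1 ∂sphereUniform N = 0 := by
    linarith
  rw [this, smul_zero]

lemma integrable_inner_sphere {N : ℕ} (u : EuclideanSpace ℝ (Fin N)) (ν : Measure (Sphere N))
    [IsFiniteMeasure ν] : Integrable (fun σ : Sphere N => inner ℝ u σ.1) ν :=
  integrable_of_continuous_sphere (by fun_prop) _

lemma integral_tiltedSphere_linear {e : EuclideanSpace ℝ (Fin N)} (he : ‖e‖ = 1) (x : ℝ)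
    (u : EuclideanSpace ℝ (Fin N)) :
    ∫ σ : Sphere N, inner ℝ u σ.1 ∂tiltedSphere (x • e) = inner ℝ u (tiltMean N x • e) := by
  have h0 := integral_tiltedSphere_orthogonal (e := e) (w := u - inner ℝ u e • e)
    (by simp [inner_sub_left, inner_smul_left, he]) x
  have h1 := integral_tiltedSphere_inner he x 1
  simp only [pow_one] at h1
  simp only [inner_sub_left, inner_smul_left, RCLike.conj_to_real] at h0
  rw [integral_sub (integrable_inner_sphere u _) ((integrable_inner_sphere e _).const_mul _),
    integral_const_mul, h1] at h0
  rw [inner_smul_right]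
  unfold tiltMean
  linarith

/-- The mean spin `S_n / n`. -/
def meanSpin {n : ℕ} (σ : Config N n) : EuclideanSpace ℝ (Fin N) := (n : ℝ)⁻¹ • totalSpin σ

lemma continuous_totalSpin {N n : ℕ} : Continuous (totalSpin : Config N n → _) := by
  unfold totalSpin; fun_prop

lemma continuous_meanSpin {N n : ℕ} : Continuous (meanSpin : Config N n → _) :=
  continuous_totalSpin.const_smul (n : ℝ)⁻¹

lemma norm_totalSpin_le {N n : ℕ} (σ : Config N n) : ‖totalSpin σ‖ ≤ n := by
  unfold totalSpin
  refine (norm_sum_le _ _).trans ?_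
  simp

lemma norm_meanSpin_le {N n : ℕ} (σ : Config N n) : ‖meanSpin σ‖ ≤ 1 := by
  unfold meanSpin
  rw [norm_smul, norm_inv, Real.norm_natCast]
  rcases Nat.eq_zero_or_pos n with rfl | hn
  · simp
  · rw [inv_mul_le_iff₀ (by positivity), mul_one]; exact norm_totalSpin_le σ

lemma rescaledSpin_eq {N n : ℕ} (β b : ℝ) (σ : Config N n) :
    rescaledSpin β b σ = √n * ((β / b) ^ 2 * ‖meanSpin σ‖ ^ 2 - 1) := by
  unfold rescaledSpin meanSpin
  rw [norm_smul, norm_inv, Real.norm_natCast, mul_pow, inv_pow, div_pow]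
  congr 2
  rw [div_mul_eq_mul_div, div_mul_eq_mul_div, mul_comm ((n : ℝ) ^ 2), ← div_div]
  ring

lemma continuous_rescaledSpin {N n : ℕ} (β b : ℝ) :
    Continuous (rescaledSpin β b : Config N n → ℝ) := by
  have := continuous_totalSpin (N := N) (n := n)
  unfold rescaledSpin
  fun_prop

lemma norm_tiltMean_smul_le {e : EuclideanSpace ℝ (Fin N)} (he : ‖e‖ = 1) (x : ℝ) :
    ‖tiltMean N x • e‖ ≤ 1 := by
  rw [norm_smul, he, mul_one]; exact abs_tiltMean_le x

/-- Second moment of the fluctuation of the mean spin in a fixed field. -/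
lemma integral_sq_meanSpin_sub_le {n : ℕ} (hn : 1 ≤ n) {e : EuclideanSpace ℝ (Fin N)}
    (he : ‖e‖ = 1) (x : ℝ) :
    ∫ σ : Config N n, ‖meanSpin σ - tiltMean N x • e‖ ^ 2
      ∂Measure.pi (fun _ => tiltedSphere (x • e)) ≤ 4 / n := by
  set m := tiltMean N x • e with hm
  set ν := tiltedSphere (x • e) with hν
  have hn0 : (0 : ℝ) < n := by exact_mod_cast hn
  have hm1 : ‖m‖ ≤ 1 := norm_tiltMean_smul_le he x
  have hcoord : ∀ i (σ : Sphere N), |σ.1 i - m i| ≤ 2 := fun i σ => by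
    have h1 := PiLp.norm_apply_le (σ.1 - m) i
    have h2 : ‖σ.1 - m‖ ≤ 2 := (norm_sub_le _ _).trans (by rw [norm_coe_sphere]; linarith)
    exact h1.trans h2
  have hmean : ∀ i, ∫ σ : Sphere N, (σ.1 i - m i) ∂ν = 0 := fun i => by
    have := integral_tiltedSphere_linear he x (EuclideanSpace.single i 1)
    simp only [EuclideanSpace.inner_single_left, map_one, one_mul, ← hm, ← hν] at this
    rw [integral_sub (integrable_of_continuous_sphere (by fun_prop) _) (integrable_const _), this]
    simp
  have hmeas : ∀ i, Continuous fun σ : Sphere N => σ.1 i - m i := fun i => by fun_prop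
  have e1 : ∀ σ : Config N n, ‖meanSpin σ - m‖ ^ 2 =
      ((n : ℝ) ^ 2)⁻¹ * ∑ i, (∑ k, ((σ k).1 i - m i)) ^ 2 := fun σ => by
    rw [EuclideanSpace.real_norm_sq_eq, Finset.mul_sum]
    refine Finset.sum_congr rfl fun i _ => ?_
    have : (meanSpin σ - m) i = (n : ℝ)⁻¹ * ∑ k, ((σ k).1 i - m i) := by
      simp only [meanSpin, totalSpin, PiLp.sub_apply, PiLp.smul_apply, smul_eq_mul,
        WithLp.ofLp_sum, Finset.sum_apply, Finset.sum_sub_distrib, Finset.sum_const,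
        Finset.card_univ, Fintype.card_fin, nsmul_eq_mul]
      field_simp
    rw [this, mul_pow, inv_pow]
  simp_rw [e1]
  rw [integral_const_mul, integral_finsetSum]
  · have e2 : ∀ i : Fin N, ∫ σ : Config N n, (∑ k, ((σ k).1 i - m i)) ^ 2 ∂Measure.pi (fun _ => ν) =
        n * ∫ σ : Sphere N, (σ.1 i - m i) ^ 2 ∂ν := fun i =>
      integral_sq_sum_pi_le ν (ψ := fun σ : Sphere N => σ.1 i - m i) (hmeas i).measurable
        (hcoord i) (hmean i)
    simp_rw [e2]
    have i2 : ∀ i ∈ Finset.univ, Integrable (fun σ : Sphere N => (σ.1 i - m i) ^ 2) ν :=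
      fun i _ => integrable_of_continuous_sphere ((hmeas i).pow 2) _
    -- The coordinates are summed before estimating: the sum is |σ - m|² ≤ 4, so the constant does
    -- not depend on N.
    rw [← Finset.mul_sum, ← integral_finsetSum _ i2]
    have h4 : ∫ σ : Sphere N, ∑ i, (σ.1 i - m i) ^ 2 ∂ν ≤ ∫ _ : Sphere N, (4 : ℝ) ∂ν := by
      refine integral_mono (integrable_of_continuous_sphere (by fun_prop) _) (integrable_const _)
        fun σ => ?_
      have h2 : ‖σ.1 - m‖ ≤ 2 := (norm_sub_le _ _).trans (by rw [norm_coe_sphere]; linarith)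
      have h3 : ‖σ.1 - m‖ ^ 2 = ∑ i, (σ.1 i - m i) ^ 2 := by
        rw [EuclideanSpace.real_norm_sq_eq]; rfl
      simp only
      rw [← h3]
      nlinarith [norm_nonneg (σ.1 - m)]
    simp only [integral_const, probReal_univ, one_smul] at h4
    calc _ ≤ ((n : ℝ) ^ 2)⁻¹ * (n * 4) := by gcongr
      _ = 4 / n := by field_simp
  · intro i _
    refine integrable_of_abs_le (C := (∑ _ : Fin n, (2 : ℝ)) ^ 2) ?_ fun σ => ?_
    · exact (Continuous.pow (continuous_finsetSum _ fun k _ => by fun_prop) 2).measurable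
    · rw [abs_pow]
      exact pow_le_pow_left₀ (abs_nonneg _) ((Finset.abs_sum_le_sum_abs _ _).trans
        (Finset.sum_le_sum fun k _ => hcoord i _)) 2

lemma integrable_norm_meanSpin_sub {N n : ℕ} (m : EuclideanSpace ℝ (Fin N)) (p : ℕ)
    (P : Measure (Config N n)) [IsFiniteMeasure P] :
    Integrable (fun σ : Config N n => ‖meanSpin σ - m‖ ^ p) P := by
  have := continuous_meanSpin (N := N) (n := n)
  refine integrable_of_abs_le (C := (1 + ‖m‖) ^ p)
    (Continuous.measurable (by fun_prop)) fun σ => ?_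
  rw [abs_of_nonneg (by positivity)]
  gcongr
  exact (norm_sub_le _ _).trans (add_le_add (norm_meanSpin_le σ) le_rfl)

lemma integral_norm_meanSpin_sub_le {n : ℕ} (hn : 1 ≤ n) {e : EuclideanSpace ℝ (Fin N)}
    (he : ‖e‖ = 1) (x : ℝ) :
    ∫ σ : Config N n, ‖meanSpin σ - tiltMean N x • e‖
      ∂Measure.pi (fun _ => tiltedSphere (x • e)) ≤ 2 / √n := by
  have hc := continuous_meanSpin (N := N) (n := n)
  have h := integral_abs_le_sqrt (P := Measure.pi fun _ : Fin n => tiltedSphere (x • e))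
    (F := fun σ : Config N n => ‖meanSpin σ - tiltMean N x • e‖)
    (MemLp.of_bound (Continuous.aestronglyMeasurable (by fun_prop)) 2 (.of_forall fun σ => by
      rw [norm_norm]
      refine (norm_sub_le _ _).trans ?_
      linarith [norm_meanSpin_le σ, norm_tiltMean_smul_le he x]))
    (integral_sq_meanSpin_sub_le hn he x)
  simp only [abs_norm] at h
  refine h.trans (le_of_eq ?_)
  rw [Real.sqrt_div (by norm_num), show (4 : ℝ) = 2 ^ 2 by norm_num, Real.sqrt_sq (by norm_num)]

/-- Linearization of `W_n` around the mean-field solution. -/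
lemma rescaledSpin_linearization {β b : ℝ} (hb : 0 < b) (hβ : 0 < β) (h : b = β * tiltMean N b) :
    ∃ C, 0 < C ∧ ∀ (n : ℕ) (e : EuclideanSpace ℝ (Fin N)), ‖e‖ = 1 → ∀ (x : ℝ) (σ : Config N n),
      |rescaledSpin β b σ - (2 * β / b * √n * inner ℝ e (meanSpin σ - tiltMean N x • e) +
        β * tiltVar N b / b ^ 2 * √n * (x ^ 2 - b ^ 2))| ≤
      C * √n * (‖meanSpin σ - tiltMean N x • e‖ ^ 2 + (x - b) ^ 2) := by
  set ρ := tiltMean N b with hρ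
  have hρ0 : 0 < ρ := tiltMean_pos hb
  refine ⟨8 / ρ + 2 / ρ ^ 2 + 1 / (ρ * b), by positivity, fun n e he x σ => ?_⟩
  rw [rescaledSpin_eq]
  set s := meanSpin σ
  set f := tiltMean N x with hf
  set t := inner ℝ e (s - f • e) with ht
  set D := ‖s - f • e‖ with hD
  have hs : ‖s‖ ^ 2 = f ^ 2 + 2 * f * t + D ^ 2 := by
    have e1 : s = (s - f • e) + f • e := by abel
    have e2 : ‖s‖ ^ 2 = ‖(s - f • e) + f • e‖ ^ 2 := by rw [← e1]
    rw [e2, norm_add_sq_real, norm_smul, he, inner_smul_right, real_inner_comm, ← ht, ← hD,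
      mul_one, Real.norm_eq_abs, sq_abs]
    ring
  have ht1 : |t| ≤ D := by
    have := abs_real_inner_le_norm e (s - f • e)
    rwa [he, one_mul] at this
  have hT := abs_tiltMean_taylor_le (N := N) b x
  have hL := abs_tiltMean_sub_le (N := N) b x
  rw [← hρ, ← hf] at hT hL
  set T := f - ρ - tiltVar N b * (x - b) with hTdef
  have hβb : β / b = 1 / ρ := by rw [h]; field_simp
  have hv0 := (tiltVar_pos (N := N) b).le
  have hv1 := tiltVar_le (N := N) b
  set v := tiltVar N b
  have e3 : 2 * β / b = 2 / ρ := by rw [mul_div_assoc, hβb]; ring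
  have e4 : β * v / b ^ 2 = v / (ρ * b) := by
    rw [pow_two, mul_comm β, mul_div_assoc, ← div_div, hβb]; field_simp
  rw [e3, e4, hβb, hs]
  -- An exact expansion, with ρ = b/β and T the Taylor remainder of f at b. The linear term 2v(x -
  -- b)/ρ is traded for v(x² - b²)/(ρ b) at the cost of a square, because it is |y|² that has an
  -- explicit conditional mean given the spins.
  have key : √(n : ℝ) * ((1 / ρ) ^ 2 * (f ^ 2 + 2 * f * t + D ^ 2) - 1) -
      (2 / ρ * √n * t + v / (ρ * b) * √n * (x ^ 2 - b ^ 2)) =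
      √n * (2 / ρ * T + 1 / ρ ^ 2 * ((f - ρ) ^ 2 + 2 * ((f - ρ) * t) + D ^ 2) -
        1 / (ρ * b) * (v * (x - b) ^ 2)) := by
    have hf' : f = T + ρ + v * (x - b) := by rw [hTdef]; ring
    clear_value T
    rw [hf']
    field_simp
    ring
  rw [key, abs_mul, abs_of_nonneg (Real.sqrt_nonneg _), mul_comm _ (√(n : ℝ)), mul_assoc]
  refine mul_le_mul_of_nonneg_left ?_ (Real.sqrt_nonneg _)
  have hd2 : (f - ρ) ^ 2 ≤ (x - b) ^ 2 := by
    rw [← sq_abs (f - ρ), ← sq_abs (x - b)]; exact pow_le_pow_left₀ (abs_nonneg _) hL 2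
  have hcross : |2 * ((f - ρ) * t)| ≤ (x - b) ^ 2 + D ^ 2 := by
    have h1 : |(f - ρ) * t| ≤ |f - ρ| * D := by rw [abs_mul]; gcongr
    rw [abs_mul, abs_two]
    nlinarith [sq_nonneg (|f - ρ| - D), sq_abs (f - ρ)]
  have hD2 : 0 ≤ D ^ 2 := sq_nonneg _
  have hx2 : 0 ≤ (x - b) ^ 2 := sq_nonneg _
  have b1 : |2 / ρ * T| ≤ 8 / ρ * (x - b) ^ 2 := by
    rw [abs_mul, abs_of_pos (by positivity : 0 < 2 / ρ)]
    calc _ ≤ 2 / ρ * (4 * (x - b) ^ 2) := by gcongr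
      _ = _ := by ring
  have b2 : |1 / ρ ^ 2 * ((f - ρ) ^ 2 + 2 * ((f - ρ) * t) + D ^ 2)| ≤
      1 / ρ ^ 2 * (2 * (x - b) ^ 2 + 2 * D ^ 2) := by
    rw [abs_mul, abs_of_pos (by positivity : 0 < 1 / ρ ^ 2)]
    refine mul_le_mul_of_nonneg_left ?_ (by positivity)
    rw [abs_le] at hcross ⊢
    constructor <;> linarith [sq_nonneg (f - ρ), hcross.1, hcross.2]
  have b3 : |1 / (ρ * b) * (v * (x - b) ^ 2)| ≤ 1 / (ρ * b) * (x - b) ^ 2 := by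
    rw [abs_mul, abs_of_pos (by positivity : 0 < 1 / (ρ * b)), abs_of_nonneg (by positivity)]
    refine mul_le_mul_of_nonneg_left ?_ (by positivity)
    exact mul_le_of_le_one_left hx2 hv1
  calc _ ≤ 8 / ρ * (x - b) ^ 2 + 1 / ρ ^ 2 * (2 * (x - b) ^ 2 + 2 * D ^ 2) +
        1 / (ρ * b) * (x - b) ^ 2 :=
        (abs_sub _ _).trans (add_le_add ((abs_add_le _ _).trans (add_le_add b1 b2)) b3)
    _ ≤ _ := by
      have p1 : 0 ≤ 8 / ρ * D ^ 2 := by positivity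
      have p2 : 0 ≤ 1 / (ρ * b) * D ^ 2 := by positivity
      have e5 : (8 / ρ + 2 / ρ ^ 2 + 1 / (ρ * b)) * (D ^ 2 + (x - b) ^ 2) =
        8 / ρ * (x - b) ^ 2 + 1 / ρ ^ 2 * (2 * (x - b) ^ 2 + 2 * D ^ 2) +
        1 / (ρ * b) * (x - b) ^ 2 + 8 / ρ * D ^ 2 + 1 / (ρ * b) * D ^ 2 := by ring
      rw [e5]; linarith

end

/-! ### Resampling one coordinate of a product measure -/

section
variable {X : Type*} {n : ℕ}

/-- The first components of a family of pairs. -/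
def firstCoords (τ : Fin n → X × X) : Fin n → X := fun i => (τ i).1

/-- Exchange the two components of the pair at site `k`. -/
def swapAt (k : Fin n) (τ : Fin n → X × X) : Fin n → X × X :=
  fun i => (if i = k then Prod.swap else id) (τ i)

lemma swapAt_swapAt (k : Fin n) (τ : Fin n → X × X) : swapAt k (swapAt k τ) = τ := by
  ext i <;> by_cases h : i = k <;> simp [swapAt, h]

lemma swapAt_self (k : Fin n) (τ : Fin n → X × X) : swapAt k τ k = (τ k).swap := by
  simp [swapAt]

variable [MeasurableSpace X] (ν : Measure X) [IsProbabilityMeasure ν]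

lemma measurePreserving_firstCoords :
    MeasurePreserving (firstCoords (X := X) (n := n)) (Measure.pi fun _ => ν.prod ν)
      (Measure.pi fun _ => ν) :=
  measurePreserving_pi (f := fun _ => Prod.fst) _ _ fun _ => measurePreserving_fst

lemma measurePreserving_swapAt (k : Fin n) :
    MeasurePreserving (swapAt (X := X) k) (Measure.pi fun _ => ν.prod ν)
      (Measure.pi fun _ => ν.prod ν) := by
  refine measurePreserving_pi (f := fun i => if i = k then Prod.swap else id) _ _ fun i => ?_
  by_cases h : i = k
  · simp only [h, if_true]; exact Measure.measurePreserving_swap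
  · simp only [h, if_false]; exact MeasurePreserving.id _

lemma integral_comp_firstCoords {F : (Fin n → X) → ℝ} (hF : Measurable F) :
    ∫ τ, F (firstCoords τ) ∂Measure.pi (fun _ => ν.prod ν) = ∫ σ, F σ ∂Measure.pi fun _ => ν := by
  have h := measurePreserving_firstCoords (n := n) ν
  rw [← h.map_eq, integral_map h.measurable.aemeasurable]
  exact hF.aestronglyMeasurable

/-- The second components are independent of all first components, so the integral factors. -/
lemma integral_second_mul_first {ψ : X → ℝ} (hψ : Measurable ψ) (h0 : ∫ x, ψ x ∂ν = 0)
    (G : (Fin n → X) → ℝ)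
    (k : Fin n) :
    ∫ τ, ψ (τ k).2 * G (firstCoords τ) ∂Measure.pi (fun _ => ν.prod ν) = 0 := by
  have h := measurePreserving_arrowProdEquivProdArrow X X (Fin n) (fun _ => ν) (fun _ => ν)
  have h1 := h.integral_comp' fun p : (Fin n → X) × (Fin n → X) => G p.1 * ψ (p.2 k)
  rw [integral_prod_mul (fun σ => G σ) fun σ : Fin n → X => ψ (σ k)] at h1
  have h2 : ∫ σ : Fin n → X, ψ (σ k) ∂Measure.pi (fun _ => ν) = 0 := by
    rw [← h0]
    exact integral_comp_eval (μ := fun _ => ν) hψ.aestronglyMeasurable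
  rw [h2, mul_zero] at h1
  rw [← h1]
  congr 1; ext τ
  exact mul_comm _ _

/-- Resampling the coordinate `k` turns a centered function of it into an antisymmetric one. -/
lemma integral_mul_eq_exchange {ψ : X → ℝ} (hψ : Measurable ψ) {C : ℝ} (hC : ∀ x, |ψ x| ≤ C)
    (h0 : ∫ x, ψ x ∂ν = 0) {G : (Fin n → X) → ℝ} (hG : Measurable G) {A : ℝ}
    (hA : ∀ σ, |G σ| ≤ A) (k : Fin n) :
    ∫ σ, ψ (σ k) * G σ ∂Measure.pi (fun _ => ν) =
      1 / 2 * ∫ τ, (ψ (τ k).1 - ψ (τ k).2) * (G (firstCoords τ) - G (firstCoords (swapAt k τ)))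
        ∂Measure.pi (fun _ => ν.prod ν) := by
  set P : Measure (Fin n → X × X) := Measure.pi fun _ => ν.prod ν with hP
  have hF := (measurePreserving_firstCoords (n := n) ν).measurable
  have hT : MeasurePreserving (swapAt k) P P := measurePreserving_swapAt (n := n) ν k
  have m1 : Measurable fun τ : Fin n → X × X => ψ (τ k).1 :=
    hψ.comp (measurable_fst.comp (measurable_pi_apply k))
  have m2 : Measurable fun τ : Fin n → X × X => ψ (τ k).2 :=
    hψ.comp (measurable_snd.comp (measurable_pi_apply k))
  have bnd : ∀ x σ, |ψ x * G σ| ≤ C * A := fun x σ => by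
    rw [abs_mul]
    exact mul_le_mul (hC x) (hA σ) (abs_nonneg _) ((abs_nonneg _).trans (hC x))
  have mG : Measurable fun τ : Fin n → X × X => G (firstCoords τ) := hG.comp hF
  have i1 : Integrable (fun τ => ψ (τ k).1 * G (firstCoords τ)) P :=
    integrable_of_abs_le (m1.mul mG) fun τ => bnd _ _
  have i2 : Integrable (fun τ => ψ (τ k).2 * G (firstCoords τ)) P :=
    integrable_of_abs_le (m2.mul mG) fun τ => bnd _ _
  have i3 : Integrable (fun τ => (ψ (τ k).1 - ψ (τ k).2) * G (firstCoords τ)) P := by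
    simp only [sub_mul]; exact i1.sub i2
  -- The fresh copy at site k is centred and independent of G, so subtracting it changes nothing;
  -- afterwards the swap only reverses the sign of the difference.
  have e1 : ∫ τ, (ψ (τ k).1 - ψ (τ k).2) * G (firstCoords τ) ∂P =
      ∫ σ, ψ (σ k) * G σ ∂Measure.pi (fun _ => ν) := by
    simp only [sub_mul]
    rw [integral_sub i1 i2, integral_second_mul_first ν hψ h0, sub_zero]
    exact integral_comp_firstCoords ν (F := fun σ => ψ (σ k) * G σ)
      ((hψ.comp (measurable_pi_apply k)).mul hG)
  have hcomp : ∀ τ : Fin n → X × X, -((ψ (swapAt k τ k).1 - ψ (swapAt k τ k).2) *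
      G (firstCoords (swapAt k τ))) = (ψ (τ k).1 - ψ (τ k).2) * G (firstCoords (swapAt k τ)) :=
    fun τ => by rw [swapAt_self, Prod.fst_swap, Prod.snd_swap]; ring
  have i4 : Integrable (fun τ => (ψ (τ k).1 - ψ (τ k).2) * G (firstCoords (swapAt k τ))) P := by
    simp only [← hcomp]
    exact (hT.integrable_comp_of_integrable i3).neg
  have e2 : ∫ τ, (ψ (τ k).1 - ψ (τ k).2) * G (firstCoords (swapAt k τ)) ∂P =
      -∫ σ, ψ (σ k) * G σ ∂Measure.pi (fun _ => ν) := by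
    simp only [← hcomp]
    rw [integral_neg, ← e1]
    congr 1
    conv_rhs => rw [← hT.map_eq]
    rw [integral_map hT.measurable.aemeasurable]
    exact ((m1.sub m2).mul mG).aestronglyMeasurable
  simp only [mul_sub]
  rw [integral_sub i3 i4, e1, e2]
  ring

end

/-! ### The change of W_n when one spin is resampled -/

section
variable {N : ℕ} [Fact (2 ≤ N)]

/-- The effect on `W_n` of moving the mean spin by `d / n`. -/
lemma rescaledSpin_sub {β b : ℝ} (hb : 0 < b) (hβ : 0 < β) (h : b = β * tiltMean N b) {n : ℕ}
    (hn : 1 ≤ n) {e : EuclideanSpace ℝ (Fin N)} (he : ‖e‖ = 1) (x : ℝ) {σ σ' : Config N n}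
    {d : EuclideanSpace ℝ (Fin N)} (hd : ‖d‖ ≤ 2)
    (hσ : meanSpin σ' = meanSpin σ - (n : ℝ)⁻¹ • d) :
    |rescaledSpin β b σ - rescaledSpin β b σ' - 2 * (β / b) / √n * inner ℝ e d| ≤
        4 * (β / b) ^ 2 * (‖meanSpin σ - tiltMean N x • e‖ + |x - b| + 1 / √n) / √n ∧
      |rescaledSpin β b σ - rescaledSpin β b σ'| ≤ 8 * (β / b) ^ 2 / √n := by
  have hn0 : (0 : ℝ) < n := by exact_mod_cast hn
  have hn1 : (1 : ℝ) ≤ n := by exact_mod_cast hn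
  have hr0 : 0 < √(n : ℝ) := Real.sqrt_pos.2 hn0
  have hr1 : 1 ≤ √(n : ℝ) := Real.one_le_sqrt.2 hn1
  have hr2 : √(n : ℝ) ^ 2 = n := Real.sq_sqrt hn0.le
  have hL := abs_tiltMean_sub_le (N := N) b x
  have hs1 := norm_meanSpin_le σ
  rw [rescaledSpin_eq, rescaledSpin_eq, hσ, norm_sub_sq_real, norm_smul, norm_inv,
    Real.norm_natCast, inner_smul_right]
  set ρ := tiltMean N b with hρ
  have hρ0 : 0 < ρ := tiltMean_pos hb
  set q := β / b with hq
  have hqρ : q * ρ = 1 := by rw [hq, h]; field_simp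
  set s := meanSpin σ
  have hs : ‖s - ρ • e‖ ≤ ‖s - tiltMean N x • e‖ + |x - b| := by
    have e1 : s - ρ • e = (s - tiltMean N x • e) + (tiltMean N x - ρ) • e := by
      rw [sub_smul]; abel
    rw [e1]
    refine (norm_add_le _ _).trans (add_le_add le_rfl ?_)
    rw [norm_smul, he, mul_one]; exact hL
  set r := √(n : ℝ)
  -- The exact increment is linear in ⟨s, d⟩ up to |d|²/n. Replacing s by its limit ρ e, where q ρ =
  -- 1, yields the main term 2q⟨e, d⟩/√n.
  have e2 : r * (q ^ 2 * ‖s‖ ^ 2 - 1) - r * (q ^ 2 * (‖s‖ ^ 2 - 2 * ((n : ℝ)⁻¹ * inner ℝ s d) +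
      ((n : ℝ)⁻¹ * ‖d‖) ^ 2) - 1) = q ^ 2 * (2 * inner ℝ s d - ‖d‖ ^ 2 / n) / r := by
    rw [← hr2]; field_simp; ring
  have e3 : q ^ 2 * (2 * inner ℝ s d - ‖d‖ ^ 2 / n) / r - 2 * q / r * inner ℝ e d =
      q ^ 2 * (2 * inner ℝ (s - ρ • e) d - ‖d‖ ^ 2 / n) / r := by
    rw [inner_sub_left, inner_smul_left, RCLike.conj_to_real]
    have : 2 * q / r * inner ℝ e d = q * (q * ρ) * 2 * inner ℝ e d / r := by rw [hqρ]; ring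
    rw [this]; ring
  have hdn : ‖d‖ ^ 2 / n ≤ 4 / r := by
    have h4 : ‖d‖ ^ 2 ≤ 4 := by nlinarith [norm_nonneg d]
    calc ‖d‖ ^ 2 / n ≤ 4 / n := by gcongr
      _ ≤ 4 / r := by
        refine div_le_div_of_nonneg_left (by norm_num) hr0 ?_
        rw [← hr2]; nlinarith
  have hdn0 : 0 ≤ ‖d‖ ^ 2 / n := by positivity
  have habs : ∀ w : EuclideanSpace ℝ (Fin N), |2 * inner ℝ w d - ‖d‖ ^ 2 / n| ≤
      4 * (‖w‖ + 1 / r) := fun w => by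
    have h1 := abs_real_inner_le_norm w d
    have h2 : ‖w‖ * ‖d‖ ≤ ‖w‖ * 2 := by gcongr
    have h3 : 4 / r = 4 * (1 / r) := by ring
    refine (abs_sub _ _).trans ?_
    rw [abs_mul, abs_two, abs_of_nonneg hdn0]
    linarith
  rw [e2, e3]
  constructor
  · rw [abs_div, abs_of_pos hr0, abs_mul, abs_of_nonneg (sq_nonneg q)]
    refine div_le_div_of_nonneg_right ?_ hr0.le
    calc _ ≤ q ^ 2 * (4 * (‖s - ρ • e‖ + 1 / r)) := by gcongr; exact habs _
      _ ≤ q ^ 2 * (4 * (‖s - tiltMean N x • e‖ + |x - b| + 1 / r)) := by gcongr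
      _ = _ := by ring
  · rw [abs_div, abs_of_pos hr0, abs_mul, abs_of_nonneg (sq_nonneg q)]
    refine div_le_div_of_nonneg_right ?_ hr0.le
    have h1r : 1 / r ≤ 1 := by rw [div_le_one hr0]; exact hr1
    calc _ ≤ q ^ 2 * (4 * (‖s‖ + 1 / r)) := by gcongr; exact habs _
      _ ≤ q ^ 2 * (4 * (1 + 1)) := by gcongr
      _ = _ := by ring

/-- Factor |s|² - ρ² = (|s| - ρ)(|s| + ρ), where the second factor is at most 2 and the first is
bounded by the distance from s to ρ e. -/
lemma abs_rescaledSpin_le {β b : ℝ} (hb : 0 < b) (hβ : 0 < β) (h : b = β * tiltMean N b) {n : ℕ}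
    {e : EuclideanSpace ℝ (Fin N)} (he : ‖e‖ = 1) (x : ℝ) (σ : Config N n) :
    |rescaledSpin β b σ| ≤
      2 * (β / b) ^ 2 * √n * (‖meanSpin σ - tiltMean N x • e‖ + |x - b|) := by
  have hL := abs_tiltMean_sub_le (N := N) b x
  have hs1 := norm_meanSpin_le σ
  have hρ1 := (abs_le.1 (abs_tiltMean_le (N := N) b)).2
  rw [rescaledSpin_eq]
  set ρ := tiltMean N b with hρ
  have hρ0 : 0 < ρ := tiltMean_pos hb
  set q := β / b with hq
  have hqρ : q * ρ = 1 := by rw [hq, h]; field_simp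
  set s := meanSpin σ
  have hs : ‖s - ρ • e‖ ≤ ‖s - tiltMean N x • e‖ + |x - b| := by
    have e1 : s - ρ • e = (s - tiltMean N x • e) + (tiltMean N x - ρ) • e := by
      rw [sub_smul]; abel
    rw [e1]
    refine (norm_add_le _ _).trans (add_le_add le_rfl ?_)
    rw [norm_smul, he, mul_one]; exact hL
  have h1 : |‖s‖ - ρ| ≤ ‖s - tiltMean N x • e‖ + |x - b| := by
    have := abs_norm_sub_norm_le s (ρ • e)
    rw [norm_smul, he, mul_one, Real.norm_eq_abs, abs_of_pos hρ0] at this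
    exact this.trans hs
  have e1 : √(n : ℝ) * (q ^ 2 * ‖s‖ ^ 2 - 1) = q ^ 2 * √n * ((‖s‖ - ρ) * (‖s‖ + ρ)) := by
    have : (1 : ℝ) = (q * ρ) ^ 2 := by rw [hqρ]; ring
    rw [this]; ring
  rw [e1, abs_mul, abs_of_nonneg (by positivity), abs_mul,
    abs_of_nonneg (by positivity : 0 ≤ ‖s‖ + ρ)]
  calc q ^ 2 * √n * (|‖s‖ - ρ| * (‖s‖ + ρ)) ≤
      q ^ 2 * √n * ((‖s - tiltMean N x • e‖ + |x - b|) * (1 + 1)) := by gcongr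
    _ = _ := by ring

end

/-! ### Stein's method in a fixed external field -/

section
variable {N : ℕ} [Fact (2 ≤ N)]

lemma abs_inner_sphere_le {N : ℕ} {e : EuclideanSpace ℝ (Fin N)} (he : ‖e‖ = 1) (σ : Sphere N) :
    |inner ℝ e σ.1| ≤ 1 := by
  have := abs_real_inner_le_norm e σ.1
  rwa [he, norm_coe_sphere, one_mul] at this

/-- The difference of two independent copies has twice the variance of one. This centres the sum of
squares in `stein_exchange`. -/
lemma integral_sq_sub_inner {e : EuclideanSpace ℝ (Fin N)} (he : ‖e‖ = 1) (x : ℝ) :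
    ∫ p : Sphere N × Sphere N, ((inner ℝ e p.1.1 - inner ℝ e p.2.1) ^ 2 - 2 * tiltVar N x)
      ∂(tiltedSphere (x • e)).prod (tiltedSphere (x • e)) = 0 := by
  set ν := tiltedSphere (x • e) with hν
  have m1 : Measurable fun p : Sphere N × Sphere N => inner ℝ e p.1.1 :=
    Continuous.measurable (by fun_prop)
  have m2 : Measurable fun p : Sphere N × Sphere N => inner ℝ e p.2.1 :=
    Continuous.measurable (by fun_prop)
  have hb := abs_inner_sphere_le he
  have hbb : ∀ σ σ' : Sphere N, |inner ℝ e σ.1 * inner ℝ e σ'.1| ≤ 1 := fun σ σ' => by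
    rw [abs_mul]; exact mul_le_one₀ (hb _) (abs_nonneg _) (hb _)
  have i1 : Integrable (fun p : Sphere N × Sphere N => inner ℝ e p.1.1 * inner ℝ e p.1.1)
    (ν.prod ν) := integrable_of_abs_le (m1.mul m1) fun p => hbb _ _
  have i2 : Integrable (fun p : Sphere N × Sphere N => inner ℝ e p.1.1 * inner ℝ e p.2.1)
    (ν.prod ν) := integrable_of_abs_le (m1.mul m2) fun p => hbb _ _
  have i3 : Integrable (fun p : Sphere N × Sphere N => inner ℝ e p.2.1 * inner ℝ e p.2.1)
    (ν.prod ν) := integrable_of_abs_le (m2.mul m2) fun p => hbb _ _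
  have e0 : ∀ p : Sphere N × Sphere N,
      (inner ℝ e p.1.1 - inner ℝ e p.2.1) ^ 2 - 2 * tiltVar N x =
      inner ℝ e p.1.1 * inner ℝ e p.1.1 - 2 * (inner ℝ e p.1.1 * inner ℝ e p.2.1) +
        inner ℝ e p.2.1 * inner ℝ e p.2.1 - 2 * tiltVar N x := fun p => by ring
  simp only [e0]
  have i4 : Integrable (fun p : Sphere N × Sphere N => inner ℝ e p.1.1 * inner ℝ e p.1.1 -
    2 * (inner ℝ e p.1.1 * inner ℝ e p.2.1)) (ν.prod ν) := i1.sub (i2.const_mul 2)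
  have i5 : Integrable (fun p : Sphere N × Sphere N => inner ℝ e p.1.1 * inner ℝ e p.1.1 -
    2 * (inner ℝ e p.1.1 * inner ℝ e p.2.1) + inner ℝ e p.2.1 * inner ℝ e p.2.1) (ν.prod ν) :=
    i4.add i3
  rw [integral_sub i5 (integrable_const _), integral_add i4 i3, integral_sub i1 (i2.const_mul 2),
    integral_const_mul,
    integral_prod_mul (fun σ : Sphere N => inner ℝ e σ.1) fun σ : Sphere N => inner ℝ e σ.1]
  have h1 := integral_prod_mul (μ := ν) (ν := ν)
    (fun σ : Sphere N => inner ℝ e σ.1 * inner ℝ e σ.1) fun _ : Sphere N => (1 : ℝ)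
  have h2 := integral_prod_mul (μ := ν) (ν := ν) (fun _ : Sphere N => (1 : ℝ))
    (fun σ : Sphere N => inner ℝ e σ.1 * inner ℝ e σ.1)
  simp only [mul_one, one_mul, integral_const, probReal_univ, smul_eq_mul] at h1 h2
  rw [h1, h2]
  have k1 := integral_tiltedSphere_inner he x 1
  have k2 := integral_tiltedSphere_inner he x 2
  simp only [pow_one, pow_two] at k1 k2
  rw [k1, k2]
  simp only [integral_const, probReal_univ, smul_eq_mul, one_mul]
  unfold tiltVar tiltMean
  ring

/-- The integrand is antisymmetric under exchange of the two copies. -/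
lemma integral_abs_mul_sub_inner {N : ℕ} (ν : Measure (Sphere N)) [IsProbabilityMeasure ν]
    (e : EuclideanSpace ℝ (Fin N)) :
    ∫ p : Sphere N × Sphere N, |inner ℝ e p.1.1 - inner ℝ e p.2.1| *
      (inner ℝ e p.1.1 - inner ℝ e p.2.1) ∂ν.prod ν = 0 := by
  have h := integral_prod_swap (μ := ν) (ν := ν) fun p : Sphere N × Sphere N =>
    |inner ℝ e p.1.1 - inner ℝ e p.2.1| * (inner ℝ e p.1.1 - inner ℝ e p.2.1)
  have e1 : ∀ p : Sphere N × Sphere N, |inner ℝ e p.swap.1.1 - inner ℝ e p.swap.2.1| *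
      (inner ℝ e p.swap.1.1 - inner ℝ e p.swap.2.1) = -(|inner ℝ e p.1.1 - inner ℝ e p.2.1| *
      (inner ℝ e p.1.1 - inner ℝ e p.2.1)) := fun p => by
    rw [Prod.fst_swap, Prod.snd_swap, abs_sub_comm]; ring
  simp only [e1, integral_neg] at h
  linarith

lemma inner_meanSpin_sub {n : ℕ} (hn : 1 ≤ n) {e : EuclideanSpace ℝ (Fin N)} (he : ‖e‖ = 1) (x : ℝ)
    (σ : Config N n) :
    √n * inner ℝ e (meanSpin σ - tiltMean N x • e) =
      1 / √n * ∑ k, (inner ℝ e (σ k).1 - tiltMean N x) := by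
  have hn0 : (0 : ℝ) < n := by exact_mod_cast hn
  have hr0 : 0 < √(n : ℝ) := Real.sqrt_pos.2 hn0
  have hr2 : √(n : ℝ) ^ 2 = n := Real.sq_sqrt hn0.le
  unfold meanSpin totalSpin
  rw [inner_sub_right, inner_smul_right, inner_smul_right, real_inner_self_eq_norm_sq, he,
    inner_sum, Finset.sum_sub_distrib, Finset.sum_const, Finset.card_univ, Fintype.card_fin, nsmul_eq_mul]
  set r := √(n : ℝ)
  rw [← hr2]
  field_simp

lemma meanSpin_swapAt {N n : ℕ} (τ : Fin n → Sphere N × Sphere N) (k : Fin n) :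
    meanSpin (firstCoords (swapAt k τ)) =
      meanSpin (firstCoords τ) - (n : ℝ)⁻¹ • ((τ k).1.1 - (τ k).2.1) := by
  unfold meanSpin totalSpin
  rw [← smul_sub]
  congr 1
  rw [eq_sub_iff_add_eq, ← eq_sub_iff_add_eq', ← Finset.sum_sub_distrib,
    Finset.sum_eq_single k]
  · simp [firstCoords, swapAt]
  · intro i _ hi
    simp [firstCoords, swapAt, hi]
  · simp

/-- Stein's method in a fixed external field: the fluctuations of the mean spin. -/
lemma fixed_field_stein {β b : ℝ} (hb : 0 < b) (hβ : 0 < β) (h : b = β * tiltMean N b) :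
    ∃ C, 0 < C ∧ ∀ n : ℕ, 1 ≤ n → ∀ e : EuclideanSpace ℝ (Fin N), ‖e‖ = 1 → ∀ (x K z : ℝ)
      (g g' : ℝ → ℝ), SteinPair K z g g' →
      |∫ σ : Config N n, (2 * (β / b) * (√n * inner ℝ e (meanSpin σ - tiltMean N x • e)) *
        g (rescaledSpin β b σ) - (2 * (β / b)) ^ 2 * tiltVar N x * g' (rescaledSpin β b σ))
        ∂Measure.pi (fun _ => tiltedSphere (x • e))| ≤ C * K * (1 / √n + |x - b|) := by
  set q := β / b with hq
  have hq0 : 0 < q := by positivity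
  set c := 2 * q with hc
  have hc0 : 0 < c := by positivity
  set a := 8 * q ^ 2 with ha
  refine ⟨36 * c * q ^ 2 + 6 * c ^ 2 + c * a ^ 2 * (1 + 4 * q ^ 2) + 2 * q ^ 2 * c * a ^ 2,
    by positivity, fun n hn e he x K z g g' hg => ?_⟩
  have hK := hg.nonneg
  have hn0 : (0 : ℝ) < n := by exact_mod_cast hn
  set r := √(n : ℝ) with hr
  have hr0 : 0 < r := Real.sqrt_pos.2 hn0
  set ν := tiltedSphere (x • e) with hν
  set P : Measure (Fin n → Sphere N × Sphere N) := Measure.pi fun _ => ν.prod ν with hP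
  set W : (Fin n → Sphere N × Sphere N) → ℝ := fun τ => rescaledSpin β b (firstCoords τ) with hW
  have hF : Measurable (firstCoords : (Fin n → Sphere N × Sphere N) → _) :=
    (measurePreserving_firstCoords ν).measurable
  have hWm0 : Measurable (rescaledSpin β b : Config N n → ℝ) :=
    (continuous_rescaledSpin β b).measurable
  have hWm : Measurable W := hWm0.comp hF
  have hD1 : ∀ σ : Config N n, ‖meanSpin σ - tiltMean N x • e‖ ≤ 2 := fun σ =>
    (norm_sub_le _ _).trans (by linarith [norm_meanSpin_le σ, norm_tiltMean_smul_le he x])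
  have hWA0 : ∀ σ : Config N n, |rescaledSpin β b σ| ≤ 2 * q ^ 2 * r * (2 + |x - b|) := fun σ =>
    (abs_rescaledSpin_le hb hβ h he x σ).trans (by gcongr; exact hD1 σ)
  have hDm : Continuous fun σ : Config N n => ‖meanSpin σ - tiltMean N x • e‖ := by
    have := continuous_meanSpin (N := N) (n := n); fun_prop
  have hDi : Integrable (fun τ : Fin n → Sphere N × Sphere N =>
      ‖meanSpin (firstCoords τ) - tiltMean N x • e‖) P :=
    integrable_of_abs_le (hDm.measurable.comp hF) (C := 2) fun τ => by
      rw [abs_norm]; exact hD1 _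
  have hDi' : Integrable (fun τ : Fin n → Sphere N × Sphere N =>
      ‖meanSpin (firstCoords τ) - tiltMean N x • e‖ + |x - b|) P := hDi.add (integrable_const _)
  have hDint : ∫ τ, ‖meanSpin (firstCoords τ) - tiltMean N x • e‖ ∂P ≤ 2 / r := by
    rw [hP, integral_comp_firstCoords ν hDm.measurable]
    exact integral_norm_meanSpin_sub_le hn he x
  set u : Fin n → (Fin n → Sphere N × Sphere N) → ℝ :=
    fun k τ => inner ℝ e (τ k).1.1 - inner ℝ e (τ k).2.1 with hu
  have hum0 : Measurable fun p : Sphere N × Sphere N => inner ℝ e p.1.1 - inner ℝ e p.2.1 :=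
    Continuous.measurable (by fun_prop)
  have hum : ∀ k, Measurable (u k) := fun k => hum0.comp (measurable_pi_apply k)
  have hu0 : ∀ p : Sphere N × Sphere N, |inner ℝ e p.1.1 - inner ℝ e p.2.1| ≤ 2 := fun p =>
    (abs_sub _ _).trans (by linarith [abs_inner_sphere_le he p.1, abs_inner_sphere_le he p.2])
  have hswap : ∀ k τ, |W τ - W (swapAt k τ) - c / r * u k τ| ≤
        4 * q ^ 2 * (‖meanSpin (firstCoords τ) - tiltMean N x • e‖ + |x - b| + 1 / r) / r ∧
      |W τ - W (swapAt k τ)| ≤ a / r := fun k τ => by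
    have hd : ‖(τ k).1.1 - (τ k).2.1‖ ≤ 2 :=
      (norm_sub_le _ _).trans (by rw [norm_coe_sphere, norm_coe_sphere]; norm_num)
    have := rescaledSpin_sub hb hβ h hn he x hd (meanSpin_swapAt τ k)
    rwa [inner_sub_right] at this
  -- Each site carries a spin and an independent copy, exchanged by `swapAt`. The quantity u_k is
  -- their difference along e, and ε collects the distance of the mean spin from its limit.
  have hst := stein_exchange (P := P) hn (T := swapAt) (fun k => measurePreserving_swapAt ν k)
    swapAt_swapAt hWm (fun τ => hWA0 _) hum (fun k τ => hu0 _)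
    (fun k τ => by simp only [hu, swapAt_self, Prod.fst_swap, Prod.snd_swap]; ring)
    (ε := fun τ => 4 * q ^ 2 * (‖meanSpin (firstCoords τ) - tiltMean N x • e‖ + |x - b| + 1 / r))
    ((hDi'.add (integrable_const _)).const_mul _)
    (a := a) (c := c) (v := tiltVar N x) (ε₀ := 4 * q ^ 2 * (2 / r + |x - b| + 1 / r))
    (w₀ := 2 * q ^ 2 * r * (2 / r + |x - b|)) hc0.le (fun k τ => (hswap k τ).1)
    (fun k τ => (hswap k τ).2)
    (integral_abs_sum_pi_le (ν.prod ν) (ψ := fun p : Sphere N × Sphere N =>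
      (inner ℝ e p.1.1 - inner ℝ e p.2.1) ^ 2 - 2 * tiltVar N x)
      ((hum0.pow_const 2).sub_const _) (by norm_num) (fun p => by
        have h1 := hu0 p
        have h2 := tiltVar_le (N := N) x
        have h3 := tiltVar_pos (N := N) x
        have h4 : (inner ℝ e p.1.1 - inner ℝ e p.2.1) ^ 2 ≤ 2 ^ 2 :=
          sq_le_sq' (abs_le.1 h1).1 (abs_le.1 h1).2
        have h5 := sq_nonneg (inner ℝ e p.1.1 - inner ℝ e p.2.1)
        rw [abs_le]; constructor <;> linarith) (integral_sq_sub_inner he x))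
    (integral_abs_sum_pi_le (ν.prod ν) (ψ := fun p : Sphere N × Sphere N =>
      |inner ℝ e p.1.1 - inner ℝ e p.2.1| * (inner ℝ e p.1.1 - inner ℝ e p.2.1))
      (hum0.abs.mul hum0) (by norm_num) (fun p => by
        rw [abs_mul, abs_abs]
        calc _ ≤ (2 : ℝ) * 2 := mul_le_mul (hu0 p) (hu0 p) (abs_nonneg _) (by norm_num)
          _ = 4 := by norm_num) (integral_abs_mul_sub_inner ν e))
    (by
      rw [integral_const_mul, integral_add hDi' (integrable_const _),
        integral_add hDi (integrable_const _)]
      simp only [integral_const, probReal_univ, smul_eq_mul, one_mul]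
      gcongr)
    (by
      calc ∫ τ, |W τ| ∂P ≤ ∫ τ, 2 * q ^ 2 * r *
            (‖meanSpin (firstCoords τ) - tiltMean N x • e‖ + |x - b|) ∂P :=
            integral_mono (integrable_of_abs_le hWm fun τ => hWA0 _).abs
              (hDi'.const_mul _) fun τ => abs_rescaledSpin_le hb hβ h he x _
        _ ≤ _ := by
          rw [integral_const_mul, integral_add hDi (integrable_const _)]
          simp only [integral_const, probReal_univ, smul_eq_mul, one_mul]
          gcongr) hg
  have hgm : Measurable fun σ : Config N n => g (rescaledSpin β b σ) := hg.meas.comp hWm0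
  have hgm' : Measurable fun σ : Config N n => g' (rescaledSpin β b σ) := hg.meas_deriv.comp hWm0
  have hψm : Measurable fun σ : Sphere N => inner ℝ e σ.1 - tiltMean N x :=
    Continuous.measurable (by fun_prop)
  have hψb : ∀ σ : Sphere N, |inner ℝ e σ.1 - tiltMean N x| ≤ 2 := fun σ =>
    (abs_sub _ _).trans (by linarith [abs_inner_sphere_le he σ, abs_tiltMean_le (N := N) x])
  have hψ0 : ∫ σ : Sphere N, (inner ℝ e σ.1 - tiltMean N x) ∂ν = 0 := by
    rw [integral_sub (integrable_inner_sphere e ν) (integrable_const _),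
      integral_tiltedSphere_linear he, inner_smul_right, real_inner_self_eq_norm_sq, he]
    simp
  have hex := fun k => integral_mul_eq_exchange ν hψm hψb hψ0 hgm (fun σ => hg.bound _) k
  have eq : ∫ σ : Config N n, (c * (r * inner ℝ e (meanSpin σ - tiltMean N x • e)) *
        g (rescaledSpin β b σ) - c ^ 2 * tiltVar N x * g' (rescaledSpin β b σ))
        ∂Measure.pi (fun _ => ν) = ∫ τ, (c / (2 * r) * ∑ k, u k τ * (g (W τ) - g (W (swapAt k τ))) -
          c ^ 2 * tiltVar N x * g' (W τ)) ∂P := by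
    have iσ : ∀ k : Fin n, Integrable (fun σ : Config N n =>
        (inner ℝ e (σ k).1 - tiltMean N x) * g (rescaledSpin β b σ)) (Measure.pi fun _ => ν) :=
      fun k => integrable_of_abs_le (C := 2 * K) ((hψm.comp (measurable_pi_apply k)).mul hgm)
        fun σ => by
          rw [abs_mul]; exact mul_le_mul (hψb _) (hg.bound _) (abs_nonneg _) (by norm_num)
    have iτ : ∀ k : Fin n, Integrable (fun τ => u k τ * (g (W τ) - g (W (swapAt k τ)))) P :=
      fun k => integrable_of_abs_le (C := 2 * (K + K)) ((hum k).mul ((hg.meas.comp hWm).sub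
        ((hg.meas.comp hWm).comp (measurePreserving_swapAt ν k).measurable))) fun τ => by
          rw [abs_mul]
          exact mul_le_mul (hu0 _) ((abs_sub _ _).trans (add_le_add (hg.bound _) (hg.bound _)))
            (abs_nonneg _) (by norm_num)
    have iσ' : Integrable (fun σ : Config N n => c ^ 2 * tiltVar N x * g' (rescaledSpin β b σ))
        (Measure.pi fun _ => ν) :=
      (integrable_of_abs_le hgm' fun σ => hg.bound_deriv _).const_mul _
    have iτ' : Integrable (fun τ => c ^ 2 * tiltVar N x * g' (W τ)) P :=
      (integrable_of_abs_le (hgm'.comp hF) fun σ => hg.bound_deriv _).const_mul _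
    have e1 : ∀ σ : Config N n, c * (r * inner ℝ e (meanSpin σ - tiltMean N x • e)) *
        g (rescaledSpin β b σ) =
        c / r * ∑ k, (inner ℝ e (σ k).1 - tiltMean N x) * g (rescaledSpin β b σ) := fun σ => by
      rw [inner_meanSpin_sub hn he, ← Finset.sum_mul]; ring
    simp only [e1]
    rw [integral_sub ((integrable_finsetSum _ fun k _ => iσ k).const_mul _) iσ',
      integral_sub ((integrable_finsetSum _ fun k _ => iτ k).const_mul _) iτ', integral_const_mul,
      integral_const_mul (c / (2 * r)), integral_finsetSum _ fun k _ => iσ k,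
      integral_finsetSum _ fun k _ => iτ k,
      integral_comp_firstCoords ν (F := fun σ => c ^ 2 * tiltVar N x * g' (rescaledSpin β b σ))
        (hgm'.const_mul _)]
    congr 1
    rw [Finset.mul_sum, Finset.mul_sum]
    refine Finset.sum_congr rfl fun k _ => ?_
    rw [hex k]
    have e2 : ∀ τ : Fin n → Sphere N × Sphere N, inner ℝ e (τ k).1.1 - tiltMean N x -
      (inner ℝ e (τ k).2.1 - tiltMean N x) = u k τ := fun τ => by simp only [hu]; ring
    simp only [e2]
    rw [← mul_assoc]
    congr 1
    field_simp
  rw [eq]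
  refine hst.trans ?_
  -- The bound for E|W| contains √n |x - b|, but it enters divided by √n, so only 1/√n and |x - b|
  -- remain.
  have e3 : K * (3 * c * (4 * q ^ 2 * (2 / r + |x - b| + 1 / r)) +
      (6 * c ^ 2 + c * a ^ 2 * (1 + 2 * q ^ 2 * r * (2 / r + |x - b|))) / r) =
      K * ((36 * c * q ^ 2 + 6 * c ^ 2 + c * a ^ 2 * (1 + 4 * q ^ 2)) * (1 / r) +
        (12 * c * q ^ 2 + 2 * q ^ 2 * c * a ^ 2) * |x - b|) := by
    field_simp
    ring
  have p1 : 0 ≤ 2 * q ^ 2 * c * a ^ 2 * (1 / r) := by positivity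
  have p2 : 0 ≤ (24 * c * q ^ 2 + 6 * c ^ 2 + c * a ^ 2 * (1 + 4 * q ^ 2)) * |x - b| := by
    positivity
  rw [e3]
  calc _ ≤ K * ((36 * c * q ^ 2 + 6 * c ^ 2 + c * a ^ 2 * (1 + 4 * q ^ 2) +
        2 * q ^ 2 * c * a ^ 2) * (1 / r + |x - b|)) := by
        refine mul_le_mul_of_nonneg_left ?_ hK
        linarith
    _ = _ := by ring

end

section
variable {N : ℕ} [Fact (2 ≤ N)]

/-- The Stein equation for `W_n` in a fixed external field close to the mean-field solution. -/
lemma fixed_field_estimate {β b : ℝ} (hb : 0 < b) (hβ : 0 < β) (h : b = β * tiltMean N b) :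
    ∃ C, 0 < C ∧ ∀ n : ℕ, 1 ≤ n → ∀ e : EuclideanSpace ℝ (Fin N), ‖e‖ = 1 → ∀ (x K z : ℝ)
      (g g' : ℝ → ℝ), SteinPair K z g g' →
      |∫ σ : Config N n, (rescaledSpin β b σ * g (rescaledSpin β b σ) -
        β * tiltVar N b / b ^ 2 * √n * (x ^ 2 - b ^ 2) * g (rescaledSpin β b σ) -
        (2 * (β / b)) ^ 2 * tiltVar N b * g' (rescaledSpin β b σ))
        ∂Measure.pi (fun _ => tiltedSphere (x • e))| ≤ C * K * (1 / √n + √n * (x - b) ^ 2) := by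
  obtain ⟨C₁, hC₁, h₁⟩ := fixed_field_stein hb hβ h
  obtain ⟨C₂, hC₂, h₂⟩ := rescaledSpin_linearization hb hβ h
  set q := β / b with hq
  refine ⟨2 * C₁ + 4 * C₂ + 4 * (2 * q) ^ 2, by positivity, fun n hn e he x K z g g' hg => ?_⟩
  have hK := hg.nonneg
  have hn0 : (0 : ℝ) < n := by exact_mod_cast hn
  have h₁ := h₁ n hn e he x K z g g' hg
  have h₂ := h₂ n e he x
  have hD2 := integral_sq_meanSpin_sub_le hn he x
  have hr2 : √(n : ℝ) ^ 2 = n := Real.sq_sqrt hn0.le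
  set r := √(n : ℝ) with hr
  have hr0 : 0 < r := Real.sqrt_pos.2 hn0
  set P : Measure (Config N n) := Measure.pi fun _ => tiltedSphere (x • e) with hP
  have hWm : Measurable (rescaledSpin β b : Config N n → ℝ) :=
    (continuous_rescaledSpin β b).measurable
  have hgm : Measurable fun σ : Config N n => g (rescaledSpin β b σ) := hg.meas.comp hWm
  have hgm' : Measurable fun σ : Config N n => g' (rescaledSpin β b σ) := hg.meas_deriv.comp hWm
  have ig' : Integrable (fun σ : Config N n => g' (rescaledSpin β b σ)) P :=
    integrable_of_abs_le hgm' fun σ => hg.bound_deriv _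
  have ig : Integrable (fun σ : Config N n => g (rescaledSpin β b σ)) P :=
    integrable_of_abs_le hgm fun σ => hg.bound _
  have hbc : ∀ F : Config N n → ℝ, Continuous F →
      Integrable (fun σ => F σ * g (rescaledSpin β b σ)) P := fun F hF =>
    ig.bdd_mul hF.aestronglyMeasurable
      (.of_forall fun σ => (isCompact_univ.exists_bound_of_continuousOn hF.continuousOn).choose_spec
        σ (Set.mem_univ σ))
  have hcm := continuous_meanSpin (N := N) (n := n)
  have hcW := continuous_rescaledSpin (N := N) (n := n) β b
  have i1 : Integrable (fun σ : Config N n =>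
      2 * q * (r * inner ℝ e (meanSpin σ - tiltMean N x • e)) * g (rescaledSpin β b σ) -
      (2 * q) ^ 2 * tiltVar N x * g' (rescaledSpin β b σ)) P :=
    (hbc _ (by fun_prop)).sub (ig'.const_mul _)
  set R : Config N n → ℝ := fun σ => rescaledSpin β b σ -
    (2 * β / b * r * inner ℝ e (meanSpin σ - tiltMean N x • e) +
      β * tiltVar N b / b ^ 2 * r * (x ^ 2 - b ^ 2)) with hR
  have i2 : Integrable (fun σ : Config N n => R σ * g (rescaledSpin β b σ)) P :=
    hbc _ (by fun_prop)
  have i3 : Integrable (fun σ : Config N n =>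
      (2 * q) ^ 2 * (tiltVar N x - tiltVar N b) * g' (rescaledSpin β b σ)) P := ig'.const_mul _
  -- The summands are the fixed-field Stein identity, the linearization error R of W, and the
  -- replacement of the variance at x by the variance at b.
  have e1 : ∀ σ : Config N n, rescaledSpin β b σ * g (rescaledSpin β b σ) -
        β * tiltVar N b / b ^ 2 * r * (x ^ 2 - b ^ 2) * g (rescaledSpin β b σ) -
        (2 * q) ^ 2 * tiltVar N b * g' (rescaledSpin β b σ) =
      ((2 * q * (r * inner ℝ e (meanSpin σ - tiltMean N x • e)) * g (rescaledSpin β b σ) -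
      (2 * q) ^ 2 * tiltVar N x * g' (rescaledSpin β b σ)) + R σ * g (rescaledSpin β b σ)) +
      (2 * q) ^ 2 * (tiltVar N x - tiltVar N b) * g' (rescaledSpin β b σ) := fun σ => by
    simp only [hR, hq]; ring
  simp only [e1]
  have i12 : Integrable (fun σ : Config N n =>
      (2 * q * (r * inner ℝ e (meanSpin σ - tiltMean N x • e)) * g (rescaledSpin β b σ) -
      (2 * q) ^ 2 * tiltVar N x * g' (rescaledSpin β b σ)) + R σ * g (rescaledSpin β b σ)) P :=
    i1.add i2
  rw [integral_add i12 i3, integral_add i1 i2]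
  have b2 : |∫ σ, R σ * g (rescaledSpin β b σ) ∂P| ≤ C₂ * K * (4 / r + r * (x - b) ^ 2) := by
    have iD := integrable_norm_meanSpin_sub (tiltMean N x • e) 2 P
    have iD' : Integrable (fun σ : Config N n =>
        C₂ * r * (‖meanSpin σ - tiltMean N x • e‖ ^ 2 + (x - b) ^ 2) * K) P :=
      ((iD.add (integrable_const _)).const_mul _).mul_const _
    calc |∫ σ, R σ * g (rescaledSpin β b σ) ∂P| ≤ ∫ σ, |R σ * g (rescaledSpin β b σ)| ∂P :=
          abs_integral_le_integral_abs
      _ ≤ ∫ σ, C₂ * r * (‖meanSpin σ - tiltMean N x • e‖ ^ 2 + (x - b) ^ 2) * K ∂P := by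
          refine integral_mono i2.abs iD' fun σ => ?_
          simp only [abs_mul]
          exact mul_le_mul (h₂ σ) (hg.bound _) (abs_nonneg _) (by positivity)
      _ = C₂ * r * (∫ σ, ‖meanSpin σ - tiltMean N x • e‖ ^ 2 ∂P + (x - b) ^ 2) * K := by
          rw [integral_mul_const, integral_const_mul, integral_add iD (integrable_const _)]
          simp
      _ ≤ C₂ * r * (4 / n + (x - b) ^ 2) * K := by gcongr
      _ = _ := by rw [← hr2]; field_simp
  have b3 : |∫ σ, (2 * q) ^ 2 * (tiltVar N x - tiltVar N b) * g' (rescaledSpin β b σ) ∂P| ≤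
      (2 * q) ^ 2 * (4 * |x - b|) * K := by
    have := norm_integral_le_of_norm_le_const (μ := P) (C := (2 * q) ^ 2 * (4 * |x - b|) * K)
      (f := fun σ => (2 * q) ^ 2 * (tiltVar N x - tiltVar N b) * g' (rescaledSpin β b σ))
      (.of_forall fun σ => by
        rw [Real.norm_eq_abs, abs_mul, abs_mul, abs_of_nonneg (sq_nonneg (2 * q))]
        gcongr
        · exact abs_tiltVar_sub_le b x
        · exact hg.bound_deriv _)
    simpa using this
  -- A linear error in x - b is traded for 1/√n plus a quadratic one, whose average over the field
  -- is of order 1/√n by concentration.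
  have hδ : |x - b| ≤ 1 / r + r * (x - b) ^ 2 := by
    have e2 : 1 / r + r * (x - b) ^ 2 - |x - b| =
        1 / r * ((1 - r * |x - b|) ^ 2 + r * |x - b|) := by
      rw [← sq_abs (x - b)]; field_simp; ring
    have : 0 ≤ 1 / r * ((1 - r * |x - b|) ^ 2 + r * |x - b|) := by positivity
    linarith
  have hr' : 0 ≤ 1 / r := by positivity
  have hx' : 0 ≤ r * (x - b) ^ 2 := by positivity
  set X := 1 / r + r * (x - b) ^ 2 with hX
  calc _ ≤ C₁ * K * (1 / r + |x - b|) + C₂ * K * (4 / r + r * (x - b) ^ 2) +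
        (2 * q) ^ 2 * (4 * |x - b|) * K :=
        (abs_add_le _ _).trans (add_le_add ((abs_add_le _ _).trans (add_le_add h₁ b2)) b3)
    _ ≤ C₁ * K * (X + X) + C₂ * K * (4 * X) + (2 * q) ^ 2 * (4 * X) * K := by
        gcongr
        · linarith
        · rw [hX, mul_add, mul_one_div]; linarith
    _ = _ := by ring

end

/-! ### The Gibbs measure as a mixture of product measures -/

lemma pi_tilted {X : Type*} [MeasurableSpace X] (μ : Measure X) [IsProbabilityMeasure μ]
    (f : X → ℝ) (n : ℕ) : Measure.pi (fun _ : Fin n => μ.tilted f) =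
      (Measure.pi fun _ : Fin n => μ).tilted fun x => ∑ i, f (x i) := by
  refine Measure.pi_eq fun s hs => ?_
  rw [tilted_apply_eq_ofReal_integral' _ (MeasurableSet.univ_pi hs), Measure.restrict_pi_pi]
  simp only [fun i => tilted_apply_eq_ofReal_integral' (μ := μ) f (hs i)]
  rw [← ENNReal.ofReal_prod_of_nonneg fun i _ => integral_nonneg fun x => by positivity]
  congr 1
  have e1 : ∀ x : Fin n → X, Real.exp (∑ i, f (x i)) = ∏ i, Real.exp (f (x i)) := fun x =>
    Real.exp_sum _ _
  have e2 : ∫ x : Fin n → X, Real.exp (∑ i, f (x i)) ∂Measure.pi (fun _ => μ) =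
      ∏ _ : Fin n, ∫ y, Real.exp (f y) ∂μ := by
    simp only [e1]
    exact integral_fintype_prod_eq_prod (μ := fun _ => μ) fun _ y => Real.exp (f y)
  rw [e2]
  simp only [e1, ← Finset.prod_div_distrib]
  exact integral_fintype_prod_eq_prod (μ := fun i => μ.restrict (s i))
    fun _ y => Real.exp (f y) / ∫ y, Real.exp (f y) ∂μ

section
variable {N : ℕ} [Fact (2 ≤ N)]

instance (n : ℕ) : IsProbabilityMeasure (productMeasure N n) := by
  unfold productMeasure; infer_instance

lemma exists_unit_smul_eq (y : EuclideanSpace ℝ (Fin N)) :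
    ∃ e : EuclideanSpace ℝ (Fin N), ‖e‖ = 1 ∧ y = ‖y‖ • e := by
  rcases eq_or_ne y 0 with rfl | hy
  · exact ⟨EuclideanSpace.single 0 1, by simp, by simp⟩
  · refine ⟨‖y‖⁻¹ • y, norm_smul_inv_norm hy, ?_⟩
    rw [smul_smul, mul_inv_cancel₀ (norm_ne_zero_iff.2 hy), one_smul]

lemma integral_exp_inner_norm (y : EuclideanSpace ℝ (Fin N)) :
    ∫ σ : Sphere N, Real.exp (inner ℝ y σ.1) ∂sphereUniform N = expMoment N 0 ‖y‖ := by
  obtain ⟨e, he, hy⟩ := exists_unit_smul_eq y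
  conv_lhs => rw [hy]
  exact integral_exp_inner he _

lemma inner_totalSpin {N n : ℕ} (y : EuclideanSpace ℝ (Fin N)) (σ : Config N n) :
    inner ℝ y (totalSpin σ) = ∑ i, inner ℝ y (σ i).1 := by
  unfold totalSpin; rw [inner_sum]

lemma integral_exp_inner_totalSpin (n : ℕ) (y : EuclideanSpace ℝ (Fin N)) :
    ∫ σ : Config N n, Real.exp (inner ℝ y (totalSpin σ)) ∂productMeasure N n =
      expMoment N 0 ‖y‖ ^ n := by
  have := integral_fintype_prod_eq_pow (μ := sphereUniform N) (ι := Fin n)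
    (fun σ : Sphere N => Real.exp (inner ℝ y σ.1))
  rw [integral_exp_inner_norm, Fintype.card_fin] at this
  rw [← this]
  unfold productMeasure
  simp only [inner_totalSpin, Real.exp_sum]

/-- The joint density of the auxiliary field `y` and the spins. -/
def jointWeight {n : ℕ} (β : ℝ) (y : EuclideanSpace ℝ (Fin N)) (σ : Config N n) : ℝ :=
  Real.exp (inner ℝ y (totalSpin σ) - n * ‖y‖ ^ 2 / (2 * β))

lemma jointWeight_eq {N n : ℕ} (β : ℝ) (y : EuclideanSpace ℝ (Fin N)) (σ : Config N n) :
    jointWeight β y σ =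
      Real.exp (inner ℝ y (totalSpin σ)) * Real.exp (-(n * ‖y‖ ^ 2 / (2 * β))) := by
  unfold jointWeight; rw [← Real.exp_add]; ring_nf

lemma continuous_jointWeight {N n : ℕ} (β : ℝ) : Continuous
    fun p : EuclideanSpace ℝ (Fin N) × Config N n => jointWeight β p.1 p.2 := by
  have := continuous_totalSpin (N := N) (n := n)
  unfold jointWeight
  fun_prop

/-- Given the field, exp⟨y, S_n⟩ factors over the sites, so the spins are independent and tilted;
their normalization, with the Gaussian factor, is `fieldWeight`. -/
lemma integral_mul_jointWeight (n : ℕ) (β : ℝ) (y : EuclideanSpace ℝ (Fin N))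
    (G : Config N n → ℝ) :
    ∫ σ, jointWeight β y σ * G σ ∂productMeasure N n =
      fieldWeight N n β ‖y‖ * ∫ σ, G σ ∂Measure.pi (fun _ => tiltedSphere y) := by
  have h0 := (expMoment_zero_pos (N := N) ‖y‖).ne'
  unfold tiltedSphere
  rw [pi_tilted, integral_tilted]
  simp only [← inner_totalSpin]
  have e := integral_exp_inner_totalSpin n y
  unfold productMeasure at e ⊢
  rw [e, ← integral_const_mul]
  congr 1; ext σ
  rw [jointWeight_eq, fieldWeight, smul_eq_mul]
  field_simp

lemma integral_jointWeight (n : ℕ) (β : ℝ) (y : EuclideanSpace ℝ (Fin N)) :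
    ∫ σ : Config N n, jointWeight β y σ ∂productMeasure N n = fieldWeight N n β ‖y‖ := by
  have := integral_mul_jointWeight n β y fun _ => 1
  simpa using this

lemma integrable_pow_mul_fieldWeight {n : ℕ} (hn : 1 ≤ n) {β : ℝ} (hβ : 0 < β) (p : ℕ) :
    Integrable fun y : EuclideanSpace ℝ (Fin N) => ‖y‖ ^ p * fieldWeight N n β ‖y‖ := by
  rw [integrable_fun_norm_addHaar volume (f := fun x => x ^ p * fieldWeight N n β x)]
  simp only [smul_eq_mul, ← mul_assoc, ← pow_add]
  exact integrableOn_pow_mul_fieldWeight hn hβ _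

lemma integrable_prod_pow_mul_jointWeight {n : ℕ} (hn : 1 ≤ n) {β : ℝ} (hβ : 0 < β) (p : ℕ) :
    Integrable (fun q : EuclideanSpace ℝ (Fin N) × Config N n => ‖q.1‖ ^ p * jointWeight β q.1 q.2)
      (volume.prod (productMeasure N n)) := by
  have hc : Continuous fun q : EuclideanSpace ℝ (Fin N) × Config N n =>
      ‖q.1‖ ^ p * jointWeight β q.1 q.2 := by
    have := continuous_jointWeight (N := N) (n := n) β
    fun_prop
  rw [integrable_prod_iff hc.aestronglyMeasurable]
  refine ⟨.of_forall fun y => ?_, ?_⟩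
  · have hc' : Continuous fun σ : Config N n => ‖y‖ ^ p * jointWeight β y σ := by
      have := continuous_totalSpin (N := N) (n := n)
      unfold jointWeight
      fun_prop
    obtain ⟨C, hC⟩ := isCompact_univ.exists_bound_of_continuousOn hc'.continuousOn
    exact Integrable.of_bound hc'.aestronglyMeasurable C (.of_forall fun σ => hC σ (Set.mem_univ σ))
  · refine (integrable_pow_mul_fieldWeight hn hβ p).congr (.of_forall fun y => ?_)
    simp only
    have e : ∀ σ : Config N n, ‖‖y‖ ^ p * jointWeight β y σ‖ = ‖y‖ ^ p * jointWeight β y σ :=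
      fun σ => Real.norm_of_nonneg (mul_nonneg (by positivity) (Real.exp_pos _).le)
    simp only [e]
    rw [integral_const_mul, integral_jointWeight]

/-- Fubini for the joint weight. The power p = 0 gives the mixture representation, and p = 2 the
second moment of the field. -/
lemma integral_pow_mul_mixture {n : ℕ} (hn : 1 ≤ n) {β : ℝ} (hβ : 0 < β) (p : ℕ)
    {G : Config N n → ℝ} (hG : Measurable G) {A : ℝ} (hA : ∀ σ, |G σ| ≤ A) :
    Integrable (fun y : EuclideanSpace ℝ (Fin N) => ‖y‖ ^ p * fieldWeight N n β ‖y‖ *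
        ∫ σ, G σ ∂Measure.pi (fun _ => tiltedSphere y)) ∧
    ∫ y : EuclideanSpace ℝ (Fin N), ‖y‖ ^ p * fieldWeight N n β ‖y‖ *
        ∫ σ, G σ ∂Measure.pi (fun _ => tiltedSphere y) =
      ∫ σ, G σ * (∫ y : EuclideanSpace ℝ (Fin N), ‖y‖ ^ p * jointWeight β y σ)
        ∂productMeasure N n := by
  have hi : Integrable (fun q : EuclideanSpace ℝ (Fin N) × Config N n =>
      G q.2 * (‖q.1‖ ^ p * jointWeight β q.1 q.2)) (volume.prod (productMeasure N n)) :=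
    (integrable_prod_pow_mul_jointWeight hn hβ p).bdd_mul
      (hG.comp measurable_snd).aestronglyMeasurable (.of_forall fun q => hA q.2)
  have e : ∀ y : EuclideanSpace ℝ (Fin N), ‖y‖ ^ p * fieldWeight N n β ‖y‖ *
      ∫ σ, G σ ∂Measure.pi (fun _ => tiltedSphere y) =
      ∫ σ, G σ * (‖y‖ ^ p * jointWeight β y σ) ∂productMeasure N n := fun y => by
    rw [mul_assoc, ← integral_mul_jointWeight, ← integral_const_mul]
    congr 1; ext σ; ring
  simp only [e]
  refine ⟨hi.integral_prod_left, ?_⟩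
  rw [integral_integral_swap (f := fun (y : EuclideanSpace ℝ (Fin N)) (σ : Config N n) =>
    G σ * (‖y‖ ^ p * jointWeight β y σ)) hi]
  simp only [integral_const_mul]

/-! ### The Gaussian integral over the field -/

lemma neg_mul_hamiltonian {N n : ℕ} (β : ℝ) (σ : Config N n) :
    -β * hamiltonian σ = β / (2 * n) * ‖totalSpin σ‖ ^ 2 := by
  have : ‖totalSpin σ‖ ^ 2 = ∑ i, ∑ j, inner ℝ (σ i).1 (σ j).1 := by
    rw [← real_inner_self_eq_norm_sq]
    unfold totalSpin
    rw [sum_inner]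
    simp only [inner_sum]
  unfold hamiltonian
  rw [this]; ring

/-- The centered Gaussian density of the field, not normalized. -/
def fieldGauss (N n : ℕ) (β : ℝ) (z : EuclideanSpace ℝ (Fin N)) : ℝ :=
  Real.exp (-(n / (2 * β)) * ‖z‖ ^ 2)

/-- Completing the square: given the spins, the field is Gaussian about β times the mean spin, and
the leftover factor is the Gibbs weight. -/
lemma jointWeight_add {N n : ℕ} (hn : 1 ≤ n) {β : ℝ} (hβ : 0 < β)
    (z : EuclideanSpace ℝ (Fin N)) (σ : Config N n) : jointWeight β (z + β • meanSpin σ) σ =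
      Real.exp (-β * hamiltonian σ) * fieldGauss N n β z := by
  have hn0 : (n : ℝ) ≠ 0 := by positivity
  have hs : totalSpin σ = (n : ℝ) • meanSpin σ := by
    unfold meanSpin; rw [smul_smul, mul_inv_cancel₀ hn0, one_smul]
  unfold jointWeight fieldGauss
  rw [neg_mul_hamiltonian, ← Real.exp_add, hs]
  congr 1
  rw [norm_add_sq_real, inner_add_left, inner_smul_left, inner_smul_right, inner_smul_right,
    inner_smul_right, real_inner_self_eq_norm_sq, norm_smul, norm_smul, Real.norm_natCast,
    Real.norm_of_nonneg hβ.le, RCLike.conj_to_real]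
  field_simp
  ring

lemma fieldGauss_neg {N : ℕ} (n : ℕ) (β : ℝ) (z : EuclideanSpace ℝ (Fin N)) :
    fieldGauss N n β (-z) = fieldGauss N n β z := by
  unfold fieldGauss; rw [norm_neg]

lemma integrable_pow_mul_fieldGauss {n : ℕ} (hn : 1 ≤ n) {β : ℝ} (hβ : 0 < β) (p : ℕ) :
    Integrable fun z : EuclideanSpace ℝ (Fin N) => ‖z‖ ^ p * fieldGauss N n β z := by
  unfold fieldGauss
  rw [integrable_fun_norm_addHaar volume (f := fun x => x ^ p * Real.exp (-(n / (2 * β)) * x ^ 2))]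
  simp only [smul_eq_mul, ← mul_assoc, ← pow_add]
  have := integrableOn_rpow_mul_exp_neg_mul_sq (b := n / (2 * β)) (by positivity)
    (s := ((Module.finrank ℝ (EuclideanSpace ℝ (Fin N)) - 1 + p : ℕ) : ℝ))
    (by have := Nat.cast_nonneg (α := ℝ) (Module.finrank ℝ (EuclideanSpace ℝ (Fin N)) - 1 + p)
        linarith)
  simpa only [Real.rpow_natCast] using this

lemma integrable_fieldGauss {n : ℕ} (hn : 1 ≤ n) {β : ℝ} (hβ : 0 < β) :
    Integrable (fieldGauss N n β) := by
  simpa using integrable_pow_mul_fieldGauss (N := N) hn hβ 0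

lemma integral_fieldGauss_pos {n : ℕ} (hn : 1 ≤ n) {β : ℝ} (hβ : 0 < β) :
    0 < ∫ z, fieldGauss N n β z :=
  integral_exp_pos (integrable_fieldGauss hn hβ)

lemma integral_jointWeight_field {N n : ℕ} (hn : 1 ≤ n) {β : ℝ} (hβ : 0 < β) (σ : Config N n) :
    ∫ y, jointWeight β y σ = Real.exp (-β * hamiltonian σ) * ∫ z, fieldGauss N n β z := by
  rw [← integral_add_right_eq_self _ (β • meanSpin σ)]
  simp only [jointWeight_add hn hβ]
  rw [integral_const_mul]

lemma integral_inner_mul_fieldGauss {N : ℕ} (n : ℕ) (β : ℝ) (s : EuclideanSpace ℝ (Fin N)) :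
    ∫ z, inner ℝ z s * fieldGauss N n β z = 0 := by
  have h := integral_neg_eq_self (fun z => inner ℝ z s * fieldGauss N n β z) volume
  simp only [inner_neg_left, fieldGauss_neg, neg_mul, integral_neg] at h
  linarith

lemma continuous_fieldGauss {N : ℕ} (n : ℕ) (β : ℝ) : Continuous (fieldGauss N n β) := by
  unfold fieldGauss; fun_prop

/-- After translating the field to its conditional mean, the cross term is odd and integrates to
zero. -/
lemma integral_sq_mul_jointWeight_field {n : ℕ} (hn : 1 ≤ n) {β : ℝ} (hβ : 0 < β)
    (σ : Config N n) : ∫ y, ‖y‖ ^ 2 * jointWeight β y σ = Real.exp (-β * hamiltonian σ) *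
      ((∫ z, ‖z‖ ^ 2 * fieldGauss N n β z) +
        β ^ 2 * ‖meanSpin σ‖ ^ 2 * ∫ z, fieldGauss N n β z) := by
  set s := meanSpin σ with hs
  rw [← integral_add_right_eq_self _ (β • s)]
  have i1 := integrable_pow_mul_fieldGauss (N := N) hn hβ 2
  have i2 : Integrable fun z : EuclideanSpace ℝ (Fin N) => inner ℝ z s * fieldGauss N n β z := by
    have hc := continuous_fieldGauss (N := N) n β
    refine ((integrable_pow_mul_fieldGauss (N := N) hn hβ 1).const_mul ‖s‖).mono'
      (Continuous.aestronglyMeasurable (by fun_prop)) (.of_forall fun z => ?_)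
    have h1 := abs_real_inner_le_norm z s
    have h2 : 0 < fieldGauss N n β z := Real.exp_pos _
    rw [Real.norm_eq_abs, abs_mul, abs_of_pos h2, pow_one, ← mul_assoc, mul_comm ‖s‖]
    gcongr
  have i3 := integrable_fieldGauss (N := N) hn hβ
  have e : ∀ z, ‖z + β • s‖ ^ 2 * jointWeight β (z + β • s) σ =
      Real.exp (-β * hamiltonian σ) * ((‖z‖ ^ 2 * fieldGauss N n β z +
        2 * β * (inner ℝ z s * fieldGauss N n β z)) + β ^ 2 * ‖s‖ ^ 2 * fieldGauss N n β z) :=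
    fun z => by
      rw [hs, jointWeight_add hn hβ, ← hs, norm_add_sq_real, inner_smul_right, norm_smul,
        Real.norm_of_nonneg hβ.le]
      ring
  simp only [e]
  have i12 : Integrable fun z => ‖z‖ ^ 2 * fieldGauss N n β z +
        2 * β * (inner ℝ z s * fieldGauss N n β z) := i1.add (i2.const_mul _)
  rw [integral_const_mul, integral_add i12 (i3.const_mul _), integral_add i1 (i2.const_mul _),
    integral_const_mul (2 * β), integral_const_mul (β ^ 2 * ‖s‖ ^ 2), integral_inner_mul_fieldGauss,
    mul_zero, add_zero]

/-- The second moment of the field under `fieldGauss` is a multiple of `1 / n`. -/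
lemma integral_sq_mul_fieldGauss {n : ℕ} (hn : 1 ≤ n) {β : ℝ} (hβ : 0 < β) :
    ∫ z, ‖z‖ ^ 2 * fieldGauss N n β z = (∫ z, ‖z‖ ^ 2 * fieldGauss N 1 β z) /
      (∫ z, fieldGauss N 1 β z) / n * ∫ z, fieldGauss N n β z := by
  have hn0 : (0 : ℝ) < n := by exact_mod_cast hn
  have hr2 : √(n : ℝ) ^ 2 = n := Real.sq_sqrt hn0.le
  have h1 := (integral_fieldGauss_pos (N := N) le_rfl hβ).ne'
  have e : ∀ z, fieldGauss N 1 β (√(n : ℝ) • z) = fieldGauss N n β z := fun z => by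
    unfold fieldGauss
    rw [norm_smul, mul_pow, Real.norm_of_nonneg (Real.sqrt_nonneg _), hr2]
    congr 1
    push_cast
    ring
  have s1 := Measure.integral_comp_smul (volume : Measure (EuclideanSpace ℝ (Fin N)))
    (fieldGauss N 1 β) √n
  have s2 := Measure.integral_comp_smul (volume : Measure (EuclideanSpace ℝ (Fin N)))
    (fun z => ‖z‖ ^ 2 * fieldGauss N 1 β z) √n
  simp only [e, norm_smul, mul_pow, Real.norm_of_nonneg (Real.sqrt_nonneg _), hr2, mul_assoc,
    smul_eq_mul] at s1 s2
  rw [integral_const_mul] at s2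
  rw [s1]
  have : ∫ z, ‖z‖ ^ 2 * fieldGauss N n β z = (n * ∫ z, ‖z‖ ^ 2 * fieldGauss N n β z) / n := by
    field_simp
  rw [this, s2]
  field_simp

/-! ### Expectations under the Gibbs measure -/

lemma continuous_exp_hamiltonian {N : ℕ} (n : ℕ) (β : ℝ) :
    Continuous fun σ : Config N n => Real.exp (-β * hamiltonian σ) := by
  have := continuous_totalSpin (N := N) (n := n)
  simp only [neg_mul_hamiltonian]
  fun_prop

lemma integrable_exp_hamiltonian (n : ℕ) (β : ℝ) :
    Integrable (fun σ : Config N n => Real.exp (-β * hamiltonian σ)) (productMeasure N n) := by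
  obtain ⟨C, hC⟩ := isCompact_univ.exists_bound_of_continuousOn
    (continuous_exp_hamiltonian (N := N) n β).continuousOn
  exact Integrable.of_bound (continuous_exp_hamiltonian n β).aestronglyMeasurable C
    (.of_forall fun σ => hC σ (Set.mem_univ σ))

lemma gibbs_eq_tilted {N : ℕ} (n : ℕ) (β : ℝ) :
    gibbs N n β = (productMeasure N n).tilted fun σ => -β * hamiltonian σ := rfl

instance (n : ℕ) (β : ℝ) : IsProbabilityMeasure (gibbs N n β) := by
  rw [gibbs_eq_tilted]
  exact isProbabilityMeasure_tilted (integrable_exp_hamiltonian n β)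

lemma partitionFunction_pos (n : ℕ) (β : ℝ) : 0 < partitionFunction N n β :=
  integral_exp_pos (integrable_exp_hamiltonian n β)

lemma integral_gibbs (n : ℕ) (β : ℝ) (G : Config N n → ℝ) :
    ∫ σ, G σ * Real.exp (-β * hamiltonian σ) ∂productMeasure N n =
      partitionFunction N n β * ∫ σ, G σ ∂gibbs N n β := by
  have h0 := (partitionFunction_pos (N := N) n β).ne'
  rw [gibbs_eq_tilted, integral_tilted, ← integral_const_mul]
  congr 1; ext σ
  unfold partitionFunction at h0 ⊢
  rw [smul_eq_mul, div_mul_eq_mul_div, mul_div_cancel₀ _ h0, mul_comm]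

/-- The Hubbard–Stratonovich transformation: the Gibbs measure is a mixture of product measures. -/
lemma integral_gibbs_mixture {n : ℕ} (hn : 1 ≤ n) {β : ℝ} (hβ : 0 < β)
    {G : Config N n → ℝ} (hG : Measurable G) {A : ℝ} (hA : ∀ σ, |G σ| ≤ A) :
    ∫ y : EuclideanSpace ℝ (Fin N), fieldWeight N n β ‖y‖ *
        ∫ σ, G σ ∂Measure.pi (fun _ => tiltedSphere y) =
      (∫ y : EuclideanSpace ℝ (Fin N), fieldWeight N n β ‖y‖) * ∫ σ, G σ ∂gibbs N n β := by
  have key : ∀ {G : Config N n → ℝ}, Measurable G → (∀ {A : ℝ}, (∀ σ, |G σ| ≤ A) →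
    ∫ y : EuclideanSpace ℝ (Fin N), fieldWeight N n β ‖y‖ *
        ∫ σ, G σ ∂Measure.pi (fun _ => tiltedSphere y) =
      partitionFunction N n β * (∫ z, fieldGauss N n β z) * ∫ σ, G σ ∂gibbs N n β) := by
    intro G hG A hA
    have := (integral_pow_mul_mixture hn hβ 0 hG hA).2
    simp only [pow_zero, one_mul] at this
    rw [this]
    simp only [integral_jointWeight_field hn hβ, ← mul_assoc]
    rw [integral_mul_const, integral_gibbs]
    ring
  -- The choice G = 1 identifies the normalizing constant with the total mass of the field weight.
  have h1 := key (G := fun _ => 1) measurable_const (A := 1) (by simp)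
  simp only [integral_const, probReal_univ, smul_eq_mul, mul_one] at h1
  rw [key hG hA, h1]

/-- The squared norm of the auxiliary field corresponds to the squared norm of the mean spin. -/
lemma integral_gibbs_mixture_sq {n : ℕ} (hn : 1 ≤ n) {β : ℝ} (hβ : 0 < β)
    {G : Config N n → ℝ} (hG : Measurable G) {A : ℝ} (hA : ∀ σ, |G σ| ≤ A) :
    ∫ y : EuclideanSpace ℝ (Fin N), ‖y‖ ^ 2 * fieldWeight N n β ‖y‖ *
        ∫ σ, G σ ∂Measure.pi (fun _ => tiltedSphere y) =
      (∫ y : EuclideanSpace ℝ (Fin N), fieldWeight N n β ‖y‖) *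
        ∫ σ, G σ * (β ^ 2 * ‖meanSpin σ‖ ^ 2 + (∫ z, ‖z‖ ^ 2 * fieldGauss N 1 β z) /
          (∫ z, fieldGauss N 1 β z) / n) ∂gibbs N n β := by
  have h1 := integral_gibbs_mixture (N := N) hn hβ (G := fun _ => 1) measurable_const (A := 1)
    (by simp)
  have h2 := (integral_pow_mul_mixture (N := N) hn hβ 0 (G := fun _ => 1) measurable_const (A := 1)
    (by simp)).2
  simp only [pow_zero, one_mul, integral_jointWeight_field hn hβ] at h2
  rw [h1, integral_mul_const] at h2
  simp only [integral_const, probReal_univ, smul_eq_mul, mul_one] at h2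
  rw [(integral_pow_mul_mixture hn hβ 2 hG hA).2, h2]
  simp only [integral_sq_mul_jointWeight_field hn hβ, integral_sq_mul_fieldGauss hn hβ]
  have := integral_gibbs n β fun σ : Config N n => G σ * (β ^ 2 * ‖meanSpin σ‖ ^ 2 +
    (∫ z, ‖z‖ ^ 2 * fieldGauss N 1 β z) / (∫ z, fieldGauss N 1 β z) / n)
  unfold partitionFunction at this
  rw [mul_right_comm, ← this, ← integral_mul_const]
  congr 1; ext σ
  generalize Real.exp (-β * hamiltonian σ) = E
  ring

end

/-! ### Averaging over the field: Stein's identity under the Gibbs measure -/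

section
variable {N : ℕ} [Fact (2 ≤ N)]

/-- The norm of the auxiliary field concentrates at the mean-field solution. -/
lemma exists_field_concentration {β b : ℝ} (hb : 0 < b) (hβ : 0 < β) (h : b = β * tiltMean N b) :
    ∃ C, 0 < C ∧ ∀ n : ℕ, 1 ≤ n →
      ∫ y : EuclideanSpace ℝ (Fin N), (‖y‖ - b) ^ 2 * fieldWeight N n β ‖y‖ ≤
        C / n * ∫ y : EuclideanSpace ℝ (Fin N), fieldWeight N n β ‖y‖ := by
  obtain ⟨C, hC, hc⟩ := exists_radial_concentration hb hβ h
  refine ⟨C, hC, fun n hn => ?_⟩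
  rw [integral_fun_norm_addHaar volume fun x => (x - b) ^ 2 * fieldWeight N n β x,
    integral_fun_norm_addHaar volume fun x => fieldWeight N n β x, finrank_euclideanSpace,
    Fintype.card_fin]
  simp only [smul_eq_mul, nsmul_eq_mul]
  have := mul_le_mul_of_nonneg_left (hc n hn) (a := (N : ℝ) *
    (volume : Measure (EuclideanSpace ℝ (Fin N))).real (Metric.ball 0 1)) (by positivity)
  calc _ = _ := by ring
    _ ≤ _ := this
    _ = _ := by ring

/-- The Stein equation for `W_n` under the Gibbs measure. -/
lemma gibbs_stein {β b : ℝ} (hb : 0 < b) (hβ : 0 < β) (h : b = β * tiltMean N b) :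
    ∃ C, 0 < C ∧ ∀ n : ℕ, 1 ≤ n → ∀ (K z : ℝ) (g g' : ℝ → ℝ), SteinPair K z g g' →
      |∫ σ : Config N n, ((1 - β * tiltVar N b) * (rescaledSpin β b σ * g (rescaledSpin β b σ)) -
        (2 * (β / b)) ^ 2 * tiltVar N b * g' (rescaledSpin β b σ)) ∂gibbs N n β| ≤
      C * K / √n := by
  obtain ⟨C₁, hC₁, h₁⟩ := fixed_field_estimate hb hβ h
  obtain ⟨C₂, hC₂, h₂⟩ := exists_field_concentration hb hβ h
  set m := (∫ z, ‖z‖ ^ 2 * fieldGauss N 1 β z) / (∫ z, fieldGauss N 1 β z) with hm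
  have hm0 : 0 ≤ m := div_nonneg (integral_nonneg fun z => mul_nonneg (sq_nonneg _)
    (Real.exp_pos _).le) (integral_fieldGauss_pos le_rfl hβ).le
  have hv0 := tiltVar_pos (N := N) b
  set v := tiltVar N b
  set κ := β * v / b ^ 2 with hκ
  have hκ0 : 0 < κ := by positivity
  refine ⟨C₁ * (1 + C₂) + κ * m, by positivity, fun n hn K z g g' hg => ?_⟩
  have hK := hg.nonneg
  have hn0 : (0 : ℝ) < n := by exact_mod_cast hn
  have h₁ := fun e he x => h₁ n hn e he x K z g g' hg
  have h₂ := h₂ n hn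
  have hr2 : √(n : ℝ) ^ 2 = n := Real.sq_sqrt hn0.le
  have hWe : ∀ σ : Config N n, b ^ 2 * rescaledSpin β b σ =
      √n * (β ^ 2 * ‖meanSpin σ‖ ^ 2 - b ^ 2) := fun σ => by
    rw [rescaledSpin_eq]; field_simp
  have hcW := continuous_rescaledSpin (N := N) (n := n) β b
  have hcm := continuous_meanSpin (N := N) (n := n)
  obtain ⟨A, hA⟩ := isCompact_univ.exists_bound_of_continuousOn hcW.continuousOn
  replace hA : ∀ σ, |rescaledSpin β b σ| ≤ A := fun σ => hA σ (Set.mem_univ σ)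
  set W : Config N n → ℝ := rescaledSpin β b with hW
  have hWm : Measurable W := hcW.measurable
  set r := √(n : ℝ) with hr
  have hr0 : 0 < r := Real.sqrt_pos.2 hn0
  have hgm : Measurable fun σ => g (W σ) := hg.meas.comp hWm
  have hgm' : Measurable fun σ => g' (W σ) := hg.meas_deriv.comp hWm
  -- The constant part κ√n b² is absorbed here, so that the remaining dependence on the field is a
  -- multiple of |y|² alone.
  set G₀ : Config N n → ℝ := fun σ => W σ * g (W σ) + κ * r * b ^ 2 * g (W σ) -
    (2 * (β / b)) ^ 2 * v * g' (W σ) with hG₀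
  have hG₀m : Measurable G₀ := ((hWm.mul hgm).add (hgm.const_mul _)).sub (hgm'.const_mul _)
  have hG₀b : ∀ σ, |G₀ σ| ≤ A * K + κ * r * b ^ 2 * K + (2 * (β / b)) ^ 2 * v * K := fun σ => by
    refine (abs_sub _ _).trans (add_le_add ((abs_add_le _ _).trans (add_le_add ?_ ?_)) ?_)
    · rw [abs_mul]
      exact mul_le_mul (hA σ) (hg.bound _) (abs_nonneg _) ((abs_nonneg _).trans (hA σ))
    · rw [abs_mul, abs_of_nonneg (by positivity)]; gcongr; exact hg.bound _
    · rw [abs_mul, abs_of_nonneg (by positivity)]; gcongr; exact hg.bound_deriv _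
  have hfi : Integrable fun y : EuclideanSpace ℝ (Fin N) => fieldWeight N n β ‖y‖ := by
    simpa using integrable_pow_mul_fieldWeight (N := N) hn hβ 0
  have hsi : Integrable fun y : EuclideanSpace ℝ (Fin N) =>
      (‖y‖ - b) ^ 2 * fieldWeight N n β ‖y‖ := by
    have i1 := integrable_pow_mul_fieldWeight (N := N) hn hβ 1
    have i2 := integrable_pow_mul_fieldWeight (N := N) hn hβ 2
    refine ((i2.sub (i1.const_mul (2 * b))).add (hfi.const_mul (b ^ 2))).congr
      (.of_forall fun y => ?_)
    simp only [Pi.add_apply, Pi.sub_apply]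
    ring
  set F := ∫ y : EuclideanSpace ℝ (Fin N), fieldWeight N n β ‖y‖ with hF
  have hF0 : 0 < F := by
    rw [hF, integral_pos_iff_support_of_nonneg (fun y => (fieldWeight_pos n β _).le) hfi,
      Function.support_eq_univ fun y => (fieldWeight_pos n β ‖y‖).ne']
    exact Measure.measure_univ_pos.2 (NeZero.ne _)
  have j0 : Integrable fun y : EuclideanSpace ℝ (Fin N) => fieldWeight N n β ‖y‖ *
      ∫ σ, G₀ σ ∂Measure.pi (fun _ => tiltedSphere y) := by
    simpa using (integral_pow_mul_mixture (N := N) hn hβ 0 hG₀m hG₀b).1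
  have j2 := (integral_pow_mul_mixture (N := N) hn hβ 2 hgm fun σ => hg.bound _).1
  have k0 := integral_gibbs_mixture (N := N) hn hβ hG₀m hG₀b
  have k2 := integral_gibbs_mixture_sq (N := N) hn hβ hgm fun σ => hg.bound _
  rw [← hm] at k2
  have hint : ∀ (P : Measure (Config N n)) [IsProbabilityMeasure P] (f : Config N n → ℝ),
      Continuous f → Integrable (fun σ => g (W σ) * f σ) P := fun P _ f hf => by
    obtain ⟨B, hB⟩ := isCompact_univ.exists_bound_of_continuousOn hf.continuousOn
    exact integrable_of_abs_le (hgm.mul hf.measurable) (C := K * B) fun σ => by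
      rw [abs_mul]
      exact mul_le_mul (hg.bound _) (hB σ (Set.mem_univ σ)) (abs_nonneg _) hK
  have hG₀i : ∀ (P : Measure (Config N n)) [IsProbabilityMeasure P], Integrable G₀ P :=
    fun P _ => integrable_of_abs_le hG₀m hG₀b
  have hgi : ∀ (P : Measure (Config N n)) [IsProbabilityMeasure P],
      Integrable (fun σ => g (W σ)) P := fun P _ => integrable_of_abs_le hgm fun σ => hg.bound _
  have hgi' : ∀ (P : Measure (Config N n)) [IsProbabilityMeasure P],
      Integrable (fun σ => g' (W σ)) P := fun P _ =>
    integrable_of_abs_le hgm' fun σ => hg.bound_deriv _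
  have hfield : ∀ y : EuclideanSpace ℝ (Fin N),
      |fieldWeight N n β ‖y‖ * ∫ σ, G₀ σ ∂Measure.pi (fun _ => tiltedSphere y) - κ * r *
        (‖y‖ ^ 2 * fieldWeight N n β ‖y‖ * ∫ σ, g (W σ) ∂Measure.pi (fun _ => tiltedSphere y))| ≤
      C₁ * K * (1 / r) * fieldWeight N n β ‖y‖ +
        C₁ * K * r * ((‖y‖ - b) ^ 2 * fieldWeight N n β ‖y‖) := fun y => by
    obtain ⟨e, he, hy⟩ := exists_unit_smul_eq y
    have := h₁ e he ‖y‖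
    rw [← hy] at this
    have e1 : ∀ σ, W σ * g (W σ) - κ * r * (‖y‖ ^ 2 - b ^ 2) * g (W σ) -
        (2 * (β / b)) ^ 2 * v * g' (W σ) = G₀ σ - κ * r * ‖y‖ ^ 2 * g (W σ) := fun σ => by
      simp only [hG₀]; ring
    simp only [e1] at this
    rw [integral_sub (hG₀i _) ((hgi _).const_mul _), integral_const_mul] at this
    have e2 : fieldWeight N n β ‖y‖ * ∫ σ, G₀ σ ∂Measure.pi (fun _ => tiltedSphere y) - κ * r *
        (‖y‖ ^ 2 * fieldWeight N n β ‖y‖ * ∫ σ, g (W σ) ∂Measure.pi (fun _ => tiltedSphere y)) =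
        fieldWeight N n β ‖y‖ * (∫ σ, G₀ σ ∂Measure.pi (fun _ => tiltedSphere y) - κ * r *
        ‖y‖ ^ 2 * ∫ σ, g (W σ) ∂Measure.pi (fun _ => tiltedSphere y)) := by ring
    rw [e2, abs_mul, abs_of_pos (fieldWeight_pos _ _ _)]
    calc _ ≤ fieldWeight N n β ‖y‖ * (C₁ * K * (1 / r + r * (‖y‖ - b) ^ 2)) :=
          mul_le_mul_of_nonneg_left this (fieldWeight_pos _ _ _).le
      _ = _ := by ring
  have hI : |F * ∫ σ, G₀ σ ∂gibbs N n β - κ * r * (F * ∫ σ, g (W σ) *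
      (β ^ 2 * ‖meanSpin σ‖ ^ 2 + m / n) ∂gibbs N n β)| ≤ F * (C₁ * (1 + C₂) * K / r) := by
    rw [← k0, ← k2, ← integral_const_mul, ← integral_sub j0 (j2.const_mul _)]
    refine abs_integral_le_integral_abs.trans ((integral_mono (j0.sub (j2.const_mul _)).abs
      ((hfi.const_mul _).add (hsi.const_mul _)) hfield).trans ?_)
    rw [integral_add' (hfi.const_mul _) (hsi.const_mul _), integral_const_mul, integral_const_mul]
    calc _ ≤ C₁ * K * (1 / r) * F + C₁ * K * r * (C₂ / n * F) := by gcongr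
      _ = _ := by rw [← hr2]; field_simp
  -- The averaged |y|² equals β² times the squared norm of the mean spin plus m/n. Since b²W is √n
  -- times that first term minus b², the field contribution is βv W g(W), which produces the factor
  -- 1 - βv; the rest is the error κ m/√n.
  have e3 : ∀ σ, (1 - β * v) * (W σ * g (W σ)) - (2 * (β / b)) ^ 2 * v * g' (W σ) =
      G₀ σ - κ * r * (g (W σ) * (β ^ 2 * ‖meanSpin σ‖ ^ 2 + m / n)) + κ * m / r * g (W σ) :=
    fun σ => by
      have e4 : β * v * W σ = κ * (b ^ 2 * W σ) := by rw [hκ]; field_simp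
      have e5 : (1 - β * v) * (W σ * g (W σ)) = W σ * g (W σ) - β * v * W σ * g (W σ) := by ring
      have e6 : κ * m / r = κ * r * (m / n) := by rw [← hr2]; field_simp
      rw [e5, e4, hWe, e6]
      simp only [hG₀]
      ring
  simp only [e3]
  have i3 := hint (gibbs N n β) (fun σ => β ^ 2 * ‖meanSpin σ‖ ^ 2 + m / n) (by fun_prop)
  have i4 : Integrable (fun σ => G₀ σ - κ * r * (g (W σ) * (β ^ 2 * ‖meanSpin σ‖ ^ 2 + m / n)))
    (gibbs N n β) := (hG₀i _).sub (i3.const_mul _)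
  rw [integral_add i4 ((hgi _).const_mul _), integral_sub (hG₀i _) (i3.const_mul _),
    integral_const_mul, integral_const_mul (κ * m / r)]
  have b1 : |∫ σ, G₀ σ ∂gibbs N n β - κ * r * ∫ σ, g (W σ) *
      (β ^ 2 * ‖meanSpin σ‖ ^ 2 + m / n) ∂gibbs N n β| ≤ C₁ * (1 + C₂) * K / r := by
    refine le_of_mul_le_mul_left ?_ hF0
    refine le_trans (le_of_eq ?_) hI
    rw [← abs_of_pos hF0, ← abs_mul, abs_of_pos hF0]
    congr 1
    ring
  have b2 : |κ * m / r * ∫ σ, g (W σ) ∂gibbs N n β| ≤ κ * m / r * K := by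
    rw [abs_mul, abs_of_nonneg (by positivity)]
    gcongr
    have := norm_integral_le_of_norm_le_const (μ := gibbs N n β) (C := K)
      (f := fun σ => g (W σ)) (.of_forall fun σ => hg.bound _)
    simpa using this
  calc _ ≤ C₁ * (1 + C₂) * K / r + κ * m / r * K := (abs_add_le _ _).trans (add_le_add b1 b2)
    _ = _ := by ring

end

/-! ### The normalized statistic and the two distances -/

section
variable {N : ℕ} [Fact (2 ≤ N)]

lemma besselRatio_eq_tiltMean {x : ℝ} (hx : 0 < x) : besselRatio N x = tiltMean N x :=
  besselRatio_eq hx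

lemma hasDerivAt_besselRatio {x : ℝ} (hx : 0 < x) :
    HasDerivAt (besselRatio N) (tiltVar N x) x := by
  refine (hasDerivAt_tiltMean x).congr_of_eventuallyEq ?_
  filter_upwards [Ioi_mem_nhds hx] with y hy
  exact besselRatio_eq_tiltMean hy

/-- The Riccati identity turns the bracket into the derivative of the Bessel ratio at b. -/
lemma varianceConst_eq (β : ℝ) {b : ℝ} (hb : 0 < b) : varianceConst N β b =
    4 * β ^ 2 / ((1 - β * tiltVar N b) * b ^ 2) * tiltVar N b := by
  unfold varianceConst
  rw [(hasDerivAt_besselRatio hb).deriv, besselRatio_eq_tiltMean hb, ← tiltVar_riccati hb.ne']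

lemma varianceConst_pos {β b : ℝ} (hb : 0 < b) (hβ : 0 < β) (h : b = β * tiltMean N b) :
    0 < varianceConst N β b := by
  have h1 := tiltVar_pos (N := N) b
  have h2 : 0 < 1 - β * tiltVar N b := by linarith [mul_tiltVar_lt_one hb hβ h]
  rw [varianceConst_eq β hb]
  positivity

/-- Stein's characterization holds approximately for the normalized statistic. -/
lemma gibbs_stein_normalized {β b : ℝ} (hb : 0 < b) (hβ : 0 < β) (h : b = β * tiltMean N b) :
    ∃ C, 0 < C ∧ ∀ n : ℕ, 1 ≤ n → ∀ (K z : ℝ) (g g' : ℝ → ℝ), SteinPair K z g g' →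
      |∫ σ : Config N n, (g' (rescaledSpin β b σ / √(varianceConst N β b)) -
        rescaledSpin β b σ / √(varianceConst N β b) *
          g (rescaledSpin β b σ / √(varianceConst N β b))) ∂gibbs N n β| ≤ C * K / √n := by
  obtain ⟨C, hC, hst⟩ := gibbs_stein hb hβ h
  have hB2 := varianceConst_pos hb hβ h
  have hBv := varianceConst_eq (N := N) β hb
  have h2 : 0 < 1 - β * tiltVar N b := by linarith [mul_tiltVar_lt_one hb hβ h]
  have hsq := Real.sq_sqrt hB2.le
  set v := tiltVar N b
  set B := √(varianceConst N β b) with hB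
  have hB0 : 0 < B := Real.sqrt_pos.2 hB2
  refine ⟨C * (1 + 1 / B) ^ 3 / ((1 - β * v) * B), by positivity, fun n hn K z g g' hg => ?_⟩
  have hk := hst n hn _ _ _ _ (hg.comp_div hB0)
  have e : ∀ σ : Config N n, (1 - β * v) * (rescaledSpin β b σ * g (rescaledSpin β b σ / B)) -
      (2 * (β / b)) ^ 2 * v * (g' (rescaledSpin β b σ / B) / B) =
      -((1 - β * v) * B) * (g' (rescaledSpin β b σ / B) - rescaledSpin β b σ / B *
        g (rescaledSpin β b σ / B)) := fun σ => by
    -- B² is the value for which both terms of the Gibbs Stein identity carry the common factor (1 -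
    -- βv)B after rescaling.
    have e1 : (2 * (β / b)) ^ 2 * v = (1 - β * v) * B ^ 2 := by
      rw [hsq, hBv]; field_simp; ring
    rw [e1]; field_simp; ring
  simp only [e] at hk
  rw [integral_const_mul, abs_mul, abs_neg, abs_of_pos (by positivity : 0 < (1 - β * v) * B)] at hk
  rw [div_mul_eq_mul_div, div_right_comm, le_div_iff₀ (by positivity), mul_comm]
  refine hk.trans (le_of_eq (by ring))

lemma rpow_neg_half (n : ℕ) : (n : ℝ) ^ (-(1 / 2) : ℝ) = 1 / √n := by
  rw [Real.rpow_neg (Nat.cast_nonneg n), ← Real.sqrt_eq_rpow, one_div]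

/-- The normal approximation in Wasserstein and Kolmogorov distance in a fixed dimension. -/
lemma gibbs_normal_approximation {β b : ℝ} (hb : 0 < b) (hβ : 0 < β) (h : b = β * tiltMean N b) :
    ∃ C, 0 < C ∧ ∀ n : ℕ, 1 ≤ n →
      wassersteinDist ((gibbs N n β).map fun σ => rescaledSpin β b σ / √(varianceConst N β b))
        (gaussianReal 0 1) ≤ ENNReal.ofReal (C * (n : ℝ) ^ (-(1 / 2) : ℝ)) ∧
      kolmogorovDist ((gibbs N n β).map fun σ => rescaledSpin β b σ / √(varianceConst N β b))
        (gaussianReal 0 1) ≤ ENNReal.ofReal (C * (n : ℝ) ^ (-(1 / 2) : ℝ)) := by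
  obtain ⟨C, hC, hst⟩ := gibbs_stein_normalized hb hβ h
  -- The factor 4 is the constant of the Stein pairs, common to indicators and Lipschitz functions.
  refine ⟨C * 4, by positivity, fun n hn => ?_⟩
  have hst := hst n hn
  have hUc : Continuous fun σ : Config N n => rescaledSpin β b σ / √(varianceConst N β b) :=
    (continuous_rescaledSpin β b).div_const _
  set U : Config N n → ℝ := fun σ => rescaledSpin β b σ / √(varianceConst N β b) with hU
  rw [rpow_neg_half, mul_one_div]
  constructor
  · refine iSup₂_le fun k hk => ENNReal.ofReal_le_ofReal ?_
    obtain ⟨g, g', hg, hgs⟩ := exists_steinPair_lipschitz hk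
    refine le_trans (le_of_eq ?_) (hst 4 0 g g' hg)
    have hi : Integrable (fun σ => k (U σ)) (gibbs N n β) := by
      have hc : Continuous fun σ => k (U σ) := hk.continuous.comp hUc
      obtain ⟨A, hA⟩ := isCompact_univ.exists_bound_of_continuousOn hc.continuousOn
      exact integrable_of_abs_le hc.measurable fun σ => hA σ (Set.mem_univ σ)
    rw [integral_map hUc.aemeasurable hk.continuous.aestronglyMeasurable]
    have e : ∀ σ : Config N n, g' (rescaledSpin β b σ / √(varianceConst N β b)) -
        rescaledSpin β b σ / √(varianceConst N β b) *
          g (rescaledSpin β b σ / √(varianceConst N β b)) =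
        k (U σ) - ∫ y, k y ∂gaussianReal 0 1 := fun σ => hgs (U σ)
    simp only [e]
    rw [integral_sub hi (integrable_const _)]
    simp
  · refine iSup_le fun z => ENNReal.ofReal_le_ofReal ?_
    obtain ⟨g, g', hg, hgs⟩ := exists_steinPair_indicator z
    refine le_trans (le_of_eq ?_) (hst 4 z g g' hg)
    have e : ∀ σ : Config N n, g' (rescaledSpin β b σ / √(varianceConst N β b)) -
        rescaledSpin β b σ / √(varianceConst N β b) *
          g (rescaledSpin β b σ / √(varianceConst N β b)) =
        Set.indicator (U ⁻¹' Set.Iic z) 1 σ - (gaussianReal 0 1).real (Set.Iic z) :=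
      fun σ => hgs (U σ)
    have hm : MeasurableSet (U ⁻¹' Set.Iic z) := hUc.measurable measurableSet_Iic
    simp only [e]
    have hi : Integrable (fun σ => (U ⁻¹' Set.Iic z).indicator (1 : Config N n → ℝ) σ)
        (gibbs N n β) := (integrable_const (1 : ℝ)).indicator hm
    rw [integral_sub hi (integrable_const _),
      integral_indicator_one hm, map_measureReal_apply hUc.measurable measurableSet_Iic]
    simp

end

end ONModel

end

theorem theorem1p1 (β : ℝ) :
    ∃ C : ℝ, 0 < C ∧
      ∀ N : ℕ, 2 ≤ N → (N : ℝ) < β →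
        ∃ b : ℝ,
          (0 < b ∧ b - β * ONModel.besselRatio N b = 0) ∧
          (∀ x : ℝ, 0 < x → x - β * ONModel.besselRatio N x = 0 → x = b) ∧
          DifferentiableAt ℝ (ONModel.besselRatio N) b ∧
          0 < ONModel.varianceConst N β b ∧
          ∀ n : ℕ, 1 ≤ n →
            ONModel.wassersteinDist
                ((ONModel.gibbs N n β).map fun σ =>
                  ONModel.rescaledSpin β b σ / Real.sqrt (ONModel.varianceConst N β b))
                (gaussianReal 0 1)
              ≤ ENNReal.ofReal (C * (n : ℝ) ^ (-(1 / 2) : ℝ)) ∧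
            ONModel.kolmogorovDist
                ((ONModel.gibbs N n β).map fun σ =>
                  ONModel.rescaledSpin β b σ / Real.sqrt (ONModel.varianceConst N β b))
                (gaussianReal 0 1)
              ≤ ENNReal.ofReal (C * (n : ℝ) ^ (-(1 / 2) : ℝ)) := by
  have H : ∀ N : ℕ, ∃ C : ℝ, 0 < C ∧ (2 ≤ N → (N : ℝ) < β → ∃ b : ℝ,
      (0 < b ∧ b - β * ONModel.besselRatio N b = 0) ∧
      (∀ x : ℝ, 0 < x → x - β * ONModel.besselRatio N x = 0 → x = b) ∧
      DifferentiableAt ℝ (ONModel.besselRatio N) b ∧ 0 < ONModel.varianceConst N β b ∧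
      ∀ n : ℕ, 1 ≤ n →
        ONModel.wassersteinDist ((ONModel.gibbs N n β).map fun σ =>
          ONModel.rescaledSpin β b σ / Real.sqrt (ONModel.varianceConst N β b))
          (gaussianReal 0 1) ≤ ENNReal.ofReal (C * (n : ℝ) ^ (-(1 / 2) : ℝ)) ∧
        ONModel.kolmogorovDist ((ONModel.gibbs N n β).map fun σ =>
          ONModel.rescaledSpin β b σ / Real.sqrt (ONModel.varianceConst N β b))
          (gaussianReal 0 1) ≤ ENNReal.ofReal (C * (n : ℝ) ^ (-(1 / 2) : ℝ))) := by
    intro N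
    by_cases hN : 2 ≤ N ∧ (N : ℝ) < β
    · obtain ⟨h2, hβ⟩ := hN
      have : Fact (2 ≤ N) := ⟨h2⟩
      have hβ0 : 0 < β := (Nat.cast_nonneg N).trans_lt hβ
      obtain ⟨b, hb, h⟩ := ONModel.exists_meanField hβ
      obtain ⟨C, hC, hd⟩ := ONModel.gibbs_normal_approximation hb hβ0 h
      refine ⟨C, hC, fun _ _ => ⟨b, ⟨hb, ?_⟩, fun x hx hx0 => ?_,
        (ONModel.hasDerivAt_besselRatio hb).differentiableAt,
        ONModel.varianceConst_pos hb hβ0 h, hd⟩⟩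
      · rw [ONModel.besselRatio_eq_tiltMean hb, ← h, sub_self]
      · rw [ONModel.besselRatio_eq_tiltMean hx] at hx0
        exact ONModel.meanField_unique hx hb (sub_eq_zero.1 hx0) h
    · exact ⟨1, one_pos, fun h2 hβ => absurd ⟨h2, hβ⟩ hN⟩
  choose C hC hN using H
  -- Only the finitely many N < β matter, so the sum of their constants depends on β alone; the
  -- extra 1 keeps it positive when there are none.
  refine ⟨∑ N ∈ Finset.range ⌈β⌉₊, C N + 1,
    add_pos_of_nonneg_of_pos (Finset.sum_nonneg fun N _ => (hC N).le) one_pos,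
    fun N h2 hβ => ?_⟩
  obtain ⟨b, h1, h3, h4, h5, h6⟩ := hN N h2 hβ
  have hle : C N ≤ ∑ N ∈ Finset.range ⌈β⌉₊, C N + 1 :=
    (Finset.single_le_sum (fun N _ => (hC N).le) (Finset.mem_range.2 (Nat.lt_ceil.2 hβ))).trans
      (le_add_of_nonneg_right zero_le_one)
  have hmono : ∀ n : ℕ, ENNReal.ofReal (C N * (n : ℝ) ^ (-(1 / 2) : ℝ)) ≤
      ENNReal.ofReal ((∑ N ∈ Finset.range ⌈β⌉₊, C N + 1) * (n : ℝ) ^ (-(1 / 2) : ℝ)) := fun n =>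
    ENNReal.ofReal_le_ofReal (mul_le_mul_of_nonneg_right hle (by positivity))
  exact ⟨b, h1, h3, h4, h5, fun n hn =>
    ⟨(h6 n hn).1.trans (hmono n), (h6 n hn).2.trans (hmono n)⟩⟩
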